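/- **Setting.** Let $\mathcal H_A=\mathbb C^{d_A}$ and $\mathcal H_B=\mathbb C^{d_B}$. A state is a positive semidefinite operator of trace one. A state $\rho$ on $\mathcal H_A\otimes\mathcal H_B$ is *separable* if it is a finite convex combination $\rho=\sum_i p_i\,|\psi_i\rangle\langle\psi_i|\otimes|\phi_i\rangle\langle\phi_i|$ with unit vectors $\psi_i\in\mathcal H_A$, $\phi_i\in\mathcal H_B$; otherwise it is *entangled*. It is *PPT entangled* if it is entangled and its partial transpose $\rho^{T_A}$ is positive semidefinite. For $k\ge 1$, a *PPT symmetric extension of $\rho$ to $k$ copies of $A$* is a state $\tilde\rho$ on $\mathcal H_A^{\otimes k}\otimes\mathcal H_B$ that (i) is invariant under conjugation by the swap of any two copies of $A$, (ii) yields $\rho$ when any $k-1$ copies of $A$ are traced out, and (iii) has positive semidefinite partial transposes with respect to every subset of the $k+1$ parties. The state $\rho$ *passes the $k$-th test* if it has such an extension; let $P_k$ be the set of states on $\mathcal H_A\otimes\mathcal H_B$ that pass the $k$-th test. The hierarchy *collapses to finitely many steps* if there is $n\ge1$ with $P_m=P_n$ for all $m\ge n$. **Theorem (non-collapse of the hierarchy).**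 1. If there exists a PPT entangled state on $\mathcal H_A\otimes\mathcal H_B$, then for every $k\ge 1$ there is an entangled state on $\mathcal H_A\otimes\mathcal H_B$ that passes the $k$-th test. 2. If $d_A\ge 2$, $d_B\ge 2$ and $d_A d_B>6$, then for every $k\ge1$ there is an entangled state on $\mathcal H_A\otimes\mathcal H_B$ that passes each of the first $k$ tests, and the hierarchy does not collapse to finitely many steps. -/

import Mathlib

open Matrix
open scoped ComplexOrder Kronecker

namespace PPTHierarchy

/-- A (mixed) quantum state on the Hilbert space with orthonormal basis indexed by `n`:
a positive semidefinite matrix of trace one. -/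
def IsState {n : Type*} [Fintype n] (ρ : Matrix n n ℂ) : Prop :=
  ρ.PosSemidef ∧ ρ.trace = 1

/-- The rank-one operator `|v⟩⟨v|`. -/
def ketBra {n : Type*} (v : n → ℂ) : Matrix n n ℂ :=
  vecMulVec v (star v)

/-- Separability of a bipartite operator: `ρ = ∑ i, p i |ψ i⟩⟨ψ i| ⊗ |φ i⟩⟨φ i|`, a (finite) convex
combination of projectors onto product unit vectors. -/
def IsSeparable {α β : Type*} [Fintype α] [Fintype β]
    (ρ : Matrix (α × β) (α × β) ℂ) : Prop :=
  ∃ (N : ℕ) (p : Fin N → ℝ) (ψ : Fin N → α → ℂ) (φ : Fin N → β → ℂ),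
    (∀ i, 0 < p i) ∧ ∑ i, p i = 1 ∧
    (∀ i, star (ψ i) ⬝ᵥ ψ i = 1) ∧ (∀ i, star (φ i) ⬝ᵥ φ i = 1) ∧
    ρ = ∑ i, (p i : ℂ) • (ketBra (ψ i) ⊗ₖ ketBra (φ i))

/-- An entangled state: a bipartite state that is not separable. -/
def IsEntangled {α β : Type*} [Fintype α] [Fintype β]
    (ρ : Matrix (α × β) (α × β) ℂ) : Prop :=
  IsState ρ ∧ ¬ IsSeparable ρ

/-- The partial transpose `ρ^{T_A}` of a bipartite operator: `ρ^{T_A}_{ik,jl} = ρ_{jk,il}`. -/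
def partialTransposeA {α β : Type*} (ρ : Matrix (α × β) (α × β) ℂ) :
    Matrix (α × β) (α × β) ℂ :=
  Matrix.of fun x y => ρ (y.1, x.2) (x.1, y.2)

/-- A PPT entangled state: an entangled state with positive partial transpose. -/
def IsPPTEntangled {α β : Type*} [Fintype α] [Fintype β]
    (ρ : Matrix (α × β) (α × β) ℂ) : Prop :=
  IsEntangled ρ ∧ (partialTransposeA ρ).PosSemidef

/-- Operators on `H_A^{⊗ k} ⊗ H_B`. A basis vector is indexed by a pair `(x, b)`, where `x i` is the
index in the `i`-th copy of `A` and `b` is the index in `B`. -/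
abbrev ExtOp (k : ℕ) (α β : Type*) : Type _ :=
  Matrix ((Fin k → α) × β) ((Fin k → α) × β) ℂ

/-- The partial transpose with respect to an arbitrary subset `s` of the parties; the party `some i`
is the `i`-th copy of `A`, and the party `none` is `B`. -/
def partialTranspose {k : ℕ} {α β : Type*} (s : Finset (Option (Fin k)))
    (M : ExtOp k α β) : ExtOp k α β :=
  Matrix.of fun x y =>
    M (fun i => if some i ∈ s then y.1 i else x.1 i, if none ∈ s then y.2 else x.2)
      (fun i => if some i ∈ s then x.1 i else y.1 i, if none ∈ s then x.2 else y.2)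

/-- Conjugation `P M P` by the swap operator `P` that interchanges the copies `i` and `j` of `A`. -/
def swapCopies {k : ℕ} {α β : Type*} (i j : Fin k) (M : ExtOp k α β) : ExtOp k α β :=
  M.submatrix (fun x => (x.1 ∘ Equiv.swap i j, x.2)) (fun x => (x.1 ∘ Equiv.swap i j, x.2))

/-- The partial trace over all copies of `A` except the `i`-th one, an operator on `H_A ⊗ H_B`.
The sum is over the common indices of the copies that are traced out: `z` runs over all index
tuples whose `i`-th entry is the row index of the remaining copy. -/
def traceOutAllBut {k : ℕ} {α β : Type*} [Fintype α] [DecidableEq α] (i : Fin k)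
    (M : ExtOp k α β) : Matrix (α × β) (α × β) ℂ :=
  Matrix.of fun x y =>
    ∑ z : Fin k → α with z i = x.1, M (z, x.2) (Function.update z i y.1, y.2)

/-- `σ` is a PPT symmetric extension of `ρ` to `k` copies of party `A`: a state that is symmetric
under interchanges of any two copies of `A`, yields `ρ` when any `k - 1` copies of `A` are traced
out, and remains positive under all possible partial transpositions. -/
structure IsPPTSymmetricExtension {α β : Type*} [Fintype α] [DecidableEq α] [Fintype β]
    (k : ℕ) (ρ : Matrix (α × β) (α × β) ℂ) (σ : ExtOp k α β) : Prop where
  isState : IsState σ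
  symmetric : ∀ i j : Fin k, swapCopies i j σ = σ
  extends_state : ∀ i : Fin k, traceOutAllBut i σ = ρ
  ppt : ∀ s : Finset (Option (Fin k)), (partialTranspose s σ).PosSemidef

/-- The set of states on `H_A ⊗ H_B` that pass (are not detected by) the `k`-th test of the
hierarchy, `k ≥ 1`: the states that have a PPT symmetric extension to `k` copies of party `A`. -/
def passing (α β : Type*) [Fintype α] [DecidableEq α] [Fintype β] (k : ℕ) :
    Set (Matrix (α × β) (α × β) ℂ) :=
  {ρ | IsState ρ ∧ ∃ σ : ExtOp k α β, IsPPTSymmetricExtension k ρ σ}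

/-- The hierarchy of tests collapses to finitely many steps: from some step on, the nested sets of
states that pass the tests no longer change. -/
def Collapses (α β : Type*) [Fintype α] [DecidableEq α] [Fintype β] : Prop :=
  ∃ n : ℕ, 1 ≤ n ∧ ∀ m : ℕ, n ≤ m → passing α β m = passing α β n

end PPTHierarchy

/-! Passing a test is a truncated moment condition. Let `L` be a linear functional on polynomials in
real variables, with values in operators on `B`, that is nonnegative on squares of vectors of
polynomials of degree at most `k`. For a vector `x` of affine polynomials, the moments of the
products `x (z 1) ⋯ x (z k)` against their conjugates form a PPT symmetric extension to `k` copies: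
swap symmetry is commutativity of multiplication, transposing a copy conjugates one factor, and
tracing out `k - 1` copies multiplies `L` by `|x|^(2(k-1))`
(`isPPTSymmetricExtension_momentExtension`).

Such an `L` need not come from a measure. `jetFunctional` prescribes the moments up to order two by
a differential operator at the origin. Adding a small point mass at the origin and a small measure
on a wide grid makes it positive up to degree `k` while barely changing the second-order moments
(`eventually_isPositiveUpTo_regFunctional`). Scaling every coordinate of `x` but a constant one by
`ε` brings `|x|^2` close to 1, so undoing this local filter on the reduced operator gives nearly the
prescribed moments. Separable states form a closed set and separability survives local filters, so
nonseparable moments yield entangled states passing `k` tests (`exists_isEntangled_mem_passing`).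

It remains to find nonseparable operators that are second-order moments of real variables, that is,
images of positive operators invariant under partial transposition. For a qubit `A` every PPT
operator qualifies, because the missing moment of `z ^ 2` can be chosen freely
(`exists_isEntangled_mem_passing_of_ppt`). Otherwise invariant examples are embedded: the tiles
state in `3 × 3` and an explicit state in `4 × 2`. Apart from trivial factors this leaves `3 × 2`,
where PPT implies separability (`mem_sepCone_of_ppt_three_two`). That is proved on extremal rays: a
dimension count forces small ranks, and a `3 × 3` block then extends to a normal `4 × 4` matrix,
whose eigenvector provides a product vector to subtract.

Non-collapse follows because a state passing all sufficiently high tests is separable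
(`mem_sepCone_of_forall_mem_passing`): measuring the copies of `A` one by one raises the average
purity on `B` by a fixed amount as long as the state is a fixed distance from the separable cone,
and this purity never exceeds 1. -/

namespace PPTHierarchy

open Filter Topology

/-! ### The cone of separable operators. -/

section Separable

variable {α β γ δ : Type*}

/-- The cone of unnormalised separable operators. -/
def sepCone (α β : Type*) : AddSubmonoid (Matrix (α × β) (α × β) ℂ) :=
  AddSubmonoid.closure {M | ∃ (ψ : α → ℂ) (φ : β → ℂ), M = ketBra ψ ⊗ₖ ketBra φ}

lemma ketBra_kron_mem_sepCone (ψ : α → ℂ) (φ : β → ℂ) :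
    ketBra ψ ⊗ₖ ketBra φ ∈ sepCone α β :=
  AddSubmonoid.subset_closure ⟨ψ, φ, rfl⟩

lemma ketBra_smul (c : ℂ) (ψ : α → ℂ) : ketBra (c • ψ) = (c * star c) • ketBra ψ := by
  ext i j
  simp [ketBra, vecMulVec_apply]
  ring

lemma sqrt_mul_star_sqrt {c : ℝ} (hc : 0 ≤ c) :
    ((Real.sqrt c : ℝ) : ℂ) * star ((Real.sqrt c : ℝ) : ℂ) = c := by
  rw [Complex.star_def, Complex.conj_ofReal, ← Complex.ofReal_mul, Real.mul_self_sqrt hc]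

lemma sepCone_smul {M : Matrix (α × β) (α × β) ℂ} (hM : M ∈ sepCone α β) {c : ℝ} (hc : 0 ≤ c) :
    (c : ℂ) • M ∈ sepCone α β := by
  induction hM using AddSubmonoid.closure_induction with
  | mem x hx =>
    obtain ⟨ψ, φ, rfl⟩ := hx
    rw [← smul_kronecker, ← sqrt_mul_star_sqrt hc, ← ketBra_smul]
    exact ketBra_kron_mem_sepCone _ _
  | zero => simp [(sepCone α β).zero_mem]
  | add x y _ _ hx hy => rw [smul_add]; exact add_mem hx hy

lemma mul_ketBra_mul [Fintype α] (A : Matrix γ α ℂ) (ψ : α → ℂ) :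
    A * ketBra ψ * Aᴴ = ketBra (A *ᵥ ψ) := by
  rw [ketBra, ketBra, mul_vecMulVec, vecMulVec_mul, star_mulVec]

lemma sepCone_conj [Fintype α] [Fintype β] (A : Matrix γ α ℂ) (B : Matrix δ β ℂ)
    {M : Matrix (α × β) (α × β) ℂ} (hM : M ∈ sepCone α β) :
    (A ⊗ₖ B) * M * (A ⊗ₖ B)ᴴ ∈ sepCone γ δ := by
  induction hM using AddSubmonoid.closure_induction with
  | mem x hx =>
    obtain ⟨ψ, φ, rfl⟩ := hx
    rw [conjTranspose_kronecker, ← mul_kronecker_mul, ← mul_kronecker_mul, mul_ketBra_mul,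
      mul_ketBra_mul]
    exact ketBra_kron_mem_sepCone _ _
  | zero => simp [(sepCone γ δ).zero_mem]
  | add x y _ _ hx hy => rw [Matrix.mul_add, Matrix.add_mul]; exact add_mem hx hy

lemma posSemidef_ketBra [Finite α] (ψ : α → ℂ) : (ketBra ψ).PosSemidef :=
  posSemidef_vecMulVec_self_star ψ

lemma kron_mem_sepCone [Finite α] [Finite β] {A : Matrix α α ℂ} {B : Matrix β β ℂ}
    (hA : A.PosSemidef) (hB : B.PosSemidef) : A ⊗ₖ B ∈ sepCone α β := by
  obtain ⟨m, v, rfl⟩ := posSemidef_iff_eq_sum_vecMulVec.mp hA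
  obtain ⟨n, w, rfl⟩ := posSemidef_iff_eq_sum_vecMulVec.mp hB
  have : (∑ i, vecMulVec (v i) (star (v i))) ⊗ₖ (∑ i, vecMulVec (w i) (star (w i))) =
      ∑ i, ∑ j, ketBra (v i) ⊗ₖ ketBra (w j) := by
    ext x y
    simp [kroneckerMap_apply, Matrix.sum_apply, ketBra, Finset.sum_mul_sum]
  rw [this]
  exact sum_mem fun i _ => sum_mem fun j _ => ketBra_kron_mem_sepCone _ _

lemma posSemidef_of_mem_sepCone [Finite α] [Finite β] {M : Matrix (α × β) (α × β) ℂ}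
    (hM : M ∈ sepCone α β) : M.PosSemidef := by
  induction hM using AddSubmonoid.closure_induction with
  | mem x hx =>
    obtain ⟨ψ, φ, rfl⟩ := hx
    cases nonempty_fintype α
    cases nonempty_fintype β
    classical
    exact (posSemidef_ketBra ψ).kronecker (posSemidef_ketBra φ)
  | zero => exact PosSemidef.zero
  | add x y _ _ hx hy => exact hx.add hy

lemma partialTransposeA_ketBra_kron (ψ : α → ℂ) (φ : β → ℂ) :
    partialTransposeA (ketBra ψ ⊗ₖ ketBra φ) = ketBra (star ψ) ⊗ₖ ketBra φ := by
  ext x y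
  simp [partialTransposeA, ketBra, vecMulVec_apply, mul_comm]

variable [Fintype α] [Fintype β]

lemma dotProduct_star_self_eq (ψ : α → ℂ) :
    star ψ ⬝ᵥ ψ = ((∑ i, ‖ψ i‖ ^ 2 : ℝ) : ℂ) := by
  simp only [dotProduct, Pi.star_apply, Complex.star_def, Complex.conj_mul']
  push_cast
  rfl

lemma exists_unit_smul {ψ : α → ℂ} (h : ψ ≠ 0) :
    ∃ (c : ℝ) (ψ' : α → ℂ), 0 < c ∧ star ψ' ⬝ᵥ ψ' = 1 ∧ ketBra ψ = (c : ℂ) • ketBra ψ' := by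
  set c : ℝ := ∑ i, ‖ψ i‖ ^ 2 with hc
  have hcpos : 0 < c := by
    obtain ⟨i, hi⟩ := Function.ne_iff.mp h
    have : 0 < ‖ψ i‖ ^ 2 := by
      have := norm_pos_iff.mpr hi
      positivity
    exact this.trans_le (Finset.single_le_sum (f := fun i => ‖ψ i‖ ^ 2)
      (fun _ _ => by positivity) (Finset.mem_univ i))
  have hs : 0 < Real.sqrt c := Real.sqrt_pos.mpr hcpos
  have hs' : ((Real.sqrt c : ℝ) : ℂ) ≠ 0 := by exact_mod_cast hs.ne'
  refine ⟨c, ((Real.sqrt c : ℝ) : ℂ)⁻¹ • ψ, hcpos, ?_, ?_⟩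
  · rw [star_smul, smul_dotProduct, dotProduct_smul, dotProduct_star_self_eq, ← hc]
    simp only [star_inv₀, Complex.star_def, Complex.conj_ofReal, smul_eq_mul]
    rw [← mul_assoc, ← mul_inv, ← Complex.ofReal_mul, Real.mul_self_sqrt hcpos.le]
    exact inv_mul_cancel₀ (by exact_mod_cast hcpos.ne')
  · rw [ketBra_smul, smul_smul, ← sqrt_mul_star_sqrt hcpos.le, star_inv₀]
    rw [Complex.star_def, Complex.conj_ofReal]
    field_simp
    simp

lemma trace_ketBra (ψ : α → ℂ) : (ketBra ψ).trace = star ψ ⬝ᵥ ψ := by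
  simp [ketBra, trace_vecMulVec, dotProduct_comm]

lemma exists_decomposition_of_mem_sepCone {M : Matrix (α × β) (α × β) ℂ} (hM : M ∈ sepCone α β) :
    ∃ (N : ℕ) (p : Fin N → ℝ) (ψ : Fin N → α → ℂ) (φ : Fin N → β → ℂ),
    (∀ i, 0 < p i) ∧ (∀ i, star (ψ i) ⬝ᵥ ψ i = 1) ∧ (∀ i, star (φ i) ⬝ᵥ φ i = 1) ∧
    M = ∑ i, (p i : ℂ) • (ketBra (ψ i) ⊗ₖ ketBra (φ i)) := by
  induction hM using AddSubmonoid.closure_induction with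
  | mem x hx =>
    obtain ⟨ψ, φ, rfl⟩ := hx
    -- Weights must be positive and vectors normalised, so a zero factor is represented by the empty
    -- sum.
    by_cases hψ : ψ = 0
    · refine ⟨0, Fin.elim0, Fin.elim0, Fin.elim0, fun i => i.elim0, fun i => i.elim0,
        fun i => i.elim0, ?_⟩
      ext x y
      simp [hψ, ketBra, vecMulVec_apply]
    by_cases hφ : φ = 0
    · refine ⟨0, Fin.elim0, Fin.elim0, Fin.elim0, fun i => i.elim0, fun i => i.elim0,
        fun i => i.elim0, ?_⟩
      ext x y
      simp [hφ, ketBra, vecMulVec_apply]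
    obtain ⟨c, ψ', hc, hψ', e⟩ := exists_unit_smul hψ
    obtain ⟨d, φ', hd, hφ', e'⟩ := exists_unit_smul hφ
    refine ⟨1, fun _ => c * d, fun _ => ψ', fun _ => φ', fun _ => mul_pos hc hd, fun _ => hψ',
      fun _ => hφ', ?_⟩
    rw [e, e', smul_kronecker, kronecker_smul, smul_smul]
    simp
  | zero =>
    exact ⟨0, Fin.elim0, Fin.elim0, Fin.elim0, fun i => i.elim0, fun i => i.elim0,
        fun i => i.elim0, by simp⟩
  | add x y _ _ hx hy =>
    obtain ⟨N, p, ψ, φ, h1, h2, h3, rfl⟩ := hx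
    obtain ⟨N', p', ψ', φ', h1', h2', h3', rfl⟩ := hy
    refine ⟨N + N', Fin.append p p', Fin.append ψ ψ', Fin.append φ φ', ?_, ?_, ?_, ?_⟩
    · intro i; refine Fin.addCases (fun i => ?_) (fun i => ?_) i <;> simp [h1, h1']
    · intro i; refine Fin.addCases (fun i => ?_) (fun i => ?_) i <;> simp [h2, h2']
    · intro i; refine Fin.addCases (fun i => ?_) (fun i => ?_) i <;> simp [h3, h3']
    · simp [Fin.sum_univ_add]

lemma isSeparable_iff {ρ : Matrix (α × β) (α × β) ℂ} :
    IsSeparable ρ ↔ ρ ∈ sepCone α β ∧ ρ.trace = 1 := by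
  have key : ∀ (N : ℕ) (p : Fin N → ℝ) (ψ : Fin N → α → ℂ) (φ : Fin N → β → ℂ),
      (∀ i, star (ψ i) ⬝ᵥ ψ i = 1) → (∀ i, star (φ i) ⬝ᵥ φ i = 1) →
      (∑ i, (p i : ℂ) • (ketBra (ψ i) ⊗ₖ ketBra (φ i))).trace = ((∑ i, p i : ℝ) : ℂ) := by
    intro N p ψ φ h1 h2
    simp [trace_sum, trace_smul, trace_kronecker, trace_ketBra, h1, h2]
  constructor
  · rintro ⟨N, p, ψ, φ, hp, h1, hψ, hφ, rfl⟩
    refine ⟨sum_mem fun i _ => sepCone_smul (ketBra_kron_mem_sepCone _ _) (hp i).le, ?_⟩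
    rw [key _ _ _ _ hψ hφ, h1, Complex.ofReal_one]
  · rintro ⟨hM, ht⟩
    obtain ⟨N, p, ψ, φ, hp, hψ, hφ, rfl⟩ := exists_decomposition_of_mem_sepCone hM
    rw [key _ _ _ _ hψ hφ] at ht
    exact ⟨N, p, ψ, φ, hp, by exact_mod_cast ht, hψ, hφ, rfl⟩

end Separable

/-! ### Compactness of convex hulls in finite dimension. -/

section ConvexHull

lemma sum_eq_sum_embedding {ι κ F : Type*} [Fintype ι] [Fintype κ] [AddCommMonoid F] (e : ι ↪ κ)
    {g : κ → F} (h0 : ∀ i ∉ Set.range e, g i = 0) : ∑ i, g i = ∑ a, g (e a) := by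
  rw [← Finset.sum_subset (Finset.subset_univ (Finset.univ.map e))
    (fun i _ hi => h0 i (by simpa using hi)), Finset.sum_map]

open scoped Classical in
/-- In finite dimension the convex hull of a compact set is compact. -/
lemma isCompact_convexHull_of_isCompact {E : Type*} [AddCommGroup E] [Module ℝ E]
    [TopologicalSpace E] [IsTopologicalAddGroup E] [ContinuousSMul ℝ E] [FiniteDimensional ℝ E]
    {s : Set E} (hs : IsCompact s) : IsCompact (convexHull ℝ s) := by
  rcases s.eq_empty_or_nonempty with rfl | ⟨x₀, hx₀⟩
  · simp
  set N := Module.finrank ℝ E + 1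
  have himg : convexHull ℝ s = (fun q : (Fin N → ℝ) × (Fin N → E) => ∑ i, q.1 i • q.2 i) ''
      (stdSimplex ℝ (Fin N) ×ˢ Set.univ.pi fun _ => s) := by
    apply Set.Subset.antisymm
    · intro x hx
      rw [convexHull_eq_union] at hx
      simp only [Set.mem_iUnion] at hx
      obtain ⟨t, hts, hti, hxt⟩ := hx
      obtain ⟨w, hw0, hw1, rfl⟩ := Finset.mem_convexHull'.mp hxt
      -- Carathéodory: affinely independent points number at most the dimension plus one. Unused
      -- slots are filled with `x₀` at weight zero.
      have hcard : Fintype.card t ≤ Fintype.card (Fin N) := by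
        rw [Fintype.card_fin]
        exact hti.card_le_finrank_succ.trans (Nat.succ_le_succ (Submodule.finrank_le _))
      obtain ⟨e⟩ := Function.Embedding.nonempty_of_card_le hcard
      refine ⟨(Function.extend e (fun a => w a) 0, Function.extend e (fun a => (a : E))
        (fun _ => x₀)), ⟨⟨?_, ?_⟩, ?_⟩, ?_⟩
      · intro i
        by_cases hi : i ∈ Set.range e
        · obtain ⟨a, rfl⟩ := hi
          simpa [e.injective.extend_apply] using hw0 a a.2
        · simp [Function.extend_apply' _ _ _ (show ¬ ∃ a, e a = i by simpa using hi)]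
      · simp only
        rw [sum_eq_sum_embedding e, ← hw1, ← Finset.sum_attach t w, ← Finset.univ_eq_attach]
        · simp [e.injective.extend_apply]
        · intro i hi
          simp [Function.extend_apply' _ _ _ (show ¬ ∃ a, e a = i by simpa using hi)]
      · rintro i -
        by_cases hi : i ∈ Set.range e
        · obtain ⟨a, rfl⟩ := hi
          simpa [e.injective.extend_apply] using hts a.2
        · simpa [Function.extend_apply' _ _ _ (show ¬ ∃ a, e a = i by simpa using hi)] using hx₀
      · simp only
        rw [← Finset.sum_attach t, ← Finset.univ_eq_attach, sum_eq_sum_embedding e]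
        · simp [e.injective.extend_apply]
        · intro i hi
          simp [Function.extend_apply' _ _ _ (show ¬ ∃ a, e a = i by simpa using hi)]
    · rintro _ ⟨⟨w, z⟩, ⟨hw, hz⟩, rfl⟩
      exact (convex_convexHull ℝ s).sum_mem (fun i _ => hw.1 i) hw.2
        fun i _ => subset_convexHull ℝ s (hz i trivial)
  rw [himg]
  refine ((isCompact_stdSimplex ℝ (Fin N)).prod (isCompact_univ_pi fun _ => hs)).image ?_
  fun_prop

end ConvexHull

/-! ### Closedness of the set of separable states. -/

section Closed

variable {α β : Type*} [Fintype α] [Fintype β]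

lemma isCompact_unit (α : Type*) [Fintype α] : IsCompact {ψ : α → ℂ | star ψ ⬝ᵥ ψ = 1} := by
  refine Metric.isCompact_of_isClosed_isBounded (isClosed_eq ?_ continuous_const) ?_
  · unfold dotProduct
    fun_prop
  · refine (Metric.isBounded_closedBall (x := (0 : α → ℂ)) (r := 1)).subset fun ψ hψ => ?_
    rw [mem_closedBall_zero_iff, pi_norm_le_iff_of_nonneg zero_le_one]
    intro i
    have h : (∑ i, ‖ψ i‖ ^ 2 : ℝ) = 1 := by
      have : star ψ ⬝ᵥ ψ = 1 := hψ
      rw [dotProduct_star_self_eq] at this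
      exact_mod_cast this
    have h2 : ‖ψ i‖ ^ 2 ≤ 1 := h ▸ Finset.single_le_sum (f := fun i => ‖ψ i‖ ^ 2)
      (fun _ _ => by positivity) (Finset.mem_univ i)
    exact (sq_le_one_iff₀ (norm_nonneg _)).mp h2

lemma convex_isSeparable : Convex ℝ {ρ : Matrix (α × β) (α × β) ℂ | IsSeparable ρ} := by
  intro ρ hρ τ hτ a b ha hb hab
  simp only [Set.mem_ofPred_eq, isSeparable_iff] at *
  have e : ∀ (c : ℝ) (M : Matrix (α × β) (α × β) ℂ), c • M = (c : ℂ) • M := fun c M => by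
    ext; simp
  rw [e, e]
  refine ⟨add_mem (sepCone_smul hρ.1 ha) (sepCone_smul hτ.1 hb), ?_⟩
  rw [trace_add, trace_smul, trace_smul, hρ.2, hτ.2]
  simp only [smul_eq_mul, mul_one]
  exact_mod_cast hab

lemma isClosed_isSeparable : IsClosed {ρ : Matrix (α × β) (α × β) ℂ | IsSeparable ρ} := by
  have h : {ρ : Matrix (α × β) (α × β) ℂ | IsSeparable ρ} = convexHull ℝ
      ((fun q : (α → ℂ) × (β → ℂ) => ketBra q.1 ⊗ₖ ketBra q.2) ''
        ({ψ | star ψ ⬝ᵥ ψ = 1} ×ˢ {φ | star φ ⬝ᵥ φ = 1})) := by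
    apply Set.Subset.antisymm
    · rintro ρ ⟨N, p, ψ, φ, hp, h1, hψ, hφ, rfl⟩
      refine (convex_convexHull ℝ _).sum_mem (w := p)
        (z := fun i => ketBra (ψ i) ⊗ₖ ketBra (φ i)) (fun i _ => (hp i).le) h1
        fun i _ => subset_convexHull ℝ _ ⟨(ψ i, φ i), ⟨hψ i, hφ i⟩, rfl⟩
    · refine convexHull_min ?_ convex_isSeparable
      rintro _ ⟨⟨ψ, φ⟩, ⟨hψ, hφ⟩, rfl⟩
      refine isSeparable_iff.mpr ⟨ketBra_kron_mem_sepCone _ _, ?_⟩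
      simp only [Set.mem_ofPred_eq] at hψ hφ
      simp [trace_kronecker, trace_ketBra, hψ, hφ]
  rw [h]
  refine (isCompact_convexHull_of_isCompact (((isCompact_unit α).prod
    (isCompact_unit β)).image ?_)).isClosed
  refine continuous_matrix fun x y => ?_
  simp only [kroneckerMap_apply, ketBra, vecMulVec_apply, Pi.star_apply]
  fun_prop

/-- The complement of the separable cone contains a neighbourhood of every entangled state. -/
lemma eventually_notMem_sepCone {X : Type*} {l : Filter X} {f : X → Matrix (α × β) (α × β) ℂ}
    {ρ : Matrix (α × β) (α × β) ℂ} (hf : Tendsto f l (𝓝 ρ)) (hρ : ρ ∉ sepCone α β)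
    (ht : ρ.trace = 1) : ∀ᶠ x in l, f x ∉ sepCone α β := by
  have htr : Tendsto (fun x => (f x).trace) l (𝓝 1) := by
    rw [← ht]
    exact ((continuous_id.matrix_trace).tendsto ρ).comp hf
  have hg : Tendsto (fun x => ((f x).trace)⁻¹ • f x) l (𝓝 ρ) := by
    have := (htr.inv₀ one_ne_zero).smul hf
    simpa using this
  have hopen : IsOpen {ρ : Matrix (α × β) (α × β) ℂ | IsSeparable ρ}ᶜ :=
    isClosed_isSeparable.isOpen_compl
  have hmem : ρ ∈ {ρ : Matrix (α × β) (α × β) ℂ | IsSeparable ρ}ᶜ := fun h =>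
    hρ (isSeparable_iff.mp h).1
  filter_upwards [hg.eventually (hopen.mem_nhds hmem), htr.eventually_ne one_ne_zero]
    with x hx hne hmem
  refine hx (isSeparable_iff.mpr ⟨?_, ?_⟩)
  · have h0 : 0 ≤ (f x).trace := (posSemidef_of_mem_sepCone hmem).trace_nonneg
    obtain ⟨r, hr, e⟩ : ∃ r : ℝ, 0 ≤ r ∧ (f x).trace = r :=
      ⟨(f x).trace.re, (Complex.nonneg_iff.mp h0).1,
        Complex.ext rfl (Complex.nonneg_iff.mp h0).2.symm⟩
    rw [e, ← Complex.ofReal_inv]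
    exact sepCone_smul hmem (inv_nonneg.mpr hr)
  · rw [trace_smul, smul_eq_mul, inv_mul_cancel₀ hne]

end Closed

/-- Hermiticity is automatic: nonnegativity in the complex order makes the quadratic form real. -/
lemma posSemidef_of_forall_nonneg {n : Type*} [Fintype n] {M : Matrix n n ℂ}
    (h : ∀ v : n → ℂ, 0 ≤ ∑ i, ∑ j, star (v i) * M i j * v j) : M.PosSemidef := by
  classical
  have h' : ∀ x, 0 ≤ star x ⬝ᵥ (M *ᵥ x) := fun x => by
    have := h x
    simpa [dotProduct, mulVec, Finset.mul_sum, mul_assoc] using this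
  refine PosSemidef.of_dotProduct_mulVec_nonneg ?_ h'
  rw [← isSymmetric_toEuclideanLin_iff, LinearMap.isSymmetric_iff_inner_map_self_real]
  intro v
  have h2 := h' v.ofLp
  have h3 : inner ℂ (toEuclideanLin M v) v = star (star v.ofLp ⬝ᵥ (M *ᵥ v.ofLp)) := by
    rw [EuclideanSpace.inner_eq_star_dotProduct, ← star_dotProduct_star, star_star,
      dotProduct_comm]
    simp [toLpLin_apply, dotProduct_comm]
  rw [h3]
  have h4 : star (star v.ofLp ⬝ᵥ (M *ᵥ v.ofLp)) = star v.ofLp ⬝ᵥ (M *ᵥ v.ofLp) :=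
    (IsSelfAdjoint.of_nonneg h2).star_eq
  rw [h4]
  exact h4

lemma PosSemidef.sum_nonneg {n : Type*} [Fintype n] {M : Matrix n n ℂ} (hM : M.PosSemidef)
    (v : n → ℂ) : 0 ≤ ∑ i, ∑ j, star (v i) * M i j * v j := by
  have := hM.dotProduct_mulVec_nonneg v
  simpa [dotProduct, mulVec, Finset.mul_sum, mul_assoc] using this

/-! ### From positive functionals to PPT symmetric extensions. -/

section MomentFunctional

open MvPolynomial

variable {ι α β : Type*}

/-- Complex conjugation of the coefficients, i.e. of the values at real points. -/
noncomputable def polyConj : MvPolynomial ι ℂ →+* MvPolynomial ι ℂ :=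
  MvPolynomial.map (starRingEnd ℂ)

@[simp] lemma polyConj_polyConj (p : MvPolynomial ι ℂ) : polyConj (polyConj p) = p := by
  rw [polyConj, MvPolynomial.map_map]
  have : (starRingEnd ℂ).comp (starRingEnd ℂ) = RingHom.id ℂ := by
    ext x; simp
  rw [this, MvPolynomial.map_id]

@[simp] lemma polyConj_C (c : ℂ) : polyConj (C c : MvPolynomial ι ℂ) = C (star c) := by
  simp [polyConj]

@[simp] lemma polyConj_X (i : ι) : polyConj (X i : MvPolynomial ι ℂ) = X i := by
  simp [polyConj]

lemma polyConj_smul (c : ℂ) (p : MvPolynomial ι ℂ) : polyConj (c • p) = star c • polyConj p := by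
  rw [smul_eq_C_mul, smul_eq_C_mul, map_mul, polyConj_C]

lemma totalDegree_polyConj_le (p : MvPolynomial ι ℂ) : (polyConj p).totalDegree ≤ p.totalDegree := by
  rw [totalDegree, totalDegree]
  exact Finset.sup_mono (support_map_subset _ _)

lemma eval_polyConj {u : ι → ℂ} (hu : ∀ i, star (u i) = u i) (p : MvPolynomial ι ℂ) :
    eval u (polyConj p) = star (eval u p) := by
  induction p using MvPolynomial.induction_on with
  | C a => simp
  | add p q hp hq => simp [hp, hq]
  | mul_X p i hp => rw [map_mul, map_mul, map_mul, hp, star_mul', polyConj_X, eval_X, hu i]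

lemma pderiv_polyConj (i : ι) (p : MvPolynomial ι ℂ) :
    pderiv i (polyConj p) = polyConj (pderiv i p) := by
  simp [polyConj, pderiv_map]

variable [Fintype β]

/-- A matrix-valued linear functional on polynomials is positive up to degree `k` if it is
positive on the squares of all vectors of polynomials of degree at most `k`. -/
def IsPositiveUpTo (k : ℕ) (L : MvPolynomial ι ℂ →ₗ[ℂ] Matrix β β ℂ) : Prop :=
  ∀ c : β → MvPolynomial ι ℂ, (∀ b, (c b).totalDegree ≤ k) →
    0 ≤ ∑ b, ∑ b', L (c b * polyConj (c b')) b b'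

/-- The moment matrix of a matrix-valued functional. -/
noncomputable def momentMatrix {γ : Type*} (L : MvPolynomial ι ℂ →ₗ[ℂ] Matrix β β ℂ)
    (q : γ → MvPolynomial ι ℂ) : Matrix (γ × β) (γ × β) ℂ :=
  Matrix.of fun x y => L (q x.1 * polyConj (q y.1)) x.2 y.2

lemma momentMatrix_posSemidef {γ : Type*} [Fintype γ] {k : ℕ}
    {L : MvPolynomial ι ℂ →ₗ[ℂ] Matrix β β ℂ} (hL : IsPositiveUpTo k L)
    {q : γ → MvPolynomial ι ℂ} (hq : ∀ i, (q i).totalDegree ≤ k) :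
    (momentMatrix L q).PosSemidef := by
  refine posSemidef_of_forall_nonneg fun v => ?_
  -- The quadratic form of the moment matrix at `v` is the value of `L` on the square of this vector
  -- of polynomials.
  have h := hL (fun b => ∑ i, star (v (i, b)) • q i) fun b => by
    refine (totalDegree_finsetSum _ _).trans (Finset.sup_le fun i _ => ?_)
    exact (totalDegree_smul_le _ _).trans (hq i)
  refine h.trans_eq ?_
  simp only [map_sum, polyConj_smul, star_star, Finset.sum_mul_sum, smul_mul_smul_comm, map_smul,
    Matrix.sum_apply, Matrix.smul_apply, smul_eq_mul, Fintype.sum_prod_type, momentMatrix, of_apply]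
  rw [Finset.sum_comm' (t' := Finset.univ) (s' := fun _ => Finset.univ) (by simp)]
  conv_rhs => rw [Finset.sum_comm]
  rw [Finset.sum_comm]
  refine Finset.sum_congr rfl fun b _ => ?_
  rw [Finset.sum_comm]
  refine Finset.sum_congr rfl fun i _ => ?_
  rw [Finset.sum_comm]
  refine Finset.sum_congr rfl fun i' _ => ?_
  refine Finset.sum_congr rfl fun b' _ => ?_
  ring

variable [Fintype α]

/-- The squared norm of a vector of polynomials. -/
noncomputable def normSqPoly (x : α → MvPolynomial ι ℂ) : MvPolynomial ι ℂ :=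
  ∑ a, x a * polyConj (x a)

/-- Multiplying a square by `|x|^2` gives the sum over `a` of the squares of `x a • c`, each of
degree one higher. -/
lemma IsPositiveUpTo.mul_normSqPoly {k : ℕ} {L : MvPolynomial ι ℂ →ₗ[ℂ] Matrix β β ℂ}
    (hL : IsPositiveUpTo (k + 1) L) {x : α → MvPolynomial ι ℂ} (hx : ∀ a, (x a).totalDegree ≤ 1) :
    IsPositiveUpTo k (L ∘ₗ LinearMap.mulLeft ℂ (normSqPoly x)) := by
  intro c hc
  have h : ∀ a, 0 ≤ ∑ b, ∑ b', L ((x a * c b) * polyConj (x a * c b')) b b' := fun a =>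
    hL (fun b => x a * c b) fun b => (totalDegree_mul _ _).trans (by
      have := hc b; have := hx a; omega)
  refine (Finset.sum_nonneg fun a (_ : a ∈ Finset.univ) => h a).trans_eq ?_
  rw [Finset.sum_comm]
  refine Finset.sum_congr rfl fun b _ => ?_
  rw [Finset.sum_comm]
  refine Finset.sum_congr rfl fun b' _ => ?_
  rw [LinearMap.comp_apply, LinearMap.mulLeft_apply, normSqPoly, Finset.sum_mul, map_sum,
    Matrix.sum_apply]
  refine Finset.sum_congr rfl fun a _ => ?_
  rw [map_mul polyConj]
  exact congrArg (fun p => L p b b') (by ring)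

lemma IsPositiveUpTo.mul_normSqPoly_pow {k : ℕ} (j : ℕ) {L : MvPolynomial ι ℂ →ₗ[ℂ] Matrix β β ℂ}
    (hL : IsPositiveUpTo (k + j) L) {x : α → MvPolynomial ι ℂ} (hx : ∀ a, (x a).totalDegree ≤ 1) :
    IsPositiveUpTo k (L ∘ₗ LinearMap.mulLeft ℂ (normSqPoly x ^ j)) := by
  induction j generalizing L with
  | zero => simpa using hL
  | succ j ih =>
    have := ih (hL.mul_normSqPoly hx)
    rwa [LinearMap.comp_assoc, ← LinearMap.mulLeft_mul, ← pow_succ'] at this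

/-- The operator on `k` copies of `A` and on `B` given by the moments of the products of `k`
coordinates. -/
noncomputable def momentExtension (k : ℕ) (L : MvPolynomial ι ℂ →ₗ[ℂ] Matrix β β ℂ)
    (x : α → MvPolynomial ι ℂ) : ExtOp k α β :=
  momentMatrix L fun z : Fin k → α => ∏ i, x (z i)

lemma totalDegree_prod_le_card {k : ℕ} {y : Fin k → MvPolynomial ι ℂ}
    (hy : ∀ i, (y i).totalDegree ≤ 1) : (∏ i, y i).totalDegree ≤ k :=
  (totalDegree_finsetProd _ _).trans
    ((Finset.sum_le_sum fun i _ => hy i).trans (by simp))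

variable {k : ℕ} {L : MvPolynomial ι ℂ →ₗ[ℂ] Matrix β β ℂ} {x : α → MvPolynomial ι ℂ}

-- An entry contains `x (z i) * conj (x (z' i))` for each copy `i`; exchanging the two indices is
-- the same as conjugating `x` in that factor.
omit [Fintype β] [Fintype α] in
lemma partialTranspose_momentExtension (s : Finset (Option (Fin k))) (h : none ∉ s) :
    partialTranspose s (momentExtension k L x) = momentMatrix L
      fun z : Fin k → α => ∏ i, if some i ∈ s then polyConj (x (z i)) else x (z i) := by
  ext X Y
  simp only [partialTranspose, momentExtension, momentMatrix, of_apply, h, if_false, map_prod,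
    ← Finset.prod_mul_distrib]
  refine congrArg (fun p => L p X.2 Y.2) ?_
  refine Finset.prod_congr rfl fun i _ => ?_
  split_ifs
  · rw [polyConj_polyConj, mul_comm]
  · rfl

-- When `B` is transposed too, transposing the whole matrix leaves only the complementary copies to
-- conjugate.
omit [Fintype β] [Fintype α] in
lemma partialTranspose_momentExtension' (s : Finset (Option (Fin k))) (h : none ∈ s) :
    partialTranspose s (momentExtension k L x) = (momentMatrix L
      fun z : Fin k → α => ∏ i, if some i ∈ s then x (z i) else polyConj (x (z i)))ᵀ := by
  ext X Y
  simp only [partialTranspose, momentExtension, momentMatrix, of_apply, h, if_true, map_prod,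
    ← Finset.prod_mul_distrib, transpose_apply]
  refine congrArg (fun p => L p Y.2 X.2) ?_
  refine Finset.prod_congr rfl fun i _ => ?_
  split_ifs
  · rfl
  · rw [polyConj_polyConj, mul_comm]

-- Each copy traced out contributes the factor `∑ a, x a * conj (x a)`. The index tuples with
-- prescribed `i`-th entry form a product set, so the sum of products is a product of sums.
omit [Fintype β] in
lemma traceOutAllBut_momentExtension [DecidableEq α] (i : Fin k) :
    traceOutAllBut i (momentExtension k L x) =
      momentMatrix (L ∘ₗ LinearMap.mulLeft ℂ (normSqPoly x ^ (k - 1))) x := by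
  ext X Y
  simp only [traceOutAllBut, momentExtension, momentMatrix, of_apply, LinearMap.comp_apply,
    LinearMap.mulLeft_apply]
  rw [← Matrix.sum_apply, ← map_sum]
  refine congrArg (fun p => L p X.2 Y.2) ?_
  have hset : (Finset.univ.filter fun z : Fin k → α => z i = X.1) =
      Fintype.piFinset (fun s => if s = i then {X.1} else Finset.univ) := by
    ext z
    simp only [Finset.mem_filter, Finset.mem_univ, true_and, Fintype.mem_piFinset]
    constructor
    · intro hz s
      by_cases hs : s = i
      · subst hs; simp [hz]
      · simp [hs]
    · intro hz
      simpa using hz i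
  have hprod := Finset.prod_univ_sum (fun s => if s = i then {X.1} else (Finset.univ : Finset α))
    (fun s a => if s = i then x X.1 * polyConj (x Y.1) else x a * polyConj (x a))
  rw [← hset] at hprod
  have hl : (∏ s, ∑ a ∈ (if s = i then {X.1} else (Finset.univ : Finset α)),
      if s = i then x X.1 * polyConj (x Y.1) else x a * polyConj (x a)) =
      normSqPoly x ^ (k - 1) * (x X.1 * polyConj (x Y.1)) := by
    rw [← Finset.mul_prod_erase _ _ (Finset.mem_univ i), mul_comm]
    congr 1
    · rw [Finset.prod_congr rfl (g := fun _ => normSqPoly x), Finset.prod_const,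
        Finset.card_erase_of_mem (Finset.mem_univ _), Finset.card_univ, Fintype.card_fin]
      intro s hs
      simp [Finset.ne_of_mem_erase hs, normSqPoly]
    · simp
  rw [← hl, hprod]
  refine Finset.sum_congr rfl fun z hz => ?_
  rw [map_prod, ← Finset.prod_mul_distrib]
  refine Finset.prod_congr rfl fun s _ => ?_
  have hz' : z i = X.1 := by simpa using hz
  by_cases hs : s = i
  · subst hs; simp [hz']
  · simp [hs]

omit [Fintype β] [Fintype α] in
lemma swapCopies_momentExtension (i j : Fin k) :
    swapCopies i j (momentExtension k L x) = momentExtension k L x := by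
  ext X Y
  simp only [swapCopies, momentExtension, momentMatrix, of_apply, submatrix_apply,
    Function.comp_apply]
  rw [Equiv.prod_comp (Equiv.swap i j) (fun s => x (X.1 s)),
    Equiv.prod_comp (Equiv.swap i j) (fun s => x (Y.1 s))]

lemma trace_traceOutAllBut [DecidableEq α] (i : Fin k) (M : ExtOp k α β) :
    (traceOutAllBut i M).trace = M.trace := by
  simp only [trace, diag_apply, traceOutAllBut, of_apply, Fintype.sum_prod_type]
  rw [Finset.sum_comm]
  conv_rhs => rw [Finset.sum_comm]
  refine Finset.sum_congr rfl fun b _ => ?_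
  rw [← Finset.sum_fiberwise (s := Finset.univ) (g := fun z : Fin k → α => z i)]
  refine Finset.sum_congr rfl fun a _ => ?_
  refine Finset.sum_congr rfl fun z hz => ?_
  have : z i = a := by simpa using hz
  rw [← this, Function.update_eq_self]

lemma isPPTSymmetricExtension_momentExtension [DecidableEq α] (hk : 1 ≤ k)
    (hL : IsPositiveUpTo k L) (hx : ∀ a, (x a).totalDegree ≤ 1)
    (ht : (momentMatrix (L ∘ₗ LinearMap.mulLeft ℂ (normSqPoly x ^ (k - 1))) x).trace = 1) :
    IsPPTSymmetricExtension k
      (momentMatrix (L ∘ₗ LinearMap.mulLeft ℂ (normSqPoly x ^ (k - 1))) x)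
      (momentExtension k L x) where
  isState := by
    refine ⟨momentMatrix_posSemidef hL fun z => totalDegree_prod_le_card fun i => hx _, ?_⟩
    rw [← ht, ← traceOutAllBut_momentExtension ⟨0, hk⟩, trace_traceOutAllBut]
  symmetric := swapCopies_momentExtension
  extends_state := traceOutAllBut_momentExtension
  ppt s := by
    have hx' : ∀ a, (polyConj (x a)).totalDegree ≤ 1 := fun a =>
      (totalDegree_polyConj_le _).trans (hx a)
    by_cases h : none ∈ s
    · rw [partialTranspose_momentExtension' s h]
      refine (momentMatrix_posSemidef hL fun z => totalDegree_prod_le_card fun i => ?_).transpose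
      split_ifs <;> simp [hx, hx']
    · rw [partialTranspose_momentExtension s h]
      refine momentMatrix_posSemidef hL fun z => totalDegree_prod_le_card fun i => ?_
      split_ifs <;> simp [hx, hx']

/-- The reduced operator of a positive functional passes all tests up to its degree. -/
lemma momentMatrix_mem_passing [DecidableEq α] (hL : IsPositiveUpTo k L)
    (hx : ∀ a, (x a).totalDegree ≤ 1)
    (ht : (momentMatrix (L ∘ₗ LinearMap.mulLeft ℂ (normSqPoly x ^ (k - 1))) x).trace = 1)
    {j : ℕ} (hj : 1 ≤ j) (hjk : j ≤ k) :
    momentMatrix (L ∘ₗ LinearMap.mulLeft ℂ (normSqPoly x ^ (k - 1))) x ∈ passing α β j := by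
  -- For `j` copies, the surplus factor `|x|^(2(k-j))` is absorbed into the functional, which stays
  -- positive up to degree `j` and has the same reduced operator.
  obtain ⟨m, rfl⟩ := Nat.exists_eq_add_of_le hjk
  have h := hL.mul_normSqPoly_pow m hx
  have e : L ∘ₗ LinearMap.mulLeft ℂ (normSqPoly x ^ (j + m - 1)) =
      (L ∘ₗ LinearMap.mulLeft ℂ (normSqPoly x ^ m)) ∘ₗ
        LinearMap.mulLeft ℂ (normSqPoly x ^ (j - 1)) := by
    rw [LinearMap.comp_assoc, ← LinearMap.mulLeft_mul, ← pow_add]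
    congr 3
    omega
  rw [e] at ht ⊢
  refine ⟨⟨?_, ht⟩, _, isPPTSymmetricExtension_momentExtension hj h hx ht⟩
  obtain ⟨j, rfl⟩ := Nat.exists_eq_add_of_le' hj
  exact momentMatrix_posSemidef ((IsPositiveUpTo.mul_normSqPoly_pow (k := 1) j
    (by rwa [add_comm]) hx)) hx

end MomentFunctional

/-! ### Functionals with a prescribed second-order jet, and their regularisation. -/

section Jets

open MvPolynomial

variable {ι : Type*}

/-- The first-order jet of a polynomial at the origin. -/
noncomputable def jet (c : Option ι) : MvPolynomial ι ℂ →ₗ[ℂ] ℂ :=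
  match c with
  | none => (aeval (0 : ι → ℂ)).toLinearMap
  | some i => (aeval (0 : ι → ℂ)).toLinearMap ∘ₗ (pderiv i : Derivation ℂ _ _).toLinearMap

/-- The second derivatives of a polynomial at the origin. -/
noncomputable def hess (i l : ι) : MvPolynomial ι ℂ →ₗ[ℂ] ℂ :=
  jet (some i) ∘ₗ (pderiv l : Derivation ℂ _ _).toLinearMap

lemma jet_none (p : MvPolynomial ι ℂ) : jet none p = eval 0 p := by
  simp [jet]

lemma jet_some (i : ι) (p : MvPolynomial ι ℂ) : jet (some i) p = eval 0 (pderiv i p) := by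
  simp [jet, aeval_eq_eval]

lemma hess_apply (i l : ι) (p : MvPolynomial ι ℂ) :
    hess i l p = eval 0 (pderiv i (pderiv l p)) := by
  simp [hess, jet_some]

lemma jet_polyConj (c : Option ι) (p : MvPolynomial ι ℂ) : jet c (polyConj p) = star (jet c p) := by
  cases c with
  | none => rw [jet_none, jet_none, eval_polyConj (by simp)]
  | some i => rw [jet_some, jet_some, pderiv_polyConj, eval_polyConj (by simp)]

lemma hess_polyConj (i l : ι) (p : MvPolynomial ι ℂ) :
    hess i l (polyConj p) = star (hess i l p) := by
  rw [hess_apply, hess_apply, pderiv_polyConj, pderiv_polyConj, eval_polyConj (by simp)]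

/-- Rescaling of the variables of a polynomial. -/
noncomputable def rescale (t : ℂ) : MvPolynomial ι ℂ →ₐ[ℂ] MvPolynomial ι ℂ :=
  aeval fun i => C t * X i

lemma eval_rescale (t : ℂ) (u : ι → ℂ) (p : MvPolynomial ι ℂ) :
    eval u (rescale t p) = eval (fun i => t * u i) p := by
  induction p using MvPolynomial.induction_on with
  | C a => simp [rescale]
  | add p q hp hq => simp [hp, hq]
  | mul_X p i hp => rw [map_mul, map_mul, hp]; simp [rescale]

lemma pderiv_rescale (t : ℂ) (i : ι) (p : MvPolynomial ι ℂ) :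
    pderiv i (rescale t p) = C t * rescale t (pderiv i p) := by
  classical
  induction p using MvPolynomial.induction_on with
  | C a => simp [rescale]
  | add p q hp hq => simp [hp, hq, mul_add]
  | mul_X p j hp =>
    rw [map_mul, Derivation.leibniz, hp, Derivation.leibniz]
    by_cases hij : j = i
    · subst hij
      simp [rescale, Derivation.leibniz]
      ring
    · simp [rescale, Derivation.leibniz, pderiv_X_of_ne hij]
      ring

lemma hess_rescale (t : ℂ) (i l : ι) (p : MvPolynomial ι ℂ) :
    hess i l (rescale t p) = t ^ 2 * hess i l p := by
  rw [hess_apply, hess_apply, pderiv_rescale, Derivation.leibniz, pderiv_rescale]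
  have h0 : (fun _ : ι => (0 : ℂ)) = 0 := rfl
  have h := eval_rescale t 0 (pderiv i (pderiv l p))
  simp only [Pi.zero_apply, mul_zero, h0] at h
  rw [pderiv_C, smul_zero, add_zero, smul_eq_mul, ← mul_assoc, ← sq, map_mul, map_pow, eval_C, h]

lemma totalDegree_rescale_le (t : ℂ) (p : MvPolynomial ι ℂ) :
    (rescale t p).totalDegree ≤ p.totalDegree := by
  conv_lhs => rw [p.as_sum]
  rw [map_sum]
  refine (totalDegree_finsetSum _ _).trans (Finset.sup_le fun m hm => ?_)
  refine le_trans ?_ (le_totalDegree hm)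
  rw [rescale, aeval_monomial]
  refine (totalDegree_mul _ _).trans ?_
  rw [algebraMap_eq, totalDegree_C, zero_add, Finsupp.prod]
  refine (totalDegree_finsetProd _ _).trans (Finset.sum_le_sum fun i _ => ?_)
  refine (totalDegree_pow _ _).trans ?_
  have : (C t * X i : MvPolynomial ι ℂ).totalDegree ≤ 1 := by
    refine (totalDegree_mul _ _).trans ?_
    simp [totalDegree_C, totalDegree_X]
  nlinarith

/-- Every linear functional on polynomials of bounded degree is a combination of evaluations at the
points of a large enough grid. -/
lemma exists_grid_weights [Fintype ι] [DecidableEq ι] (k : ℕ) (f : MvPolynomial ι ℂ →ₗ[ℂ] ℂ) :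
    ∃ w : (ι → Fin (k + 1)) → ℂ, ∀ p : MvPolynomial ι ℂ, p.totalDegree ≤ k →
      f p = ∑ u, w u * eval (fun i => ((u i : ℕ) : ℂ)) p := by
  let V := restrictTotalDegree ι ℂ k
  let E : (ι → Fin (k + 1)) → V →ₗ[ℂ] ℂ := fun u =>
    (aeval fun i => ((u i : ℕ) : ℂ)).toLinearMap ∘ₗ V.subtype
  -- By duality it suffices that a polynomial of degree at most `k` vanishing on a grid with `k + 1`
  -- nodes per variable is zero.
  have hker : ⨅ u, LinearMap.ker (E u) ≤ LinearMap.ker (f ∘ₗ V.subtype) := by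
    intro p hp
    have hp0 : (p : MvPolynomial ι ℂ) = 0 := by
      refine eq_zero_of_eval_zero_at_prod_finset _
        (fun _ => Finset.univ.image fun n : Fin (k + 1) => ((n : ℕ) : ℂ)) ?_ ?_
      · intro i
        rw [Finset.card_image_of_injective _ (fun a b h => Fin.ext (by exact_mod_cast h)),
          Finset.card_univ, Fintype.card_fin]
        exact Nat.lt_succ_of_le ((degreeOf_le_totalDegree _ _).trans
          ((mem_restrictTotalDegree _ _ _).mp p.2))
      · intro x hx
        simp only [Finset.mem_image, Finset.mem_univ, true_and] at hx
        choose u hu using hx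
        have := (Submodule.mem_iInf _).mp hp u
        rw [LinearMap.mem_ker] at this
        simpa [E, aeval_eq_eval, hu] using this
    rw [LinearMap.mem_ker]
    simp [hp0]
  obtain ⟨w, hw⟩ := (Submodule.mem_span_range_iff_exists_fun ℂ).mp (mem_span_of_iInf_ker_le_ker hker)
  refine ⟨w, fun p hp => ?_⟩
  have := LinearMap.congr_fun hw ⟨p, (mem_restrictTotalDegree _ _ _).mpr hp⟩
  simpa [E, aeval_eq_eval] using this.symm

variable {β : Type*} [Fintype ι]

/-- The functional with prescribed moments up to order two. -/
noncomputable def jetFunctional (Λ : Option ι → Option ι → Matrix β β ℂ) :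
    MvPolynomial ι ℂ →ₗ[ℂ] Matrix β β ℂ :=
  (jet none).smulRight (Λ none none) + ∑ i, (jet (some i)).smulRight (Λ none (some i)) +
    (1 / 2 : ℂ) • ∑ i, ∑ l, (hess i l).smulRight (Λ (some i) (some l))

/-- Leibniz rule. The terms in first-order jets form the quadratic form of `Λ`, which is positive in
the application; the only terms without a sign pair a Hessian with a value at the origin, and the
regularisation must dominate these. -/
lemma jetFunctional_mul_polyConj {Λ : Option ι → Option ι → Matrix β β ℂ}
    (hsym : ∀ c c', Λ c c' = Λ c' c) (p q : MvPolynomial ι ℂ) :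
    jetFunctional Λ (p * polyConj q) = ∑ c, ∑ c', (jet c p * star (jet c' q)) • Λ c c' +
      (1 / 2 : ℂ) • ∑ i, ∑ l, (hess i l p * star (jet none q) + jet none p * star (hess i l q)) •
        Λ (some i) (some l) := by
  have h1 : ∀ i, jet (some i) (p * polyConj q) =
      jet none p * star (jet (some i) q) + jet (some i) p * star (jet none q) := fun i => by
    rw [← jet_polyConj, ← jet_polyConj, jet_some, jet_some, jet_some, jet_none, jet_none,
      Derivation.leibniz]
    simp
    ring
  have h2 : ∀ i l, hess i l (p * polyConj q) =
      (hess i l p * star (jet none q) + jet none p * star (hess i l q)) +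
      (jet (some i) p * star (jet (some l) q) + jet (some l) p * star (jet (some i) q)) :=
    fun i l => by
    rw [← jet_polyConj, ← jet_polyConj, ← jet_polyConj, ← hess_polyConj, jet_some, jet_some,
      jet_some, jet_some, jet_none, jet_none, hess_apply, hess_apply, hess_apply,
      Derivation.leibniz, map_add, smul_eq_mul, smul_eq_mul, Derivation.leibniz,
      Derivation.leibniz]
    simp
    ring
  have h0 : jet none (p * polyConj q) = jet none p * star (jet none q) := by
    rw [← jet_polyConj, jet_none, jet_none, jet_none, map_mul]
  simp only [jetFunctional, LinearMap.add_apply, LinearMap.smulRight_apply, LinearMap.smul_apply,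
    LinearMap.sum_apply, h0, h1, h2, Fintype.sum_option]
  have e : ∑ i, ∑ l, (jet (some l) p * star (jet (some i) q)) • Λ (some i) (some l) =
      ∑ i, ∑ l, (jet (some i) p * star (jet (some l) q)) • Λ (some i) (some l) := by
    rw [Finset.sum_comm]
    refine Finset.sum_congr rfl fun i _ => Finset.sum_congr rfl fun l _ => ?_
    rw [hsym]
  have e2 : ∀ i, Λ (some i) none = Λ none (some i) := fun i => hsym _ _
  simp only [add_smul, Finset.sum_add_distrib, smul_add, e, e2]
  module

variable [DecidableEq β] [DecidableEq ι]

/-- The functional with prescribed moments up to order two, regularised by a point mass at the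
origin and by a measure on a grid of mesh `s⁻²`. -/
noncomputable def regFunctional (Λ : Option ι → Option ι → Matrix β β ℂ) (k : ℕ) (s : ℝ) :
    MvPolynomial ι ℂ →ₗ[ℂ] Matrix β β ℂ :=
  jetFunctional Λ + (s : ℂ) • (jet none).smulRight 1 +
    ((s : ℂ) ^ 5) • ∑ u : ι → Fin (k + 1),
      (aeval fun i => ((s : ℂ) ^ 2)⁻¹ * ((u i : ℕ) : ℂ)).toLinearMap.smulRight 1

lemma regFunctional_apply (Λ : Option ι → Option ι → Matrix β β ℂ) (k : ℕ) (s : ℝ)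
    (p : MvPolynomial ι ℂ) : regFunctional Λ k s p = jetFunctional Λ p + ((s : ℂ) * jet none p) • 1 +
      ((s : ℂ) ^ 5 * ∑ u : ι → Fin (k + 1),
        eval (fun i => ((s : ℂ) ^ 2)⁻¹ * ((u i : ℕ) : ℂ)) p) • 1 := by
  simp only [regFunctional, LinearMap.add_apply, LinearMap.smul_apply, LinearMap.sum_apply,
    LinearMap.smulRight_apply, AlgHom.toLinearMap_apply, aeval_eq_eval, mul_smul, Finset.sum_smul]

omit [Fintype ι] [DecidableEq ι] in
lemma star_gridPoint {k : ℕ} (s : ℝ) (u : ι → Fin (k + 1)) (i : ι) :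
    star (((s : ℂ) ^ 2)⁻¹ * ((u i : ℕ) : ℂ)) = ((s : ℂ) ^ 2)⁻¹ * ((u i : ℕ) : ℂ) := by
  simp

variable [Fintype β]

/-- The sum over the two indices of a matrix-valued functional evaluated at products. -/
lemma regFunctional_quadratic {Λ : Option ι → Option ι → Matrix β β ℂ}
    (hsym : ∀ c c', Λ c c' = Λ c' c) (hherm : ∀ c c', (Λ c c').IsHermitian) (k : ℕ) (s : ℝ)
    (c : β → MvPolynomial ι ℂ) :
    ∑ b, ∑ b', regFunctional Λ k s (c b * polyConj (c b')) b b' =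
      (∑ x : Option ι × β, ∑ y : Option ι × β,
        jet x.1 (c x.2) * Λ x.1 y.1 x.2 y.2 * star (jet y.1 (c y.2))) +
      ((((∑ b, ∑ b', ∑ i, ∑ l,
        Λ (some i) (some l) b b' * hess i l (c b) * star (jet none (c b'))).re +
      s * ∑ b, ‖jet none (c b)‖ ^ 2 + s ^ 5 * ∑ b, ∑ u : ι → Fin (k + 1),
        ‖eval (fun i => ((s : ℂ) ^ 2)⁻¹ * ((u i : ℕ) : ℂ)) (c b)‖ ^ 2 : ℝ)) : ℂ) := by
  have hX : ∀ z : ℂ, ((z.re : ℝ) : ℂ) = (1 / 2 : ℂ) * (z + star z) := fun z => by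
    apply Complex.ext <;> simp
    ring
  have hstar : ∀ i l b b', star (Λ (some i) (some l) b b') = Λ (some i) (some l) b' b :=
    fun i l b b' => by
      rw [← conjTranspose_apply, (hherm _ _).eq]
  have hA : ∑ b, ∑ b', (∑ a, ∑ a', (jet a (c b) * star (jet a' (c b'))) • Λ a a') b b' =
      ∑ x : Option ι × β, ∑ y : Option ι × β,
        jet x.1 (c x.2) * Λ x.1 y.1 x.2 y.2 * star (jet y.1 (c y.2)) := by
    simp only [Matrix.sum_apply, Matrix.smul_apply, smul_eq_mul]
    rw [Fintype.sum_prod_type_right]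
    refine Finset.sum_congr rfl fun b _ => ?_
    rw [Finset.sum_comm]
    refine Finset.sum_congr rfl fun a _ => ?_
    rw [Fintype.sum_prod_type_right]
    refine Finset.sum_congr rfl fun b' _ => Finset.sum_congr rfl fun a' _ => ?_
    ring
  set Z := ∑ b, ∑ b', ∑ i, ∑ l,
    Λ (some i) (some l) b b' * hess i l (c b) * star (jet none (c b')) with hZ
  have hB : ∑ b, ∑ b', ((1 / 2 : ℂ) • ∑ i, ∑ l, (hess i l (c b) * star (jet none (c b')) +
      jet none (c b) * star (hess i l (c b'))) • Λ (some i) (some l)) b b' =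
      (1 / 2 : ℂ) * (Z + star Z) := by
    have hZ' : star Z = ∑ b, ∑ b', ∑ i, ∑ l,
        Λ (some i) (some l) b b' * jet none (c b) * star (hess i l (c b')) := by
      rw [hZ, Finset.sum_comm]
      simp only [star_sum, star_mul', star_star, hstar]
      refine Finset.sum_congr rfl fun b _ => Finset.sum_congr rfl fun b' _ =>
        Finset.sum_congr rfl fun i _ => Finset.sum_congr rfl fun l _ => ?_
      ring
    rw [hZ', hZ, ← Finset.sum_add_distrib, Finset.mul_sum]
    refine Finset.sum_congr rfl fun b _ => ?_
    rw [← Finset.sum_add_distrib, Finset.mul_sum]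
    refine Finset.sum_congr rfl fun b' _ => ?_
    rw [Matrix.smul_apply, smul_eq_mul, ← Finset.sum_add_distrib]
    congr 1
    rw [Matrix.sum_apply]
    refine Finset.sum_congr rfl fun i _ => ?_
    rw [← Finset.sum_add_distrib, Matrix.sum_apply]
    refine Finset.sum_congr rfl fun l _ => ?_
    rw [Matrix.smul_apply, smul_eq_mul]
    ring
  have hdiag : ∀ g : β → β → ℂ, ∑ b, ∑ b', (g b b' • (1 : Matrix β β ℂ)) b b' = ∑ b, g b b :=
    fun g => by simp [Matrix.one_apply]
  have hsq : ∀ z : ℂ, z * star z = (‖z‖ : ℂ) ^ 2 := fun z => Complex.mul_conj' z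
  have hC : ∑ b, ∑ b', (((s : ℂ) * jet none (c b * polyConj (c b'))) • (1 : Matrix β β ℂ)) b b' =
      s * ∑ b, (‖jet none (c b)‖ : ℂ) ^ 2 := by
    rw [hdiag, Finset.mul_sum]
    refine Finset.sum_congr rfl fun b _ => ?_
    rw [jet_none, map_mul, ← jet_none, ← jet_none, jet_polyConj, hsq]
  have hD : ∑ b, ∑ b', (((s : ℂ) ^ 5 * ∑ u : ι → Fin (k + 1),
        eval (fun i => ((s : ℂ) ^ 2)⁻¹ * ((u i : ℕ) : ℂ)) (c b * polyConj (c b'))) •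
        (1 : Matrix β β ℂ)) b b' = s ^ 5 * ∑ b, ∑ u : ι → Fin (k + 1),
        (‖eval (fun i => ((s : ℂ) ^ 2)⁻¹ * ((u i : ℕ) : ℂ)) (c b)‖ : ℂ) ^ 2 := by
    rw [hdiag, Finset.mul_sum]
    refine Finset.sum_congr rfl fun b _ => ?_
    congr 1
    refine Finset.sum_congr rfl fun u _ => ?_
    rw [map_mul, eval_polyConj (star_gridPoint s u), hsq]
  simp only [regFunctional_apply, jetFunctional_mul_polyConj hsym, Matrix.add_apply,
    Finset.sum_add_distrib]
  rw [hA, hB, hC, hD]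
  push_cast
  rw [hX]
  ring

/-- For small `s` the regularised functional is positive up to degree `k`. -/
lemma eventually_isPositiveUpTo_regFunctional {Λ : Option ι → Option ι → Matrix β β ℂ}
    (hsym : ∀ c c', Λ c c' = Λ c' c) (hherm : ∀ c c', (Λ c c').IsHermitian)
    (hpsd : (Matrix.of fun x y : Option ι × β => Λ x.1 y.1 x.2 y.2).PosSemidef) (k : ℕ) :
    ∀ᶠ s : ℝ in 𝓝[>] 0, IsPositiveUpTo k (regFunctional Λ k s) := by
  have hw := fun i l => exists_grid_weights k (hess (ι := ι) i l)
  choose w hw using hw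
  set W : ℝ := ∑ b, ∑ b', ∑ i, ∑ l, ‖Λ (some i) (some l) b b'‖ * ∑ u, ‖w i l u‖ with hW
  have hW0 : 0 ≤ W := by positivity
  have hlt : ∀ᶠ s : ℝ in 𝓝[>] 0, s < 2 / (W + 1) :=
    nhdsWithin_le_nhds (Iio_mem_nhds (by positivity))
  filter_upwards [hlt, self_mem_nhdsWithin] with s hs hs0
  replace hs0 : 0 < s := hs0
  intro c hc
  rw [regFunctional_quadratic hsym hherm]
  refine add_nonneg ?_ ?_
  · refine (PosSemidef.sum_nonneg hpsd fun x => star (jet x.1 (c x.2))).trans_eq ?_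
    simp only [of_apply, star_star]
  set S1 := ∑ b, ‖jet none (c b)‖ ^ 2 with hS1
  set S2 := ∑ b, ∑ u : ι → Fin (k + 1),
    ‖eval (fun i => ((s : ℂ) ^ 2)⁻¹ * ((u i : ℕ) : ℂ)) (c b)‖ ^ 2 with hS2
  set Z := ∑ b, ∑ b', ∑ i, ∑ l,
    Λ (some i) (some l) b b' * hess i l (c b) * star (jet none (c b')) with hZ
  have hS10 : 0 ≤ S1 := by positivity
  have hS20 : 0 ≤ S2 := by positivity
  have ha : ∀ b, ‖jet none (c b)‖ ≤ Real.sqrt S1 := fun b => Real.le_sqrt_of_sq_le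
    (Finset.single_le_sum (f := fun b => ‖jet none (c b)‖ ^ 2) (fun _ _ => by positivity)
      (Finset.mem_univ b))
  have he : ∀ b (u : ι → Fin (k + 1)),
      ‖eval (fun i => ((s : ℂ) ^ 2)⁻¹ * ((u i : ℕ) : ℂ)) (c b)‖ ≤ Real.sqrt S2 := fun b u => by
    refine Real.le_sqrt_of_sq_le (le_trans ?_ (Finset.single_le_sum (f := fun b =>
      ∑ u : ι → Fin (k + 1), ‖eval (fun i => ((s : ℂ) ^ 2)⁻¹ * ((u i : ℕ) : ℂ)) (c b)‖ ^ 2)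
        (fun _ _ => by positivity) (Finset.mem_univ b)))
    exact Finset.single_le_sum (f := fun u : ι → Fin (k + 1) =>
      ‖eval (fun i => ((s : ℂ) ^ 2)⁻¹ * ((u i : ℕ) : ℂ)) (c b)‖ ^ 2) (fun _ _ => by positivity)
      (Finset.mem_univ u)
  have hsc : (s : ℂ) ≠ 0 := by exact_mod_cast hs0.ne'
  -- Second derivatives are combinations of values on the unit grid; passing to the grid of mesh
  -- `s⁻²` gains `(s ^ 2) ^ 2`.
  have hD : ∀ i l b, ‖hess i l (c b)‖ ≤ s ^ 4 * ((∑ u, ‖w i l u‖) * Real.sqrt S2) := by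
    intro i l b
    have h1 := hw i l (rescale ((s : ℂ) ^ 2)⁻¹ (c b)) ((totalDegree_rescale_le _ _).trans (hc b))
    simp only [hess_rescale, eval_rescale] at h1
    have h2 : hess i l (c b) = (s : ℂ) ^ 4 * ∑ u, w i l u *
        eval (fun i => ((s : ℂ) ^ 2)⁻¹ * ((u i : ℕ) : ℂ)) (c b) := by
      rw [← h1]
      field_simp
    rw [h2, norm_mul, norm_pow, Complex.norm_real, Real.norm_of_nonneg hs0.le]
    refine mul_le_mul_of_nonneg_left ?_ (by positivity)
    refine (norm_sum_le _ _).trans ?_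
    rw [Finset.sum_mul]
    refine Finset.sum_le_sum fun u _ => ?_
    rw [norm_mul]
    exact mul_le_mul_of_nonneg_left (he b u) (norm_nonneg _)
  have hZle : ‖Z‖ ≤ W * (s ^ 4 * (Real.sqrt S1 * Real.sqrt S2)) := by
    rw [hZ, hW, Finset.sum_mul]
    refine (norm_sum_le _ _).trans (Finset.sum_le_sum fun b _ => ?_)
    rw [Finset.sum_mul]
    refine (norm_sum_le _ _).trans (Finset.sum_le_sum fun b' _ => ?_)
    rw [Finset.sum_mul]
    refine (norm_sum_le _ _).trans (Finset.sum_le_sum fun i _ => ?_)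
    rw [Finset.sum_mul]
    refine (norm_sum_le _ _).trans (Finset.sum_le_sum fun l _ => ?_)
    rw [norm_mul, norm_mul, norm_star]
    calc _ ≤ ‖Λ (some i) (some l) b b'‖ * (s ^ 4 * ((∑ u, ‖w i l u‖) * Real.sqrt S2)) *
          Real.sqrt S1 := by
          gcongr
          · exact hD i l b
          · exact ha b'
      _ = _ := by ring
  have hre : -‖Z‖ ≤ Z.re := (abs_le.mp (Complex.abs_re_le_norm Z)).1
  have hsW : s * W ≤ 2 := by
    rw [lt_div_iff₀ (by positivity)] at hs
    nlinarith
  have e1 := Real.sq_sqrt hS10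
  have e2 := Real.sq_sqrt hS20
  have e3 := Real.sqrt_nonneg S1
  have e4 := Real.sqrt_nonneg S2
  -- The arithmetic-geometric mean inequality bounds the two regularising terms below by `2 s ^ 3
  -- √S1 √S2`, which beats the cross term of order `s ^ 4` once `s * W ≤ 2`.
  have hfin : W * (s ^ 4 * (Real.sqrt S1 * Real.sqrt S2)) ≤ s * S1 + s ^ 5 * S2 := by
    calc W * (s ^ 4 * (Real.sqrt S1 * Real.sqrt S2)) =
          (s * W) * (s ^ 3 * (Real.sqrt S1 * Real.sqrt S2)) := by ring
      _ ≤ 2 * (s ^ 3 * (Real.sqrt S1 * Real.sqrt S2)) := by gcongr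
      _ ≤ s * Real.sqrt S1 ^ 2 + s ^ 5 * Real.sqrt S2 ^ 2 := by
          have := mul_nonneg hs0.le (sq_nonneg (Real.sqrt S1 - s ^ 2 * Real.sqrt S2))
          nlinarith
      _ = _ := by rw [e1, e2]
  rw [Complex.zero_le_real]
  linarith

end Jets

/-! ### From nonseparable second-order moments to entangled states passing `k` tests. -/

section Core

open MvPolynomial

variable {ι α β : Type*} [Fintype α] [Fintype β]

lemma trace_pos_of_notMem_sepCone {ρ : Matrix (α × β) (α × β) ℂ} (hρ : ρ.PosSemidef)
    (h : ρ ∉ sepCone α β) : ∃ r : ℝ, 0 < r ∧ ρ.trace = r := by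
  have h0 := Complex.nonneg_iff.mp hρ.trace_nonneg
  have e : ρ.trace = (ρ.trace.re : ℂ) := Complex.ext rfl h0.2.symm
  refine ⟨ρ.trace.re, h0.1.lt_of_ne fun h1 => h ?_, e⟩
  rw [← h1, Complex.ofReal_zero, hρ.trace_eq_zero_iff] at e
  rw [e]
  exact zero_mem _

omit [Fintype α] [Fintype β] in
lemma smul_mem_sepCone_iff {ρ : Matrix (α × β) (α × β) ℂ} {r : ℝ} (hr : 0 < r) :
    (r : ℂ) • ρ ∈ sepCone α β ↔ ρ ∈ sepCone α β := by
  refine ⟨fun h => ?_, fun h => sepCone_smul h hr.le⟩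
  have := sepCone_smul h (inv_nonneg.mpr hr.le)
  rwa [smul_smul, ← Complex.ofReal_mul, inv_mul_cancel₀ hr.ne', Complex.ofReal_one,
    one_smul] at this

lemma eventually_notMem_sepCone_of_posSemidef {X : Type*} {l : Filter X}
    {f : X → Matrix (α × β) (α × β) ℂ} {ρ : Matrix (α × β) (α × β) ℂ} (hf : Tendsto f l (𝓝 ρ))
    (hp : ρ.PosSemidef) (hρ : ρ ∉ sepCone α β) : ∀ᶠ x in l, f x ∉ sepCone α β := by
  obtain ⟨r, hr, e⟩ := trace_pos_of_notMem_sepCone hp hρ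
  have h := eventually_notMem_sepCone (hf.const_smul ((r⁻¹ : ℝ) : ℂ))
    (ρ := ((r⁻¹ : ℝ) : ℂ) • ρ) (by rwa [smul_mem_sepCone_iff (inv_pos.mpr hr)]) (by
      rw [trace_smul, e, smul_eq_mul, ← Complex.ofReal_mul, inv_mul_cancel₀ hr.ne',
        Complex.ofReal_one])
  filter_upwards [h] with x hx
  rwa [smul_mem_sepCone_iff (inv_pos.mpr hr)] at hx

-- Moments of linear images of the variables are a local conjugation of the moment matrix `Λ`, hence
-- inherit its positivity.
omit [Fintype α] in
lemma of_sum_eq_kronecker_conj {κ : Type*} [Fintype κ] [DecidableEq β]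
    (J : α → κ → ℂ) (Λ : κ → κ → Matrix β β ℂ) :
    (Matrix.of fun x y : α × β => ∑ c, ∑ c', J x.1 c * star (J y.1 c') * Λ c c' x.2 y.2) =
      ((Matrix.of J) ⊗ₖ (1 : Matrix β β ℂ)) *
        (Matrix.of fun x y : κ × β => Λ x.1 y.1 x.2 y.2) *
        ((Matrix.of J) ⊗ₖ (1 : Matrix β β ℂ))ᴴ := by
  ext x y
  simp only [of_apply, Matrix.mul_apply, conjTranspose_apply, kroneckerMap_apply,
    Fintype.sum_prod_type, Matrix.one_apply]
  simp only [mul_ite, mul_one, mul_zero, ite_mul, zero_mul, Finset.sum_ite_eq,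
    Finset.mem_univ, if_true, star_zero, apply_ite star]
  rw [Finset.sum_comm]
  refine Finset.sum_congr rfl fun c _ => ?_
  rw [Finset.sum_mul]
  refine Finset.sum_congr rfl fun c' _ => ?_
  ring

/-- The affine polynomial with the given coefficients. -/
noncomputable def affinePoly [Fintype ι] (v : Option ι → ℂ) : MvPolynomial ι ℂ :=
  C (v none) + ∑ i, C (v (some i)) * X i

variable [Fintype ι]

lemma totalDegree_affinePoly_le (v : Option ι → ℂ) : (affinePoly v).totalDegree ≤ 1 := by
  refine (totalDegree_add _ _).trans (max_le (by simp) ((totalDegree_finsetSum _ _).trans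
    (Finset.sup_le fun i _ => (totalDegree_mul _ _).trans (by simp))))

lemma eval_affinePoly (v : Option ι → ℂ) (u : ι → ℂ) :
    eval u (affinePoly v) = v none + ∑ i, v (some i) * u i := by
  simp [affinePoly]

lemma pderiv_affinePoly (v : Option ι → ℂ) (i : ι) :
    pderiv i (affinePoly v) = C (v (some i)) := by
  classical
  simp [affinePoly, Derivation.leibniz, pderiv_X, Pi.single_apply]

lemma jet_affinePoly (v : Option ι → ℂ) (c : Option ι) : jet c (affinePoly v) = v c := by
  cases c with
  | none => rw [jet_none, eval_affinePoly]; simp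
  | some i => rw [jet_some, pderiv_affinePoly, eval_C]

lemma hess_affinePoly (v : Option ι → ℂ) (i l : ι) : hess i l (affinePoly v) = 0 := by
  rw [hess_apply, pderiv_affinePoly]; simp

variable [DecidableEq ι] [DecidableEq β]

-- Affine polynomials have no Hessian, so the jet part gives exactly the prescribed moments. The
-- grid part vanishes in the limit: products of two affine polynomials grow like `s⁻⁴` there,
-- against the weight `s ^ 5`.
omit [Fintype α] [Fintype β] in
lemma tendsto_momentMatrix_regFunctional {Λ : Option ι → Option ι → Matrix β β ℂ}
    (hsym : ∀ c c', Λ c c' = Λ c' c) (J : α → Option ι → ℂ) (k : ℕ) :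
    Tendsto (fun s : ℝ => momentMatrix (regFunctional Λ k s) fun a => affinePoly (J a)) (𝓝[>] 0)
      (𝓝 (Matrix.of fun x y => ∑ c, ∑ c', J x.1 c * star (J y.1 c') * Λ c c' x.2 y.2)) := by
  refine tendsto_pi_nhds.mpr fun x => tendsto_pi_nhds.mpr fun y => ?_
  have hlim : Tendsto (fun s : ℝ => (∑ c, ∑ c', J x.1 c * star (J y.1 c') * Λ c c' x.2 y.2) +
      (s : ℂ) * (J x.1 none * star (J y.1 none)) * (1 : Matrix β β ℂ) x.2 y.2 +
      (s : ℂ) * (∑ u : ι → Fin (k + 1),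
        ((s : ℂ) ^ 2 * J x.1 none + ∑ i, J x.1 (some i) * ((u i : ℕ) : ℂ)) *
        star ((s : ℂ) ^ 2 * J y.1 none + ∑ i, J y.1 (some i) * ((u i : ℕ) : ℂ))) *
        (1 : Matrix β β ℂ) x.2 y.2) (𝓝[>] 0)
      (𝓝 (∑ c, ∑ c', J x.1 c * star (J y.1 c') * Λ c c' x.2 y.2)) := by
    refine Tendsto.mono_left ?_ nhdsWithin_le_nhds
    refine Continuous.tendsto' ?_ _ _ ?_
    · fun_prop
    · simp
  refine hlim.congr' ?_
  filter_upwards [self_mem_nhdsWithin] with s hs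
  have hs0 : (s : ℂ) ≠ 0 := by
    have : (0 : ℝ) < s := hs
    exact_mod_cast this.ne'
  simp only [momentMatrix, of_apply, regFunctional_apply, jetFunctional_mul_polyConj hsym,
    jet_affinePoly, hess_affinePoly, Matrix.add_apply, Matrix.smul_apply, smul_eq_mul,
    Matrix.sum_apply]
  have e0 : jet none (affinePoly (J x.1) * polyConj (affinePoly (J y.1))) =
      J x.1 none * star (J y.1 none) := by
    rw [jet_none, map_mul, ← jet_none, ← jet_none, jet_polyConj, jet_affinePoly, jet_affinePoly]
  have e1 : (s : ℂ) * (∑ u : ι → Fin (k + 1),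
        ((s : ℂ) ^ 2 * J x.1 none + ∑ i, J x.1 (some i) * ((u i : ℕ) : ℂ)) *
        star ((s : ℂ) ^ 2 * J y.1 none + ∑ i, J y.1 (some i) * ((u i : ℕ) : ℂ))) =
      (s : ℂ) ^ 5 * ∑ u : ι → Fin (k + 1),
        eval (fun i => ((s : ℂ) ^ 2)⁻¹ * ((u i : ℕ) : ℂ))
          (affinePoly (J x.1) * polyConj (affinePoly (J y.1))) := by
    rw [Finset.mul_sum, Finset.mul_sum]
    refine Finset.sum_congr rfl fun u _ => ?_
    have e2 : ∀ v : Option ι → ℂ, (s : ℂ) ^ 2 * v none + ∑ i, v (some i) * ((u i : ℕ) : ℂ) =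
        (s : ℂ) ^ 2 * eval (fun i => ((s : ℂ) ^ 2)⁻¹ * ((u i : ℕ) : ℂ)) (affinePoly v) := by
      intro v
      rw [eval_affinePoly, mul_add, Finset.mul_sum]
      congr 1
      refine Finset.sum_congr rfl fun i _ => ?_
      field_simp
    rw [e2, e2, map_mul, eval_polyConj (star_gridPoint s u), star_mul', star_pow,
      Complex.star_def, Complex.conj_ofReal]
    ring
  rw [e0, e1]
  simp

-- Every entry is a polynomial in `ε` with the desired constant term.
omit [Fintype α] [Fintype β] [Fintype ι] [DecidableEq ι] [DecidableEq β] in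
lemma tendsto_momentMatrix_mulLeft (L : MvPolynomial ι ℂ →ₗ[ℂ] Matrix β β ℂ)
    (x : α → MvPolynomial ι ℂ) (h : MvPolynomial ι ℂ) (n : ℕ) :
    Tendsto (fun ε : ℝ => momentMatrix
        (L ∘ₗ LinearMap.mulLeft ℂ ((((ε : ℂ) ^ 2) • h + 1) ^ n)) x) (𝓝[>] 0)
      (𝓝 (momentMatrix L x)) := by
  refine tendsto_pi_nhds.mpr fun X => tendsto_pi_nhds.mpr fun Y => ?_
  refine Tendsto.mono_left ?_ nhdsWithin_le_nhds
  refine Continuous.tendsto' ?_ _ _ ?_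
  · have : ∀ ε : ℝ, (L ((((ε : ℂ) ^ 2) • h + 1) ^ n * (x X.1 * polyConj (x Y.1)))) X.2 Y.2 =
        ∑ m ∈ Finset.range (n + 1), ((ε : ℂ) ^ 2) ^ m *
          L (h ^ m * (n.choose m : MvPolynomial ι ℂ) * (x X.1 * polyConj (x Y.1))) X.2 Y.2 := by
      intro ε
      rw [add_pow, Finset.sum_mul, map_sum, Matrix.sum_apply]
      refine Finset.sum_congr rfl fun m _ => ?_
      rw [one_pow, mul_one, smul_pow, smul_mul_assoc, smul_mul_assoc, map_smul,
        Matrix.smul_apply, smul_eq_mul]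
    simp only [momentMatrix, of_apply, LinearMap.comp_apply, LinearMap.mulLeft_apply, this]
    fun_prop
  · simp [momentMatrix]

variable [DecidableEq α]

/-- An operator that is not separable and is the image, under a linear map sending the
distinguished basis vector `a₀` to itself, of a positive operator invariant under partial
transposition, yields entangled states passing arbitrarily many tests. -/
theorem exists_isEntangled_mem_passing {Λ : Option ι → Option ι → Matrix β β ℂ}
    (hsym : ∀ c c', Λ c c' = Λ c' c) (hherm : ∀ c c', (Λ c c').IsHermitian)
    (hpsd : (Matrix.of fun x y : Option ι × β => Λ x.1 y.1 x.2 y.2).PosSemidef)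
    {J : α → Option ι → ℂ} {a₀ : α} (hJ : J a₀ none = 1) (hJ' : ∀ i, J a₀ (some i) = 0)
    (hns : (Matrix.of fun x y : α × β =>
      ∑ c, ∑ c', J x.1 c * star (J y.1 c') * Λ c c' x.2 y.2) ∉ sepCone α β)
    {k : ℕ} (hk : 1 ≤ k) :
    ∃ ρ : Matrix (α × β) (α × β) ℂ, IsEntangled ρ ∧ ∀ j, 1 ≤ j → j ≤ k → ρ ∈ passing α β j := by
  have hpos : (Matrix.of fun x y : α × β =>
      ∑ c, ∑ c', J x.1 c * star (J y.1 c') * Λ c c' x.2 y.2).PosSemidef := by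
    rw [of_sum_eq_kronecker_conj]
    exact hpsd.mul_mul_conjTranspose_same _
  obtain ⟨s, hs1, hs2⟩ := ((eventually_isPositiveUpTo_regFunctional hsym hherm hpsd k).and
    (eventually_notMem_sepCone_of_posSemidef (tendsto_momentMatrix_regFunctional hsym J k)
      hpos hns)).exists
  set L := regFunctional Λ k s
  set ξ : α → MvPolynomial ι ℂ := fun a => affinePoly (J a) with hξ
  have hξdeg : ∀ a, (ξ a).totalDegree ≤ 1 := fun a => totalDegree_affinePoly_le _
  have hξ0 : ξ a₀ = 1 := by simp [hξ, affinePoly, hJ, hJ']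
  have hpL : IsPositiveUpTo 1 L := fun c hc => hs1 c fun b => (hc b).trans hk
  set h : MvPolynomial ι ℂ := ∑ a ∈ Finset.univ.erase a₀, ξ a * polyConj (ξ a) with hh
  obtain ⟨ε, hε1, hε0⟩ := ((eventually_notMem_sepCone_of_posSemidef
    (tendsto_momentMatrix_mulLeft L ξ h (k - 1)) (momentMatrix_posSemidef hpL hξdeg) hs2).and
    self_mem_nhdsWithin).exists
  replace hε0 : 0 < ε := hε0
  have hεc : (ε : ℂ) ≠ 0 := by exact_mod_cast hε0.ne'
  -- Since `ξ a₀ = 1`, shrinking the other coordinates makes `normSqPoly x` equal to `1 + ε ^ 2 •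
  -- h`.
  set d : α → ℂ := fun a => if a = a₀ then 1 else (ε : ℂ) with hd
  have hd0 : ∀ a, d a ≠ 0 := fun a => by simp only [hd]; split_ifs <;> simp [hεc]
  have hdstar : ∀ a, star (d a) = d a := fun a => by simp only [hd]; split_ifs <;> simp
  set x : α → MvPolynomial ι ℂ := fun a => d a • ξ a with hx
  have hxdeg : ∀ a, (x a).totalDegree ≤ 1 := fun a => (totalDegree_smul_le _ _).trans (hξdeg a)
  have hnorm : normSqPoly x = ((ε : ℂ) ^ 2) • h + 1 := by
    rw [normSqPoly, ← Finset.sum_erase_add _ _ (Finset.mem_univ a₀)]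
    congr 1
    · rw [hh, Finset.smul_sum]
      refine Finset.sum_congr rfl fun a ha => ?_
      have : a ≠ a₀ := Finset.ne_of_mem_erase ha
      simp only [hx, polyConj_smul, hdstar, smul_mul_smul_comm]
      simp [hd, this, sq]
    · simp [hx, hd, hξ0]
  set ρ := momentMatrix (L ∘ₗ LinearMap.mulLeft ℂ (normSqPoly x ^ (k - 1))) x with hρ
  -- The inverse scaling acts on `A` alone, so it would carry a separable `ρ` to a separable
  -- operator, contradicting the choice of `ε`.
  have hfilter : momentMatrix (L ∘ₗ LinearMap.mulLeft ℂ ((((ε : ℂ) ^ 2) • h + 1) ^ (k - 1))) ξ =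
      (diagonal (fun a => (d a)⁻¹) ⊗ₖ (1 : Matrix β β ℂ)) * ρ *
        (diagonal (fun a => (d a)⁻¹) ⊗ₖ (1 : Matrix β β ℂ))ᴴ := by
    rw [← diagonal_one, diagonal_kronecker_diagonal, diagonal_conjTranspose]
    ext X Y
    rw [mul_diagonal, diagonal_mul, hρ, hnorm]
    simp only [momentMatrix, of_apply, hx, polyConj_smul, hdstar, smul_mul_smul_comm, map_smul,
      Matrix.smul_apply, smul_eq_mul, Pi.star_apply, mul_one, star_inv₀]
    have := hd0 X.1
    have := hd0 Y.1
    field_simp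
  have hρns : ρ ∉ sepCone α β := fun hmem => hε1 (by rw [hfilter]; exact sepCone_conj _ _ hmem)
  have hρpos : ρ.PosSemidef := by
    refine momentMatrix_posSemidef (k := 1) (IsPositiveUpTo.mul_normSqPoly_pow (k - 1) ?_ hxdeg)
      hxdeg
    rwa [Nat.add_sub_cancel' hk]
  obtain ⟨r, hr, hrt⟩ := trace_pos_of_notMem_sepCone hρpos hρns
  have hscale : ((r⁻¹ : ℝ) : ℂ) • ρ =
      momentMatrix ((((r⁻¹ : ℝ) : ℂ) • L) ∘ₗ LinearMap.mulLeft ℂ (normSqPoly x ^ (k - 1))) x := by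
    ext X Y
    simp [hρ, momentMatrix]
  have htr : (((r⁻¹ : ℝ) : ℂ) • ρ).trace = 1 := by
    rw [trace_smul, hrt, smul_eq_mul, ← Complex.ofReal_mul, inv_mul_cancel₀ hr.ne',
      Complex.ofReal_one]
  have hLs : IsPositiveUpTo k (((r⁻¹ : ℝ) : ℂ) • L) := by
    intro c hc
    have h1 := hs1 c hc
    have h2 : (0 : ℂ) ≤ ((r⁻¹ : ℝ) : ℂ) := by
      rw [Complex.zero_le_real]; exact inv_nonneg.mpr hr.le
    refine (mul_nonneg h2 h1).trans_eq ?_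
    simp only [LinearMap.smul_apply, Matrix.smul_apply, smul_eq_mul, Finset.mul_sum]
  refine ⟨((r⁻¹ : ℝ) : ℂ) • ρ, ⟨⟨?_, htr⟩, fun hsep => ?_⟩, fun j hj hjk => ?_⟩
  · exact hρpos.smul (by rw [Complex.zero_le_real]; exact inv_nonneg.mpr hr.le)
  · exact hρns ((smul_mem_sepCone_iff (inv_pos.mpr hr)).mp (isSeparable_iff.mp hsep).1)
  · rw [hscale] at htr ⊢
    exact momentMatrix_mem_passing hLs hxdeg htr hj hjk

end Core

/-! ### Two sources of second-order moments: invariant operators, and PPT operators with a qubit. -/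

section Instances

variable {α β : Type*} [Fintype α] [Fintype β] [DecidableEq α] [DecidableEq β]

/-- An entangled operator that is invariant under partial transposition yields entangled states
passing arbitrarily many tests. -/
theorem exists_isEntangled_mem_passing_of_partialTransposeA_eq
    {ρ : Matrix (α × β) (α × β) ℂ} (hρ : ρ.PosSemidef) (hT : partialTransposeA ρ = ρ)
    (hns : ρ ∉ sepCone α β) {k : ℕ} (hk : 1 ≤ k) :
    ∃ ρ : Matrix (α × β) (α × β) ℂ, IsEntangled ρ ∧ ∀ j, 1 ≤ j → j ≤ k → ρ ∈ passing α β j := by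
  rcases isEmpty_or_nonempty α with hα | ⟨⟨a₀⟩⟩
  · exact absurd (by rw [show ρ = 0 from Subsingleton.elim _ _]; exact zero_mem _) hns
  have hT' : ∀ a b a' b', ρ (a, b) (a', b') = ρ (a', b) (a, b') := fun a b a' b' => by
    conv_lhs => rw [← hT]
    rfl
  -- The constant `none` plays the role of `a₀`, and `some a₀` duplicates it harmlessly: the index
  -- type `Option α` is pulled back along `g`, and `f` is a section of `g`.
  let g : Option α → α := fun c => c.getD a₀
  let f : α → Option α := fun a => if a = a₀ then none else some a
  have hgf : ∀ a, g (f a) = a := fun a => by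
    by_cases h : a = a₀ <;> simp [f, g, h]
  refine exists_isEntangled_mem_passing (ι := α) (a₀ := a₀)
    (Λ := fun c c' => Matrix.of fun b b' => ρ (g c, b) (g c', b'))
    (J := fun a c => if c = f a then 1 else 0) ?_ ?_ ?_ ?_ ?_ ?_ hk
  · intro c c'
    ext b b'
    exact hT' _ _ _ _
  · intro c c'
    ext b b'
    rw [conjTranspose_apply, of_apply, of_apply, hT', ← conjTranspose_apply, hρ.isHermitian.eq]
  · exact hρ.submatrix fun x : Option α × β => (g x.1, x.2)
  · simp [f]
  · simp [f]
  · convert! hns using 2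
    ext ⟨a, b⟩ ⟨a', b'⟩
    simp [hgf]

/-- The block of an operator with respect to two basis vectors of `A`. -/
def blockA (ρ : Matrix (α × β) (α × β) ℂ) (a a' : α) : Matrix β β ℂ :=
  Matrix.of fun b b' => ρ (a, b) (a', b')

omit [Fintype α] [Fintype β] [DecidableEq α] [DecidableEq β] in
lemma conjTranspose_blockA {ρ : Matrix (α × β) (α × β) ℂ} (hρ : ρ.IsHermitian) (a a' : α) :
    (blockA ρ a a')ᴴ = blockA ρ a' a := by
  ext b b'
  simp only [blockA, conjTranspose_apply, of_apply]
  rw [← conjTranspose_apply, hρ.eq]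

omit [Fintype α] [DecidableEq α] in
lemma posSemidef_schur {ρ : Matrix (α × β) (α × β) ℂ} (hρ : ρ.PosSemidef) {a a' : α}
    (ha : (blockA ρ a a).PosDef) :
    (blockA ρ a' a' - blockA ρ a' a * (blockA ρ a a)⁻¹ * blockA ρ a a').PosSemidef := by
  have h := hρ.submatrix (Sum.elim (fun b => (a, b)) fun b => (a', b) : β ⊕ β → α × β)
  have e : ρ.submatrix (Sum.elim (fun b => (a, b)) fun b => (a', b) : β ⊕ β → α × β)
      (Sum.elim (fun b => (a, b)) fun b => (a', b)) =
      fromBlocks (blockA ρ a a) (blockA ρ a a') (blockA ρ a a')ᴴ (blockA ρ a' a') := by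
    rw [conjTranspose_blockA hρ.isHermitian]
    ext (i | i) (j | j) <;> rfl
  rw [e] at h
  have := ha.isUnit.invertible
  rw [PosDef.fromBlocks₁₁ _ _ ha] at h
  rwa [conjTranspose_blockA hρ.isHermitian] at h

/-- The block moments `L(q_i * conj q_j)` of `q = (1, z, conj z)`, completed by
`L(z ^ 2) = Qᴴ * P⁻¹ * Qᴴ`. -/
noncomputable def completion (P Q S : Matrix β β ℂ) : Option Bool → Option Bool → Matrix β β ℂ
  | none, none => P
  | none, some true => Q
  | none, some false => Qᴴ
  | some true, none => Qᴴ
  | some true, some true => S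
  | some true, some false => Qᴴ * P⁻¹ * Qᴴ
  | some false, none => Q
  | some false, some true => Q * P⁻¹ * Q
  | some false, some false => S

/-- The chosen value of `L(z ^ 2)` makes the Schur complement of `P` block diagonal. Its two blocks
are the Schur complements of `ρ` and of its partial transpose. -/
lemma posSemidef_completion {P Q S : Matrix β β ℂ} (hP : P.PosDef)
    (h1 : (S - Qᴴ * P⁻¹ * Q).PosSemidef) (h2 : (S - Q * P⁻¹ * Qᴴ).PosSemidef) :
    (Matrix.of fun x y : Option Bool × β => completion P Q S x.1 y.1 x.2 y.2).PosSemidef := by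
  have hPH : Pᴴ = P := hP.isHermitian.eq
  have hl : P * P⁻¹ = 1 := mul_nonsing_inv _ ((isUnit_iff_isUnit_det _).mp hP.isUnit)
  have hr : P⁻¹ * P = 1 := nonsing_inv_mul _ ((isUnit_iff_isUnit_det _).mp hP.isUnit)
  let K : Option Bool → Matrix β β ℂ := fun c => completion P Q S c none
  let N : Matrix (Option Bool × β) β ℂ := Matrix.of fun x b => K x.1 x.2 b
  have hE : ∀ i : Option Bool, (Matrix.single i i (1 : ℂ)).PosSemidef := fun i => by
    rw [← diagonal_single]
    refine PosSemidef.diagonal fun j => ?_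
    by_cases h : j = i
    · subst h; simp
    · simp [h]
  have hsum := ((hP.inv.posSemidef.mul_mul_conjTranspose_same N).add
    ((hE (some true)).kronecker h1)).add ((hE (some false)).kronecker h2)
  have hN : ∀ x y, (N * P⁻¹ * Nᴴ) x y = (K x.1 * P⁻¹ * (K y.1)ᴴ) x.2 y.2 := by
    intro x y
    simp [N, Matrix.mul_apply]
  convert! hsum using 1
  ext ⟨i, b⟩ ⟨j, b'⟩
  rw [Matrix.add_apply, Matrix.add_apply, hN, kroneckerMap_apply, kroneckerMap_apply, of_apply]
  rcases i with _ | _ | _ <;> rcases j with _ | _ | _ <;>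
    simp [K, completion, hPH, hl, hr, Matrix.mul_assoc]

/-- With a qubit on the extended side, every PPT operator that is not separable yields entangled
states passing arbitrarily many tests. -/
theorem exists_isEntangled_mem_passing_of_ppt
    {ρ : Matrix (Fin 2 × β) (Fin 2 × β) ℂ} (hρ : ρ.PosSemidef)
    (hT : (partialTransposeA ρ).PosSemidef)
    (hns : ρ ∉ sepCone (Fin 2) β) {k : ℕ} (hk : 1 ≤ k) :
    ∃ ρ : Matrix (Fin 2 × β) (Fin 2 × β) ℂ,
      IsEntangled ρ ∧ ∀ j, 1 ≤ j → j ≤ k → ρ ∈ passing (Fin 2) β j := by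
  -- Adding a small multiple of the identity keeps PPT and, by closedness, nonseparability.
  wlog hP : (blockA ρ 0 0).PosDef generalizing ρ
  · have hlim : Tendsto (fun η : ℝ => ρ + (η : ℂ) • (1 : Matrix (Fin 2 × β) (Fin 2 × β) ℂ))
        (𝓝[>] 0) (𝓝 ρ) := by
      refine Tendsto.mono_left ?_ nhdsWithin_le_nhds
      refine Continuous.tendsto' (by fun_prop) _ _ (by simp)
    obtain ⟨η, h1, h2⟩ := ((eventually_notMem_sepCone_of_posSemidef hlim hρ hns).and
      self_mem_nhdsWithin).exists
    replace h2 : 0 < η := h2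
    have hη : (0 : ℂ) < (η : ℂ) := by exact_mod_cast h2
    have h1p : ((η : ℂ) • (1 : Matrix (Fin 2 × β) (Fin 2 × β) ℂ)).PosSemidef :=
      PosSemidef.one.smul hη.le
    refine this (hρ.add h1p) ?_ h1 ?_
    · have : partialTransposeA (ρ + (η : ℂ) • (1 : Matrix (Fin 2 × β) (Fin 2 × β) ℂ)) =
          partialTransposeA ρ + (η : ℂ) • (1 : Matrix (Fin 2 × β) (Fin 2 × β) ℂ) := by
        ext x y
        simp only [partialTransposeA, of_apply, Matrix.add_apply, Matrix.smul_apply,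
          Matrix.one_apply, Prod.ext_iff]
        simp only [eq_comm]
      rw [this]
      exact hT.add h1p
    · have : blockA (ρ + (η : ℂ) • (1 : Matrix (Fin 2 × β) (Fin 2 × β) ℂ)) 0 0 =
          blockA ρ 0 0 + (η : ℂ) • (1 : Matrix β β ℂ) := by
        ext x y
        simp [blockA, Matrix.one_apply]
      rw [this]
      exact PosDef.posSemidef_add (hρ.submatrix fun b => (0, b)) (PosDef.one.smul hη)
  set P := blockA ρ 0 0 with hPdef
  set Q := blockA ρ 0 1 with hQdef
  set S := blockA ρ 1 1 with hSdef
  have hQ : Qᴴ = blockA ρ 1 0 := conjTranspose_blockA hρ.isHermitian _ _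
  have hPH : Pᴴ = P := hP.isHermitian.eq
  have hSH : Sᴴ = S := conjTranspose_blockA hρ.isHermitian _ _
  have hPinv : (P⁻¹)ᴴ = P⁻¹ := hP.inv.isHermitian.eq
  have h1 : (S - Qᴴ * P⁻¹ * Q).PosSemidef := by
    rw [hQ]; exact posSemidef_schur hρ hP
  have h2 : (S - Q * P⁻¹ * Qᴴ).PosSemidef := by
    rw [hQ]; exact posSemidef_schur (a := 0) (a' := 1) hT hP
  have hcomp := posSemidef_completion hP h1 h2
  set G : Option Bool → Option Bool → Matrix β β ℂ := completion P Q S with hG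
  have hGH : ∀ i j, (G i j)ᴴ = G j i := by
    intro i j
    rcases i with _ | _ | _ <;> rcases j with _ | _ | _ <;>
      simp [hG, completion, hPH, hSH, hPinv, Matrix.mul_assoc]
  -- `T` passes from `(1, z, conj z)` to the real variables `(1, Re z, Im z)`, whose moments are
  -- symmetric in the two indices; `J` recovers `1` and `z = Re z + I * Im z`.
  let T : Option Bool → Option Bool → ℂ := fun c i => match c, i with
    | none, none => 1
    | some true, some _ => 1 / 2
    | some false, some true => -(Complex.I / 2)
    | some false, some false => Complex.I / 2
    | _, _ => 0
  let Λ : Option Bool → Option Bool → Matrix β β ℂ := fun c c' =>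
    ∑ i, ∑ j, (T c i * star (T c' j)) • G i j
  let J : Fin 2 → Option Bool → ℂ := fun a c => match c with
    | none => if a = 0 then 1 else 0
    | some true => if a = 0 then 0 else 1
    | some false => if a = 0 then 0 else Complex.I
  have hΛ : (Matrix.of fun x y : Option Bool × β => Λ x.1 y.1 x.2 y.2) =
      Matrix.of fun x y => ∑ i, ∑ j, T x.1 i * star (T y.1 j) * G i j x.2 y.2 := by
    ext x y
    simp only [Λ, of_apply, Matrix.sum_apply, Matrix.smul_apply, smul_eq_mul]
  have e1 : star (1 / 2 : ℂ) = 1 / 2 := by simp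
  have e2 : star (Complex.I / 2) = -(Complex.I / 2) := by simp [neg_div]
  have e3 : star Complex.I = -Complex.I := by simp
  have hsym : ∀ c c', Λ c c' = Λ c' c := by
    intro c c'
    rcases c with _ | _ | _ <;> rcases c' with _ | _ | _ <;>
      simp only [Λ, T, Fintype.sum_option, Fintype.sum_bool, e1, e2, star_neg, star_one,
        star_zero, hG, completion] <;> module
  refine exists_isEntangled_mem_passing (ι := Bool) (a₀ := 0) (Λ := Λ) (J := J)
    hsym ?_ ?_ ?_ ?_ ?_ hk
  · intro c c'
    rw [IsHermitian]
    conv_rhs => rw [hsym]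
    simp only [Λ, conjTranspose_sum, conjTranspose_smul, hGH, star_mul', star_star]
    rw [Finset.sum_comm]
    refine Finset.sum_congr rfl fun i _ => Finset.sum_congr rfl fun j _ => ?_
    rw [mul_comm]
  · rw [hΛ, of_sum_eq_kronecker_conj]
    exact hcomp.mul_mul_conjTranspose_same _
  · simp [J]
  · intro i
    cases i <;> simp [J]
  · convert! hns using 2
    have h01 : ∀ a : Fin 2, a = 0 ∨ a = 1 := by decide
    ext ⟨a, b⟩ ⟨a', b'⟩
    have hb : ρ (a, b) (a', b') = blockA ρ a a' b b' := rfl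
    rw [hb, of_apply]
    rcases h01 a with rfl | rfl <;> rcases h01 a' with rfl | rfl <;>
      simp only [Λ, T, J, Fintype.sum_option, Fintype.sum_bool, e1, e2, star_neg, star_one,
        star_zero, hG, completion, if_true, one_ne_zero, if_false, ← hQ, ← hPdef, ← hQdef, ← hSdef,
        Matrix.add_apply, Matrix.smul_apply, smul_eq_mul, e3] <;>
      ring_nf
    all_goals try simp only [Complex.I_sq, Complex.I_pow_four]
    all_goals try ring

end Instances

/-! ### The range criterion for separability. -/

section RangeCriterion

variable {α β γ δ : Type*}

lemma eq_zero_or_exists_ketBra_add {M : Matrix (α × β) (α × β) ℂ} (hM : M ∈ sepCone α β) :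
    M = 0 ∨ ∃ (ψ : α → ℂ) (φ : β → ℂ), ψ ≠ 0 ∧ φ ≠ 0 ∧ ∃ M' ∈ sepCone α β, M = ketBra ψ ⊗ₖ ketBra φ + M' := by
  induction hM using AddSubmonoid.closure_induction with
  | mem x hx =>
    obtain ⟨ψ, φ, rfl⟩ := hx
    by_cases h : ψ = 0 ∨ φ = 0
    · left
      ext x y
      rcases h with rfl | rfl <;> simp [ketBra, vecMulVec_apply]
    · rw [not_or] at h
      exact Or.inr ⟨ψ, φ, h.1, h.2, 0, zero_mem _, by simp⟩
  | zero => exact Or.inl rfl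
  | add x y hxm hym hx hy =>
    rcases hx with rfl | ⟨ψ, φ, h1, h2, M', hM', rfl⟩
    · simpa using hy
    · exact Or.inr ⟨ψ, φ, h1, h2, M' + y, add_mem hM' hym, by rw [add_assoc]⟩

variable [Fintype α] [Fintype β]

lemma dotProduct_ketBra_mulVec (v w : α → ℂ) :
    star w ⬝ᵥ (ketBra v *ᵥ w) = star (star v ⬝ᵥ w) * (star v ⬝ᵥ w) := by
  rw [ketBra, vecMulVec_mulVec, star_dotProduct, dotProduct_comm]
  simp [dotProduct_comm, mul_comm]

omit [Fintype α] [Fintype β] in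
lemma ketBra_kron_ketBra (ψ : α → ℂ) (φ : β → ℂ) :
    ketBra ψ ⊗ₖ ketBra φ = ketBra fun x => ψ x.1 * φ x.2 := by
  ext x y
  simp [ketBra, vecMulVec_apply]
  ring

/-- A vector in the kernel of a sum of positive operators is orthogonal to each of their ranges. -/
lemma star_dotProduct_eq_zero_of_mulVec_eq_zero {v w : α → ℂ} {M : Matrix α α ℂ}
    (hM : M.PosSemidef) (h : (ketBra v + M) *ᵥ w = 0) : star v ⬝ᵥ w = 0 := by
  have h1 : star w ⬝ᵥ (ketBra v *ᵥ w) + star w ⬝ᵥ (M *ᵥ w) = 0 := by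
    rw [← dotProduct_add, ← add_mulVec, h, dotProduct_zero]
  have h2 := (add_eq_zero_iff_of_nonneg ((posSemidef_ketBra v).dotProduct_mulVec_nonneg w)
    (hM.dotProduct_mulVec_nonneg w)).mp h1
  rw [dotProduct_ketBra_mulVec] at h2
  simpa using h2.1

omit [Fintype α] [Fintype β] in
lemma partialTransposeA_add (M N : Matrix (α × β) (α × β) ℂ) :
    partialTransposeA (M + N) = partialTransposeA M + partialTransposeA N := rfl

omit [Fintype α] [Fintype β] in
lemma partialTransposeA_mem_sepCone {M : Matrix (α × β) (α × β) ℂ} (hM : M ∈ sepCone α β) :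
    partialTransposeA M ∈ sepCone α β := by
  induction hM using AddSubmonoid.closure_induction with
  | mem x hx =>
    obtain ⟨ψ, φ, rfl⟩ := hx
    rw [partialTransposeA_ketBra_kron]
    exact ketBra_kron_mem_sepCone _ _
  | zero => exact zero_mem _
  | add x y _ _ hx hy => exact add_mem hx hy

/-- The range criterion. -/
lemma exists_product_of_mem_sepCone {M : Matrix (α × β) (α × β) ℂ} (hM : M ∈ sepCone α β)
    (h0 : M ≠ 0) : ∃ (ψ : α → ℂ) (φ : β → ℂ), ψ ≠ 0 ∧ φ ≠ 0 ∧
      (∀ w, M *ᵥ w = 0 → ∑ a, ∑ b, star (ψ a * φ b) * w (a, b) = 0) ∧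
      (∀ w, partialTransposeA M *ᵥ w = 0 → ∑ a, ∑ b, star (star (ψ a) * φ b) * w (a, b) = 0) := by
  rcases eq_zero_or_exists_ketBra_add hM with h | ⟨ψ, φ, h1, h2, M', hM', rfl⟩
  · exact absurd h h0
  refine ⟨ψ, φ, h1, h2, fun w hw => ?_, fun w hw => ?_⟩
  · rw [ketBra_kron_ketBra] at hw
    simpa [dotProduct, Fintype.sum_prod_type] using
      star_dotProduct_eq_zero_of_mulVec_eq_zero (posSemidef_of_mem_sepCone hM') hw
  · rw [partialTransposeA_add, partialTransposeA_ketBra_kron, ketBra_kron_ketBra] at hw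
    simpa [dotProduct, Fintype.sum_prod_type] using star_dotProduct_eq_zero_of_mulVec_eq_zero
      (posSemidef_of_mem_sepCone (partialTransposeA_mem_sepCone hM')) hw

lemma kron_conj_apply (A : Matrix γ α ℂ) (B : Matrix δ β ℂ) (M : Matrix (α × β) (α × β) ℂ)
    (x y : γ × δ) : ((A ⊗ₖ B) * M * (A ⊗ₖ B)ᴴ) x y =
      ∑ b', ∑ b, ∑ a', ∑ a, A x.1 a * B x.2 b * M (a, b) (a', b') *
        (star (A y.1 a') * star (B y.2 b')) := by
  simp only [Matrix.mul_apply, conjTranspose_apply, kroneckerMap_apply, star_mul',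
    Finset.sum_mul, Fintype.sum_prod_type]
  rw [Finset.sum_comm]
  refine Finset.sum_congr rfl fun b' _ => ?_
  rw [Finset.sum_comm]
  simp_rw [Finset.sum_comm (s := (Finset.univ : Finset β))]
  exact Finset.sum_comm

lemma partialTransposeA_kron_conj (A : Matrix γ α ℂ) (B : Matrix δ β ℂ)
    (M : Matrix (α × β) (α × β) ℂ) :
    partialTransposeA ((A ⊗ₖ B) * M * (A ⊗ₖ B)ᴴ) =
      (A.map star ⊗ₖ B) * partialTransposeA M * (A.map star ⊗ₖ B)ᴴ := by
  ext x y
  rw [kron_conj_apply]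
  simp only [partialTransposeA, of_apply, map_apply, star_star]
  rw [kron_conj_apply]
  refine Finset.sum_congr rfl fun b' _ => Finset.sum_congr rfl fun b _ => ?_
  rw [Finset.sum_comm]
  refine Finset.sum_congr rfl fun a _ => Finset.sum_congr rfl fun a' _ => ?_
  ring

end RangeCriterion

/-! ### An invariant entangled operator in `3 × 3` from an unextendible product basis. -/

section Tiles

/-- The first factors of the product vectors of the tiles configuration. -/
def tilesA : Fin 5 → Fin 3 → ℤ :=
  ![![1, 0, 0], ![1, -1, 0], ![0, 0, 1], ![0, 1, -1], ![1, 1, 1]]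

/-- The second factors of the product vectors of the tiles configuration. -/
def tilesB : Fin 5 → Fin 3 → ℤ :=
  ![![1, -1, 0], ![0, 0, 1], ![0, 1, -1], ![1, 0, 0], ![1, 1, 1]]

/-- A multiple of the projection onto the orthogonal complement of the tiles product vectors. -/
def tilesInt : Matrix (Fin 3 × Fin 3) (Fin 3 × Fin 3) ℤ :=
  Matrix.of fun x y => (if x = y then 36 else 0) -
    -- The weights are 36 divided by the squared norms 2, 2, 2, 2, 9 of the product vectors.
    ∑ i, ![18, 18, 18, 18, 4] i * (tilesA i x.1 * tilesB i x.2 * (tilesA i y.1 * tilesB i y.2))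

lemma tilesInt_mul_self (x y : Fin 3 × Fin 3) :
    ∑ z, tilesInt z x * tilesInt z y = 36 * tilesInt x y := by
  revert x y
  decide +kernel

/-- The product vectors are real, so transposing the first factor fixes each projector. -/
lemma tilesInt_swap (a b a' b' : Fin 3) : tilesInt (a, b) (a', b') = tilesInt (a', b) (a, b') := by
  revert a b a' b'
  decide +kernel

lemma tilesInt_mulVec (i : Fin 5) (x : Fin 3 × Fin 3) :
    ∑ y, tilesInt x y * (tilesA i y.1 * tilesB i y.2) = 0 := by
  revert i x
  decide +kernel

/-- A multiple of the bound entangled tiles state. -/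
noncomputable def tiles : Matrix (Fin 3 × Fin 3) (Fin 3 × Fin 3) ℂ :=
  Matrix.of fun x y => (tilesInt x y : ℂ)

lemma posSemidef_tiles : tiles.PosSemidef := by
  have h : tiles = (1 / 36 : ℂ) • (tilesᴴ * tiles) := by
    ext x y
    have := congrArg (Int.cast : ℤ → ℂ) (tilesInt_mul_self x y)
    push_cast at this
    simp [tiles, Matrix.mul_apply, this]
  rw [h]
  exact (posSemidef_conjTranspose_mul_self _).smul (by norm_num [Complex.le_def])

lemma partialTransposeA_tiles : partialTransposeA tiles = tiles := by
  ext ⟨a, b⟩ ⟨a', b'⟩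
  simp [partialTransposeA, tiles, tilesInt_swap a' b a b']

lemma tiles_notMem_sepCone : tiles ∉ sepCone (Fin 3) (Fin 3) := by
  intro h
  have h0 : tiles ≠ 0 := fun h0 => by
    have h1 : (tilesInt (0, 0) (0, 0) : ℂ) = 0 := congrFun (congrFun h0 (0, 0)) (0, 0)
    have h2 : tilesInt (0, 0) (0, 0) ≠ 0 := by decide +kernel
    exact h2 (by exact_mod_cast h1)
  obtain ⟨ψ, φ, hψ, hφ, h1, -⟩ := exists_product_of_mem_sepCone h h0
  have key : ∀ i, (∑ a, star (ψ a) * (tilesA i a : ℂ)) * ∑ b, star (φ b) * (tilesB i b : ℂ) = 0 := by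
    intro i
    have := h1 (fun x => (tilesA i x.1 : ℂ) * tilesB i x.2) (by
      ext x
      have := congrArg (Int.cast : ℤ → ℂ) (tilesInt_mulVec i x)
      push_cast at this
      simpa [tiles, mulVec, dotProduct] using this)
    rw [← this, Finset.sum_mul_sum]
    refine Finset.sum_congr rfl fun a _ => Finset.sum_congr rfl fun b _ => ?_
    rw [star_mul']
    ring
  have k0 := key 0
  have k1 := key 1
  have k2 := key 2
  have k3 := key 3
  have k4 := key 4
  simp only [Fin.sum_univ_three, tilesA, tilesB] at k0 k1 k2 k3 k4
  have hψ' : ¬ (star (ψ 0) = 0 ∧ star (ψ 1) = 0 ∧ star (ψ 2) = 0) := fun ⟨x, y, z⟩ => hψ (by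
    funext i; fin_cases i; exacts [star_eq_zero.mp x, star_eq_zero.mp y, star_eq_zero.mp z])
  have hφ' : ¬ (star (φ 0) = 0 ∧ star (φ 1) = 0 ∧ star (φ 2) = 0) := fun ⟨x, y, z⟩ => hφ (by
    funext i; fin_cases i; exacts [star_eq_zero.mp x, star_eq_zero.mp y, star_eq_zero.mp z])
  generalize star (ψ 0) = x0 at *
  generalize star (ψ 1) = x1 at *
  generalize star (ψ 2) = x2 at *
  generalize star (φ 0) = y0 at *
  generalize star (φ 1) = y1 at *
  generalize star (φ 2) = y2 at *
  simp at k0 k1 k2 k3 k4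
  -- One factor must be orthogonal to at least three of its five local vectors, but any three of
  -- these span the space on either side.
  grind

end Tiles

/-! ### An invariant entangled operator in `4 × 2`. -/

section RealOnQubit

/-- The complex symmetric matrix that is the second block of the Gram factor of a `4 × 2`
bound entangled state. -/
noncomputable def qubitMat : Matrix (Fin 4) (Fin 4) ℂ :=
  !![1, -Complex.I, 1, 0; -Complex.I, -1, 0, 1; 1, 0, 0, -Complex.I; 0, 1, -Complex.I, 0]

/-- The vector completing the Gram matrix to an operator invariant under partial transposition. -/
noncomputable def qubitVec : Fin 4 → ℂ := ![1, Complex.I, 0, 0]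

/-- The Gram factor of a multiple of a `4 × 2` bound entangled state. -/
noncomputable def qubitFactor : Matrix (Fin 4 × Fin 2) (Fin 4 ⊕ Fin 1) ℂ :=
  Matrix.of fun x m => Sum.elim
    (fun m => if x.2 = 0 then (1 : Matrix (Fin 4) (Fin 4) ℂ) x.1 m else qubitMat x.1 m)
    (fun _ => if x.2 = 0 then 0 else qubitVec x.1) m

/-- A multiple of a `4 × 2` bound entangled state invariant under partial transposition. -/
noncomputable def fourTwo : Matrix (Fin 4 × Fin 2) (Fin 4 × Fin 2) ℂ :=
  qubitFactor * Matrix.diagonal (Sum.elim (fun _ => 1) fun _ => 2 : Fin 4 ⊕ Fin 1 → ℂ) * qubitFactorᴴ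

lemma posSemidef_fourTwo : fourTwo.PosSemidef := by
  refine PosSemidef.mul_mul_conjTranspose_same (PosSemidef.diagonal fun i => ?_) _
  rcases i with i | i <;> simp

lemma fourTwo_apply (x y : Fin 4 × Fin 2) : fourTwo x y =
    ∑ m, qubitFactor x (Sum.inl m) * star (qubitFactor y (Sum.inl m)) +
      2 * qubitFactor x (Sum.inr 0) * star (qubitFactor y (Sum.inr 0)) := by
  rw [fourTwo, Matrix.mul_apply]
  simp only [mul_diagonal, conjTranspose_apply, Fintype.sum_sum_type, Sum.elim_inl, Sum.elim_inr,
    mul_one, Fin.sum_univ_one, mul_comm (2 : ℂ)]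

/-- With `A = qubitMat` and `v = qubitVec`, the blocks over the qubit are `1`, `Aᴴ`, `A` and `A Aᴴ +
2 v vᴴ`. Invariance says that all are symmetric: `A` is, and `2 v vᴴ` cancels the antisymmetric part
of `A Aᴴ`. -/
lemma partialTransposeA_fourTwo : partialTransposeA fourTwo = fourTwo := by
  ext ⟨a, b⟩ ⟨a', b'⟩
  simp only [partialTransposeA, of_apply, fourTwo_apply]
  fin_cases b <;> fin_cases b' <;> fin_cases a <;> fin_cases a' <;>
    simp [qubitFactor, qubitMat, qubitVec, Fin.sum_univ_four, Matrix.one_apply] <;> ring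

/-- The algebraic core of the absence of product vectors in the range. -/
lemma eq_zero_of_range_equations {z z' p q r s : ℂ}
    (e1 : p = z * r + Complex.I * s) (e2 : q = z * s + Complex.I * r)
    (e3 : z * p - (p + r - Complex.I * q) + Complex.I * (z * q - (-q + s - Complex.I * p)) = 0)
    (f1 : p = z' * r - Complex.I * s) (f2 : q = z' * s - Complex.I * r)
    (f3 : z' * p - (p + r + Complex.I * q) - Complex.I * (z' * q - (-q + s + Complex.I * p)) = 0) :
    p = 0 ∧ q = 0 ∧ r = 0 ∧ s = 0 := by
  have hI := Complex.I_sq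
  by_cases hr : r = 0
  · subst hr
    have hs : s = 0 := by
      have : 2 * Complex.I * s = 0 := by linear_combination f1 - e1
      simpa using this
    subst hs
    simp_all
  exfalso
  -- In terms of the difference `d` and the mean `a` of `z` and `z'`, the system becomes `d ^ 2 =
  -- -4`, `a ^ 2 - a - 1 = 0` and `a ^ 2 + a - 1 = 0`; the last two are incompatible.
  obtain ⟨d, hd⟩ : ∃ d, d = z - z' := ⟨_, rfl⟩
  obtain ⟨a, ha⟩ : ∃ a, 2 * a = z + z' := ⟨(z + z') / 2, by ring⟩
  have g1 : d * r = -2 * Complex.I * s := by rw [hd]; linear_combination f1 - e1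
  have g2 : d * s = -2 * Complex.I * r := by rw [hd]; linear_combination f2 - e2
  have hs : s = Complex.I * d * r / 2 := by
    linear_combination (-Complex.I / 2) * g1 + s * hI
  have hd2 : d ^ 2 = -4 := by
    apply mul_right_cancel₀ hr
    linear_combination d * g1 - 2 * Complex.I * g2 + 4 * r * hI
  have hp : p = a * r := by
    linear_combination (1 / 2) * e1 + (1 / 2) * f1 - (r / 2) * ha
  have hq : q = a * s := by
    linear_combination (1 / 2) * e2 + (1 / 2) * f2 - (s / 2) * ha
  have hz : z = a + d / 2 := by linear_combination -(1 / 2) * hd - (1 / 2) * ha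
  have hz' : z' = a - d / 2 := by linear_combination (1 / 2) * hd - (1 / 2) * ha
  rw [hp, hq, hs, hz] at e3
  rw [hp, hq, hs, hz'] at f3
  have k1 : r * (a ^ 2 - a - 1) = 0 := by
    linear_combination (e3 + f3) / 2 - Complex.I ^ 2 * a * r / 4 * hd2
  have k2 : d * r * (a ^ 2 + a - 1) = 0 := by
    linear_combination -(e3 - f3) + r * d * (2 * a + a ^ 2 - 1) * hI
  have hd0 : d ≠ 0 := by
    rintro rfl
    norm_num at hd2
  have k1' := (mul_eq_zero.mp k1).resolve_left hr
  have k2' := (mul_eq_zero.mp k2).resolve_left (mul_ne_zero hd0 hr)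
  have ha0 : a = 0 := by linear_combination (k2' - k1') / 2
  rw [ha0] at k1'
  norm_num at k1'

lemma fourTwo_mulVec {w : Fin 4 × Fin 2 → ℂ} (hw : qubitFactorᴴ *ᵥ w = 0) : fourTwo *ᵥ w = 0 := by
  rw [fourTwo, ← mulVec_mulVec, hw, mulVec_zero]

/-- The three test vectors below form a basis of the kernel of `fourTwo`, which has rank five. -/
lemma fourTwo_kernel_equations {p q r s f h : ℂ}
    (H : ∀ w, fourTwo *ᵥ w = 0 → ∑ a, ∑ b, ![p, q, r, s] a * ![f, h] b * w (a, b) = 0) :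
    h * r = f * (p + Complex.I * s) ∧ h * s = f * (q + Complex.I * r) ∧
      h * (p - Complex.I * q) = f * (2 * p + 2 * Complex.I * q + r - Complex.I * s) := by
  have hI := Complex.I_mul_I
  have h1 := H (fun x => ![![-1, 0], ![0, 0], ![0, 1], ![-Complex.I, 0]] x.1 x.2)
    (fourTwo_mulVec (by
      ext m
      rcases m with m | m <;> fin_cases m <;> simp [mulVec, dotProduct, qubitFactor, qubitMat,
        qubitVec, Fintype.sum_prod_type, Fin.sum_univ_four, Matrix.one_apply]))
  have h2 := H (fun x => ![![0, 0], ![-1, 0], ![-Complex.I, 0], ![0, 1]] x.1 x.2)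
    (fourTwo_mulVec (by
      ext m
      rcases m with m | m <;> fin_cases m <;> simp [mulVec, dotProduct, qubitFactor, qubitMat,
        qubitVec, Fintype.sum_prod_type, Fin.sum_univ_four, Matrix.one_apply]))
  have h3 := H (fun x => ![![-2, 1], ![-2 * Complex.I, -Complex.I], ![-1, 0], ![Complex.I, 0]] x.1 x.2)
    (fourTwo_mulVec (by
      ext m
      rcases m with m | m <;> fin_cases m <;> simp [mulVec, dotProduct, qubitFactor, qubitMat,
        qubitVec, Fintype.sum_prod_type, Fin.sum_univ_four, Matrix.one_apply]; norm_num; ring))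
  simp [Fin.sum_univ_four] at h1 h2 h3
  refine ⟨?_, ?_, ?_⟩
  · linear_combination h1
  · linear_combination h2
  · linear_combination h3

lemma fourTwo_notMem_sepCone : fourTwo ∉ sepCone (Fin 4) (Fin 2) := by
  intro hmem
  have h0 : fourTwo ≠ 0 := fun h0 => by
    have h1 : fourTwo (0, 0) (0, 0) = 0 := congrFun (congrFun h0 (0, 0)) (0, 0)
    simp [fourTwo_apply, qubitFactor, Matrix.one_apply] at h1
  obtain ⟨ψ, φ, hψ, hφ, h1, h2⟩ := exists_product_of_mem_sepCone hmem h0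
  rw [partialTransposeA_fourTwo] at h2
  have k1 := @fourTwo_kernel_equations (star (ψ 0)) (star (ψ 1)) (star (ψ 2)) (star (ψ 3))
    (star (φ 0)) (star (φ 1)) (fun w hw => by
      rw [← h1 w hw]
      simp [Fin.sum_univ_four])
  -- By invariance the partially conjugated product vector satisfies the same equations. Conjugating
  -- them below yields the second half of the system in the entries of `star ψ`.
  have k2 := @fourTwo_kernel_equations (ψ 0) (ψ 1) (ψ 2) (ψ 3)
    (star (φ 0)) (star (φ 1)) (fun w hw => by
      rw [← h2 w hw]
      simp [Fin.sum_univ_four])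
  obtain ⟨a1, a2, a3⟩ := k1
  obtain ⟨b1, b2, b3⟩ := k2
  replace b1 := congrArg star b1
  replace b2 := congrArg star b2
  replace b3 := congrArg star b3
  simp only [star_mul', star_add, star_sub, Complex.star_def, Complex.conj_I,
    map_ofNat, Complex.conj_conj] at a1 a2 a3 b1 b2 b3
  have hI := Complex.I_sq
  have hI0 := Complex.I_ne_zero
  have fin : star (ψ 0) = 0 ∧ star (ψ 1) = 0 ∧ star (ψ 2) = 0 ∧ star (ψ 3) = 0 := by
    simp only [Complex.star_def]
    by_cases hf : φ 0 = 0
    · have hh : φ 1 ≠ 0 := fun hh => hφ (by funext i; fin_cases i; exacts [hf, hh])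
      have hh' : (starRingEnd ℂ) (φ 1) ≠ 0 := by simpa using hh
      simp only [hf, map_zero, zero_mul, mul_eq_zero, hh, hh', false_or] at a1 a2 a3 b1 b2 b3
      refine ⟨?_, ?_, a1, a2⟩
      · linear_combination (a3 + b3) / 2
      · have : Complex.I * (starRingEnd ℂ) (ψ 1) = 0 := by linear_combination (b3 - a3) / 2
        simpa using this
    · have hf' : (starRingEnd ℂ) (φ 0) ≠ 0 := by simpa using hf
      refine eq_zero_of_range_equations (z := φ 1 / φ 0)
        (z' := (starRingEnd ℂ) (φ 1) / (starRingEnd ℂ) (φ 0)) ?_ ?_ ?_ ?_ ?_ ?_ <;> field_simp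
      · linear_combination -b1
      · linear_combination -b2
      · linear_combination b3 + (φ 0) * hI * (starRingEnd ℂ) (ψ 0)
      · linear_combination -a1
      · linear_combination -a2
      · linear_combination a3 + (starRingEnd ℂ) (φ 0) * hI * (starRingEnd ℂ) (ψ 0)
  exact hψ (by
    funext i
    fin_cases i
    exacts [star_eq_zero.mp fin.1, star_eq_zero.mp fin.2.1, star_eq_zero.mp fin.2.2.1,
      star_eq_zero.mp fin.2.2.2])

end RealOnQubit

/-! ### Transfer to larger dimensions and exchange of the two factors. -/

section Embedding

/-- The isometry including `ℂ ^ m` into `ℂ ^ n` along the first coordinates. -/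
def finIncl (m n : ℕ) : Matrix (Fin n) (Fin m) ℂ :=
  Matrix.of fun i j => if i.val = j.val then 1 else 0

lemma map_star_finIncl (m n : ℕ) : (finIncl m n).map star = finIncl m n := by
  ext i j
  simp [finIncl, apply_ite]

lemma conjTranspose_finIncl_mul {m n : ℕ} (h : m ≤ n) : (finIncl m n)ᴴ * finIncl m n = 1 := by
  ext i j
  rw [Matrix.mul_apply, Finset.sum_eq_single ⟨i, i.2.trans_le h⟩]
  · simp [finIncl, Matrix.one_apply, Fin.ext_iff]
  · intro x _ hx
    have : x.val ≠ i.val := fun h => hx (Fin.ext h)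
    simp [finIncl, this]
  · simp

variable {α β γ δ : Type*} [Fintype α] [Fintype β] [Fintype γ] [Fintype δ] [DecidableEq α]
  [DecidableEq β]

lemma mem_sepCone_of_isometry_conj {A : Matrix γ α ℂ} {B : Matrix δ β ℂ} (hA : Aᴴ * A = 1)
    (hB : Bᴴ * B = 1) {ρ : Matrix (α × β) (α × β) ℂ}
    (h : (A ⊗ₖ B) * ρ * (A ⊗ₖ B)ᴴ ∈ sepCone γ δ) : ρ ∈ sepCone α β := by
  have key : (A ⊗ₖ B)ᴴ * (A ⊗ₖ B) = 1 := by
    rw [conjTranspose_kronecker, ← mul_kronecker_mul, hA, hB, one_kronecker_one]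
  have := sepCone_conj Aᴴ Bᴴ h
  rw [← conjTranspose_kronecker, conjTranspose_conjTranspose] at this
  have e : (A ⊗ₖ B)ᴴ * ((A ⊗ₖ B) * ρ * (A ⊗ₖ B)ᴴ) * (A ⊗ₖ B) = ρ := by
    calc _ = ((A ⊗ₖ B)ᴴ * (A ⊗ₖ B)) * ρ * ((A ⊗ₖ B)ᴴ * (A ⊗ₖ B)) := by
          simp only [Matrix.mul_assoc]
      _ = ρ := by rw [key, Matrix.one_mul, Matrix.mul_one]
  rwa [e] at this

lemma exists_partialTransposeA_eq_of_le {m n m' n' : ℕ} (hm : m ≤ m') (hn : n ≤ n')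
    {ρ : Matrix (Fin m × Fin n) (Fin m × Fin n) ℂ} (h : ρ.PosSemidef)
    (hT : partialTransposeA ρ = ρ) (hs : ρ ∉ sepCone (Fin m) (Fin n)) :
    ∃ ρ : Matrix (Fin m' × Fin n') (Fin m' × Fin n') ℂ,
      ρ.PosSemidef ∧ partialTransposeA ρ = ρ ∧ ρ ∉ sepCone (Fin m') (Fin n') := by
  refine ⟨(finIncl m m' ⊗ₖ finIncl n n') * ρ * (finIncl m m' ⊗ₖ finIncl n n')ᴴ,
    h.mul_mul_conjTranspose_same _, ?_, fun hmem => hs (mem_sepCone_of_isometry_conj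
      (conjTranspose_finIncl_mul hm) (conjTranspose_finIncl_mul hn) hmem)⟩
  rw [partialTransposeA_kron_conj, map_star_finIncl, hT]

/-- In these dimensions there is a nonseparable positive operator invariant under partial
transposition. -/
lemma exists_partialTransposeA_eq {m n : ℕ} (h : 3 ≤ m ∧ 3 ≤ n ∨ 4 ≤ m ∧ 2 ≤ n) :
    ∃ ρ : Matrix (Fin m × Fin n) (Fin m × Fin n) ℂ,
      ρ.PosSemidef ∧ partialTransposeA ρ = ρ ∧ ρ ∉ sepCone (Fin m) (Fin n) := by
  rcases h with h | h
  · exact exists_partialTransposeA_eq_of_le h.1 h.2 posSemidef_tiles partialTransposeA_tiles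
      tiles_notMem_sepCone
  · exact exists_partialTransposeA_eq_of_le h.1 h.2 posSemidef_fourTwo partialTransposeA_fourTwo
      fourTwo_notMem_sepCone

omit [Fintype α] [Fintype β] [DecidableEq α] [DecidableEq β] in
lemma submatrix_swap_mem_sepCone {ρ : Matrix (α × β) (α × β) ℂ} (h : ρ ∈ sepCone α β) :
    ρ.submatrix Prod.swap Prod.swap ∈ sepCone β α := by
  induction h using AddSubmonoid.closure_induction with
  | mem x hx =>
    obtain ⟨ψ, φ, rfl⟩ := hx
    convert ketBra_kron_mem_sepCone φ ψ using 1
    ext x y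
    simp [mul_comm]
  | zero => exact zero_mem _
  | add x y _ _ hx hy => exact add_mem hx hy

/-- Exchanging the factors turns the partial transpose on `A` into that on `B`, which is the full
transpose of the former, so only PPT, and no longer invariance, is claimed. -/
lemma exists_ppt_two {n : ℕ} (hn : 4 ≤ n) :
    ∃ ρ : Matrix (Fin 2 × Fin n) (Fin 2 × Fin n) ℂ,
      ρ.PosSemidef ∧ (partialTransposeA ρ).PosSemidef ∧ ρ ∉ sepCone (Fin 2) (Fin n) := by
  obtain ⟨ρ, h, hT, hs⟩ := exists_partialTransposeA_eq (m := n) (n := 2) (Or.inr ⟨hn, le_rfl⟩)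
  refine ⟨ρ.submatrix Prod.swap Prod.swap, h.submatrix _, ?_, fun hmem => hs ?_⟩
  · have : partialTransposeA (ρ.submatrix Prod.swap Prod.swap) =
        ((partialTransposeA ρ).submatrix Prod.swap Prod.swap)ᵀ := by
      ext x y
      simp [partialTransposeA]
    rw [this, hT]
    exact (h.submatrix _).transpose
  · simpa using submatrix_swap_mem_sepCone hmem

end Embedding

/-! ### Average purity of ensembles of operators. -/

section Purity

variable {β O : Type*} [Fintype β] [Fintype O]

/-- The squared Frobenius norm of an operator divided by its trace. -/
noncomputable def purity (B : Matrix β β ℂ) : ℝ := (∑ b, ∑ b', ‖B b b'‖ ^ 2) / B.trace.re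

omit [Fintype β] in
lemma PosSemidef.norm_sq_apply_le {B : Matrix β β ℂ} (hB : B.PosSemidef) (b b' : β) :
    ‖B b b'‖ ^ 2 ≤ (B b b).re * (B b' b').re := by
  have h := (hB.submatrix ![b, b']).det_nonneg
  have h1 : B b' b = star (B b b') := (hB.1.apply b' b).symm
  rw [det_fin_two] at h
  simp only [submatrix_apply, Matrix.cons_val_zero, Matrix.cons_val_one, h1, Complex.star_def,
    Complex.mul_conj] at h
  have hb := (Complex.nonneg_iff.mp (hB.diag_nonneg (i := b))).2
  have h2 := (Complex.nonneg_iff.mp h).1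
  rw [← Complex.normSq_eq_norm_sq]
  simp [Complex.mul_re, ← hb] at h2
  exact h2

lemma PosSemidef.purity_le {B : Matrix β β ℂ} (hB : B.PosSemidef) : purity B ≤ B.trace.re := by
  have h0 : 0 ≤ B.trace.re := (Complex.nonneg_iff.mp hB.trace_nonneg).1
  have h : ∑ b, ∑ b', ‖B b b'‖ ^ 2 ≤ B.trace.re * B.trace.re := by
    simp only [Matrix.trace, diag_apply, Complex.re_sum, Finset.sum_mul_sum]
    gcongr with b _ b' _
    exact PosSemidef.norm_sq_apply_le hB b b'
  exact div_le_of_le_mul₀ h0 h0 h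

lemma PosSemidef.eq_zero_of_trace_re_eq_zero {B : Matrix β β ℂ} (hB : B.PosSemidef)
    (h : B.trace.re = 0) : B = 0 := by
  refine hB.trace_eq_zero_iff.mp (Complex.ext h ?_)
  exact (Complex.nonneg_iff.mp hB.trace_nonneg).2.symm

/-- Completing the square around the mean `(q / p) * w`. Division by zero is harmless because `z`
vanishes with `q`. -/
lemma norm_sq_div_eq {z w : ℂ} {p q : ℝ} (h : q = 0 → z = 0) :
    ‖z‖ ^ 2 / q = 2 * (w.re * z.re + w.im * z.im) / p - q * (‖w‖ ^ 2 / p ^ 2) +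
      ‖z - (q / p : ℝ) * w‖ ^ 2 / q := by
  by_cases hq : q = 0
  · simp [hq, h hq]
  simp only [← Complex.normSq_eq_norm_sq, Complex.normSq_apply, Complex.sub_re, Complex.sub_im,
    Complex.re_ofReal_mul, Complex.im_ofReal_mul]
  by_cases hp : p = 0
  · simp [hp]
  field_simp
  ring

/-- Linearising the quadratic gain with a parameter `t` allows summation over an ensemble without a
Cauchy–Schwarz step. -/
lemma two_mul_norm_sub_le {z : ℂ} {q t : ℝ} (hq : 0 ≤ q) (h : q = 0 → z = 0) :
    2 * t * ‖z‖ - t ^ 2 * q ≤ ‖z‖ ^ 2 / q := by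
  rcases hq.eq_or_lt with hq | hq
  · simp [← hq, h hq.symm]
  rw [le_div_iff₀ hq]
  nlinarith [sq_nonneg (‖z‖ - t * q)]

/-- Refining an ensemble increases the purity by a variance. -/
lemma purity_add_le {B : O → Matrix β β ℂ} (hB : ∀ x, (B x).PosSemidef) (x₀ : O) (b₀ b₀' : β)
    (t : ℝ) :
    purity (∑ x, B x) + (2 * t * ‖B x₀ b₀ b₀' -
      ((B x₀).trace.re / (∑ x, B x).trace.re : ℝ) * (∑ x, B x) b₀ b₀'‖ - t ^ 2 * (B x₀).trace.re) ≤
      ∑ x, purity (B x) := by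
  set S := ∑ x, B x with hS
  set p := S.trace.re with hp
  have hq : ∀ x, 0 ≤ (B x).trace.re := fun x => (Complex.nonneg_iff.mp (hB x).trace_nonneg).1
  have hz : ∀ x, (B x).trace.re = 0 → B x = 0 := fun x hx =>
    PosSemidef.eq_zero_of_trace_re_eq_zero (hB x) hx
  have hz' : ∀ x b b', (B x).trace.re = 0 →
      B x b b' - ((B x).trace.re / p : ℝ) * S b b' = 0 := fun x b b' hx => by simp [hz x hx]
  have hpsum : ∑ x, (B x).trace.re = p := by
    rw [hp, hS, trace_sum, Complex.re_sum]
  have e1 : ∀ x, purity (B x) = ∑ b, ∑ b', (2 * ((S b b').re * (B x b b').re +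
      (S b b').im * (B x b b').im) / p - (B x).trace.re * (‖S b b'‖ ^ 2 / p ^ 2)) +
      ∑ b, ∑ b', ‖B x b b' - ((B x).trace.re / p : ℝ) * S b b'‖ ^ 2 / (B x).trace.re := by
    intro x
    rw [purity, Finset.sum_div, ← Finset.sum_add_distrib]
    refine Finset.sum_congr rfl fun b _ => ?_
    rw [Finset.sum_div, ← Finset.sum_add_distrib]
    exact Finset.sum_congr rfl fun b' _ => norm_sq_div_eq fun h => by simp [hz x h]
  -- The parts linear in `B x` add up to the purity of the mean; the squares left over are the
  -- variance, of which only one entry of one outcome is kept.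
  have e2 : ∑ x, ∑ b, ∑ b', (2 * ((S b b').re * (B x b b').re +
      (S b b').im * (B x b b').im) / p - (B x).trace.re * (‖S b b'‖ ^ 2 / p ^ 2)) = purity S := by
    rw [Finset.sum_comm, purity, Finset.sum_div]
    refine Finset.sum_congr rfl fun b _ => ?_
    rw [Finset.sum_comm, Finset.sum_div]
    refine Finset.sum_congr rfl fun b' _ => ?_
    rw [Finset.sum_sub_distrib, ← Finset.sum_mul, hpsum, ← Finset.sum_div, ← Finset.mul_sum,
      Finset.sum_add_distrib, ← Finset.mul_sum, ← Finset.mul_sum, ← Complex.re_sum,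
      ← Complex.im_sum, ← Matrix.sum_apply, ← hS, ← Complex.normSq_eq_norm_sq,
      Complex.normSq_apply, ← hp]
    by_cases h : p = 0
    · simp [h]
    · field_simp
      ring
  have e3 : ‖B x₀ b₀ b₀' - ((B x₀).trace.re / p : ℝ) * S b₀ b₀'‖ ^ 2 / (B x₀).trace.re ≤
      ∑ x, ∑ b, ∑ b', ‖B x b b' - ((B x).trace.re / p : ℝ) * S b b'‖ ^ 2 / (B x).trace.re := by
    have nn : ∀ x b b',
        0 ≤ ‖B x b b' - ((B x).trace.re / p : ℝ) * S b b'‖ ^ 2 / (B x).trace.re :=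
      fun x b b' => div_nonneg (sq_nonneg _) (hq x)
    refine le_trans ?_ (Finset.single_le_sum (f := fun x => ∑ b, ∑ b', _)
      (fun x _ => Finset.sum_nonneg fun b _ => Finset.sum_nonneg fun b' _ => nn x b b')
      (Finset.mem_univ x₀))
    refine le_trans ?_ (Finset.single_le_sum (f := fun b => ∑ b', _)
      (fun b _ => Finset.sum_nonneg fun b' _ => nn x₀ b b') (Finset.mem_univ b₀))
    exact Finset.single_le_sum (f := fun b' => _) (fun b' _ => nn x₀ b₀ b') (Finset.mem_univ b₀')
  have e4 := two_mul_norm_sub_le (t := t) (hq x₀) (hz' x₀ b₀ b₀')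
  simp only [e1, Finset.sum_add_distrib] at *
  rw [e2]
  linarith

end Purity

/-! ### An informationally complete measurement on one copy of `A`. -/

section Measure

variable {α β : Type*} [Fintype α] [DecidableEq α]

/-- An informationally complete tight frame. -/
noncomputable def frame (x : α × α × Fin 4) : α → ℂ :=
  fun a => (if a = x.1 then 1 else 0) + Complex.I ^ (x.2.2 : ℕ) * (if a = x.2.1 then 1 else 0)

lemma sum_frame (a a' : α) : ∑ x, star (frame x a) * frame x a' =
    if a = a' then (8 * Fintype.card α : ℂ) else 0 := by
  have h : ∀ i j : α, ∑ t, star (frame (i, j, t) a) * frame (i, j, t) a' =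
      4 * ((if a = i then 1 else 0) * (if a' = i then 1 else 0)) +
      4 * ((if a = j then 1 else 0) * (if a' = j then 1 else 0)) := by
    intro i j
    have := Complex.I_sq
    simp only [frame, Fin.sum_univ_four]
    split_ifs <;> simp [pow_succ] <;> ring_nf <;> simp [this] <;> norm_num
  simp only [Fintype.sum_prod_type, h, Finset.sum_add_distrib, Finset.sum_const, Finset.card_univ,
    nsmul_eq_mul, ← Finset.mul_sum]
  have h' : ∑ i : α, (if a = i then (1 : ℂ) else 0) * (if a' = i then 1 else 0) =
      if a = a' then 1 else 0 := by
    simp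
  rw [h']
  split_ifs <;> ring

omit [Fintype α] in
lemma polarization_frame (i j a a' : α) :
    ∑ t : Fin 4, star (Complex.I ^ (t : ℕ)) * (star (frame (i, j, t) a) * frame (i, j, t) a') =
      4 * ((if a = i then 1 else 0) * (if a' = j then 1 else 0)) := by
  have := Complex.I_sq
  simp only [frame, Fin.sum_univ_four]
  split_ifs <;> simp [pow_succ] <;> ring_nf <;> simp [this] <;> norm_num

/-- The operator on `B` conditioned on an outcome of the frame measurement on `A`. -/
noncomputable def condFrame (x : α × α × Fin 4) (X : Matrix (α × β) (α × β) ℂ) : Matrix β β ℂ :=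
  Matrix.of fun b b' => (8 * Fintype.card α : ℂ)⁻¹ *
    ∑ a, ∑ a', star (frame x a) * X (a, b) (a', b') * frame x a'

/-- Polarisation: the conditional operators of the frame outcomes determine every entry of `X`. -/
lemma sum_condFrame (X : Matrix (α × β) (α × β) ℂ) [Nonempty α] (i j : α) (b b' : β) :
    ∑ t : Fin 4, star (Complex.I ^ (t : ℕ)) * condFrame (i, j, t) X b b' =
      (2 * Fintype.card α : ℂ)⁻¹ * X (i, b) (j, b') := by
  have hc : (Fintype.card α : ℂ) ≠ 0 := by simp
  have h : ∑ t : Fin 4, star (Complex.I ^ (t : ℕ)) * condFrame (i, j, t) X b b' =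
      (8 * Fintype.card α : ℂ)⁻¹ * ∑ a, ∑ a', X (a, b) (a', b') *
        ∑ t : Fin 4, star (Complex.I ^ (t : ℕ)) *
          (star (frame (i, j, t) a) * frame (i, j, t) a') := by
    simp only [condFrame, of_apply, Finset.mul_sum]
    rw [Finset.sum_comm]
    refine Finset.sum_congr rfl fun a _ => ?_
    rw [Finset.sum_comm]
    refine Finset.sum_congr rfl fun a' _ => Finset.sum_congr rfl fun t _ => ?_
    ring
  rw [h]
  simp only [polarization_frame]
  rw [Finset.sum_eq_single i, Finset.sum_eq_single j]
  · simp only [if_true, mul_one]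
    field_simp
    ring
  · intro y _ hy
    simp [hy]
  · simp
  · intro y _ hy
    simp [hy]
  · simp

/-- The operator on the remaining parties conditioned on an outcome of the frame measurement on the
first copy of `A`. -/
noncomputable def measureFirst {k : ℕ} (x : α × α × Fin 4) (σ : ExtOp (k + 1) α β) : ExtOp k α β :=
  Matrix.of fun z z' => (8 * Fintype.card α : ℂ)⁻¹ *
    ∑ a, ∑ a', star (frame x a) * σ (Fin.cons a z.1, z.2) (Fin.cons a' z'.1, z'.2) * frame x a'

/-- The reduced operator on `B`. -/
def traceA {γ : Type*} [Fintype γ] (M : Matrix (γ × β) (γ × β) ℂ) : Matrix β β ℂ :=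
  Matrix.of fun b b' => ∑ z, M (z, b) (z, b')

omit [DecidableEq α] in
lemma sum_fin_cons {k : ℕ} (f : (Fin (k + 1) → α) → ℂ) :
    ∑ z, f z = ∑ a, ∑ z : Fin k → α, f (Fin.cons a z) := by
  rw [← (Fin.consEquiv fun _ : Fin (k + 1) => α).sum_comp, Fintype.sum_prod_type]
  rfl

lemma traceOutAllBut_zero_apply {k : ℕ} (σ : ExtOp (k + 1) α β) (x y : α × β) :
    traceOutAllBut 0 σ x y = ∑ z : Fin k → α, σ (Fin.cons x.1 z, x.2) (Fin.cons y.1 z, y.2) := by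
  simp only [traceOutAllBut, of_apply, Finset.sum_filter]
  rw [sum_fin_cons, Finset.sum_eq_single x.1]
  · simp [Fin.update_cons_zero]
  · intro a _ ha
    simp [ha]
  · simp

lemma sum_measureFirst {k : ℕ} [Nonempty α] (σ : ExtOp (k + 1) α β)
    (z z' : (Fin k → α) × β) :
    ∑ x, measureFirst x σ z z' = ∑ a, σ (Fin.cons a z.1, z.2) (Fin.cons a z'.1, z'.2) := by
  have hc : (Fintype.card α : ℂ) ≠ 0 := by simp
  simp only [measureFirst, of_apply, ← Finset.mul_sum]
  have : ∑ x, ∑ a, ∑ a', star (frame x a) * σ (Fin.cons a z.1, z.2) (Fin.cons a' z'.1, z'.2) *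
      frame x a' = ∑ a, ∑ a', σ (Fin.cons a z.1, z.2) (Fin.cons a' z'.1, z'.2) *
        ∑ x, star (frame x a) * frame x a' := by
    simp only [Finset.mul_sum]
    rw [Finset.sum_comm]
    refine Finset.sum_congr rfl fun a _ => ?_
    rw [Finset.sum_comm]
    refine Finset.sum_congr rfl fun a' _ => Finset.sum_congr rfl fun t _ => ?_
    ring
  rw [this]
  simp only [sum_frame, mul_ite, mul_zero, Finset.sum_ite_eq, Finset.mem_univ, if_true,
    ← Finset.sum_mul]
  field_simp

lemma sum_traceOutAllBut_measureFirst {k : ℕ} [Nonempty α] (σ : ExtOp (k + 1) α β) (i : Fin k) :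
    ∑ x, traceOutAllBut i (measureFirst x σ) = traceOutAllBut i.succ σ := by
  ext u v
  rw [Matrix.sum_apply]
  simp only [traceOutAllBut, of_apply]
  rw [Finset.sum_comm]
  simp only [sum_measureFirst, Finset.sum_filter]
  rw [sum_fin_cons, Finset.sum_comm]
  refine Finset.sum_congr rfl fun z _ => ?_
  simp only [Fin.cons_succ, Fin.cons_update]
  split_ifs <;> simp

lemma traceA_measureFirst {k : ℕ} (x : α × α × Fin 4) (σ : ExtOp (k + 1) α β) :
    traceA (measureFirst x σ) = condFrame x (traceOutAllBut 0 σ) := by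
  ext b b'
  simp only [traceA, measureFirst, condFrame, of_apply, traceOutAllBut_zero_apply,
    ← Finset.mul_sum]
  congr 1
  simp only [Finset.mul_sum, Finset.sum_mul]
  rw [Finset.sum_comm]
  exact Finset.sum_congr rfl fun a _ => Finset.sum_comm

lemma sum_traceA_measureFirst {k : ℕ} [Nonempty α] (σ : ExtOp (k + 1) α β) :
    ∑ x, traceA (measureFirst x σ) = traceA σ := by
  ext b b'
  rw [Matrix.sum_apply]
  simp only [traceA, of_apply]
  rw [Finset.sum_comm]
  simp only [sum_measureFirst]
  rw [sum_fin_cons, Finset.sum_comm]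

variable [Fintype β]

lemma trace_traceA {γ : Type*} [Fintype γ] (M : Matrix (γ × β) (γ × β) ℂ) :
    (traceA M).trace = M.trace := by
  simp only [Matrix.trace, diag_apply, traceA, of_apply, Fintype.sum_prod_type]
  exact Finset.sum_comm

omit [Fintype β] in
lemma posSemidef_traceA {γ : Type*} [Fintype γ] {M : Matrix (γ × β) (γ × β) ℂ}
    (hM : M.PosSemidef) : (traceA M).PosSemidef := by
  have : traceA M = ∑ z, M.submatrix (fun b => (z, b)) fun b => (z, b) := by
    ext b b'
    simp [traceA, Matrix.sum_apply]
  rw [this]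
  exact posSemidef_sum _ fun z _ => hM.submatrix _

omit [DecidableEq α] in
lemma posSemidef_sandwich {γ : Type*} [Fintype γ] {S : Matrix (α × γ) (α × γ) ℂ}
    (hS : S.PosSemidef) (f : α → ℂ) :
    (Matrix.of fun z z' => ∑ a, ∑ a', star (f a) * S (a, z) (a', z') * f a').PosSemidef := by
  refine posSemidef_of_forall_nonneg fun w => ?_
  refine (PosSemidef.sum_nonneg hS fun u => f u.1 * w u.2).trans_eq ?_
  simp only [Fintype.sum_prod_type, of_apply, Finset.mul_sum, Finset.sum_mul, star_mul']
  rw [Finset.sum_comm]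
  refine Finset.sum_congr rfl fun z _ => ?_
  simp_rw [Finset.sum_comm (s := (Finset.univ : Finset γ)) (t := (Finset.univ : Finset α))]
  refine Finset.sum_congr rfl fun a _ => ?_
  refine Finset.sum_congr rfl fun a' _ => Finset.sum_congr rfl fun z' _ => ?_
  ring

lemma posSemidef_measureFirst {k : ℕ} (x : α × α × Fin 4) {σ : ExtOp (k + 1) α β}
    (hσ : σ.PosSemidef) : (measureFirst x σ).PosSemidef := by
  have h := posSemidef_sandwich (hσ.submatrix
    fun u : α × ((Fin k → α) × β) => ((Fin.cons u.1 u.2.1 : Fin (k + 1) → α), u.2.2)) (frame x)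
  have e : measureFirst x σ = (((8 * Fintype.card α : ℝ)⁻¹ : ℝ) : ℂ) • Matrix.of fun z z' =>
      ∑ a, ∑ a', star (frame x a) * (σ.submatrix
        (fun u : α × ((Fin k → α) × β) => ((Fin.cons u.1 u.2.1 : Fin (k + 1) → α), u.2.2))
        (fun u : α × ((Fin k → α) × β) => ((Fin.cons u.1 u.2.1 : Fin (k + 1) → α), u.2.2)))
          (a, z) (a', z') * frame x a' := by
    ext z z'
    simp [measureFirst]
  rw [e]
  exact h.smul (by rw [Complex.zero_le_real]; positivity)

omit [Fintype β] in
lemma posSemidef_traceOutAllBut_zero {k : ℕ} {σ : ExtOp (k + 1) α β}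
    (hσ : σ.PosSemidef) : (traceOutAllBut 0 σ).PosSemidef := by
  have : traceOutAllBut 0 σ = ∑ z : Fin k → α,
      σ.submatrix (fun x => ((Fin.cons x.1 z : Fin (k + 1) → α), x.2))
        (fun x => ((Fin.cons x.1 z : Fin (k + 1) → α), x.2)) := by
    ext x y
    rw [Matrix.sum_apply, traceOutAllBut_zero_apply]
    rfl
  rw [this]
  exact posSemidef_sum _ fun z _ => hσ.submatrix _

/-- The reduced operator on `A`. -/
def traceB (M : Matrix (α × β) (α × β) ℂ) : Matrix α α ℂ :=
  traceA (M.submatrix Prod.swap Prod.swap)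

/-- Measuring `A` on a product of marginals does not change the `B` part beyond its outcome weight;
this is the quantity compared with the true conditional operator in the variance. -/
lemma condFrame_traceB_kronecker (x : α × α × Fin 4) (ρ : Matrix (α × β) (α × β) ℂ)
    (B : Matrix β β ℂ) : condFrame x (traceB ρ ⊗ₖ B) = (condFrame x ρ).trace • B := by
  ext b b'
  simp only [condFrame, traceB, traceA, of_apply, kroneckerMap_apply, submatrix_apply,
    Prod.swap_prod_mk, Matrix.smul_apply, smul_eq_mul, Matrix.trace, diag_apply,
    ← Finset.mul_sum]
  rw [mul_assoc]
  congr 1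
  simp only [Finset.sum_mul, Finset.mul_sum]
  symm
  rw [Finset.sum_comm]
  refine Finset.sum_congr rfl fun a _ => ?_
  rw [Finset.sum_comm]
  refine Finset.sum_congr rfl fun a' _ => Finset.sum_congr rfl fun _ _ => ?_
  ring

omit [Fintype β] in
lemma condFrame_sum {Ω : Type*} [Fintype Ω] (x : α × α × Fin 4)
    (X : Ω → Matrix (α × β) (α × β) ℂ) : condFrame x (∑ ω, X ω) = ∑ ω, condFrame x (X ω) := by
  ext b b'
  simp only [condFrame, Matrix.sum_apply, of_apply, Finset.mul_sum, Finset.sum_mul]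
  symm
  rw [Finset.sum_comm]
  refine Finset.sum_congr rfl fun a _ => ?_
  rw [Finset.sum_comm]

omit [Fintype β] in
lemma condFrame_smul (x : α × α × Fin 4) (c : ℂ)
    (X : Matrix (α × β) (α × β) ℂ) : condFrame x (c • X) = c • condFrame x X := by
  ext b b'
  simp only [condFrame, Matrix.smul_apply, smul_eq_mul, of_apply, Finset.mul_sum]
  refine Finset.sum_congr rfl fun a _ => Finset.sum_congr rfl fun a' _ => ?_
  ring

end Measure

/-! ### States passing all high tests are separable. -/

section DeFinetti

universe u

variable {α β : Type u} [Fintype α] [DecidableEq α] [Fintype β] [Nonempty α]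

/-- The purity of an ensemble of extensions of a state far from all separable operators grows with
each measured copy. -/
lemma purity_growth {ρ : Matrix (α × β) (α × β) ℂ} {δ : ℝ} (h0 : 0 < δ)
    (hδ : ∀ τ ∈ sepCone α β, ∃ x b b', δ ≤ ‖condFrame x ρ b b' - condFrame x τ b b'‖) (k : ℕ) :
    ∀ (Ω : Type u) [Fintype Ω] (σ : Ω → ExtOp k α β), (∀ ω, (σ ω).PosSemidef) →
      (∀ i, ∑ ω, traceOutAllBut i (σ ω) = ρ) → ∑ ω, (traceA (σ ω)).trace.re = 1 →
      k * δ ^ 2 + ∑ ω, purity (traceA (σ ω)) ≤ 1 := by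
  induction k with
  | zero =>
    intro Ω _ σ hσ _ h1
    rw [← h1]
    simp only [Nat.cast_zero, zero_mul, zero_add]
    exact Finset.sum_le_sum fun ω _ => PosSemidef.purity_le (posSemidef_traceA (hσ ω))
  | succ k ih =>
    intro Ω _ σ hσ hρ h1
    have hm := fun ω x => posSemidef_measureFirst x (hσ ω)
    have hq : ∀ ω x, 0 ≤ (traceA (measureFirst x (σ ω))).trace.re := fun ω x =>
      (Complex.nonneg_iff.mp (posSemidef_traceA (hm ω x)).trace_nonneg).1
    have hp : ∀ ω, 0 ≤ (traceA (σ ω)).trace.re := fun ω =>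
      (Complex.nonneg_iff.mp (posSemidef_traceA (hσ ω)).trace_nonneg).1
    have hqs : ∀ ω, ∑ x, (traceA (measureFirst x (σ ω))).trace.re = (traceA (σ ω)).trace.re :=
      fun ω => by rw [← sum_traceA_measureFirst, trace_sum, Complex.re_sum]
    -- Recording the outcome of measuring the first copy refines the ensemble and uses up one copy;
    -- the average reduction to any remaining copy and `B` is still `ρ`.
    have IH := ih (Ω × (α × α × Fin 4)) (fun y => measureFirst y.2 (σ y.1)) (fun y => hm _ _)
      (fun i => by
        rw [Fintype.sum_prod_type]
        simp only [sum_traceOutAllBut_measureFirst]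
        exact hρ _)
      (by
        rw [Fintype.sum_prod_type]
        simp only [hqs, h1])
    rw [Fintype.sum_prod_type] at IH
    -- The separable comparison operator is the average of the products of the marginals on the
    -- first copy and on `B`.
    obtain ⟨x, b, b', hx⟩ := hδ (∑ ω, (((traceA (σ ω)).trace.re⁻¹ : ℝ) : ℂ) •
        (traceB (traceOutAllBut 0 (σ ω)) ⊗ₖ traceA (σ ω)))
      (sum_mem fun ω _ => sepCone_smul (kron_mem_sepCone
        (posSemidef_traceA ((posSemidef_traceOutAllBut_zero (hσ ω)).submatrix _))
        (posSemidef_traceA (hσ ω))) (inv_nonneg.mpr (hp ω)))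
    have key := fun ω => purity_add_le (fun x => posSemidef_traceA (hm ω x)) x b b' δ
    simp only [sum_traceA_measureFirst] at key
    have hD : δ ≤ ∑ ω, ‖traceA (measureFirst x (σ ω)) b b' -
        ((traceA (measureFirst x (σ ω))).trace.re / (traceA (σ ω)).trace.re : ℝ) *
          traceA (σ ω) b b'‖ := by
      refine hx.trans (le_trans (le_of_eq ?_) (norm_sum_le _ _))
      congr 1
      rw [← hρ 0, condFrame_sum, condFrame_sum, Matrix.sum_apply, Matrix.sum_apply,
        ← Finset.sum_sub_distrib]
      refine Finset.sum_congr rfl fun ω _ => ?_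
      have e := (Complex.nonneg_iff.mp (posSemidef_traceA (hm ω x)).trace_nonneg).2
      have e' : (traceA (measureFirst x (σ ω))).trace =
          ((traceA (measureFirst x (σ ω))).trace.re : ℂ) := Complex.ext (by simp) (by simp [← e])
      rw [condFrame_smul, condFrame_traceB_kronecker, ← traceA_measureFirst, Matrix.smul_apply,
        Matrix.smul_apply, e', smul_eq_mul, smul_eq_mul]
      simp only [Complex.ofReal_re]
      push_cast
      ring
    have hq1 : ∑ ω, (traceA (measureFirst x (σ ω))).trace.re ≤ 1 := by
      rw [← h1]
      refine Finset.sum_le_sum fun ω _ => ?_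
      rw [← hqs]
      exact Finset.single_le_sum (f := fun x => (traceA (measureFirst x (σ ω))).trace.re)
        (fun x _ => hq ω x) (Finset.mem_univ x)
    -- With `t = δ` the total gain is at least `2 δ * δ - δ ^ 2 * 1 = δ ^ 2`.
    have := Finset.sum_le_sum fun ω (_ : ω ∈ Finset.univ) => key ω
    rw [Finset.sum_add_distrib, Finset.sum_sub_distrib, ← Finset.mul_sum, ← Finset.mul_sum] at this
    push_cast
    nlinarith [mul_le_mul_of_nonneg_left hD h0.le, mul_le_mul_of_nonneg_left hq1 (sq_nonneg δ)]

/-- States that pass arbitrarily high tests of the hierarchy are separable. -/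
theorem mem_sepCone_of_forall_mem_passing {ρ : Matrix (α × β) (α × β) ℂ} {n : ℕ}
    (h : ∀ k, n ≤ k → ρ ∈ passing α β k) : ρ ∈ sepCone α β := by
  by_contra hs
  have hρ := (h n le_rfl).1
  -- Otherwise separable operators would have conditional operators converging to those of `ρ`,
  -- hence converge to `ρ` by informational completeness, contradicting closedness.
  have hδ : ∃ δ > 0, ∀ τ ∈ sepCone α β,
      ∃ x b b', δ ≤ ‖condFrame x ρ b b' - condFrame x τ b b'‖ := by
    by_contra! H
    choose! f hf hlt using H
    have hlim : Tendsto (fun m : ℕ => f (1 / ((m : ℝ) + 1))) atTop (𝓝 ρ) := by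
      refine tendsto_pi_nhds.mpr fun ⟨i, b⟩ => tendsto_pi_nhds.mpr fun ⟨j, b'⟩ => ?_
      have h1 : ∀ x, Tendsto (fun m : ℕ => condFrame x (f (1 / ((m : ℝ) + 1))) b b') atTop
          (𝓝 (condFrame x ρ b b')) := fun x => by
        rw [tendsto_iff_norm_sub_tendsto_zero]
        refine squeeze_zero (fun _ => norm_nonneg _) (fun m => ?_)
          tendsto_one_div_add_atTop_nhds_zero_nat
        rw [norm_sub_rev]
        exact (hlt _ (by positivity) x b b').le
      have h2 := (tendsto_finsetSum (Finset.univ : Finset (Fin 4)) fun t _ =>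
        (h1 (i, j, t)).const_mul (star (Complex.I ^ (t : ℕ)))).const_mul (2 * Fintype.card α : ℂ)
      have hc : (Fintype.card α : ℂ) ≠ 0 := by simp
      have hc' : (2 * Fintype.card α : ℂ) ≠ 0 := by simp
      simpa only [sum_condFrame, mul_inv_cancel_left₀ hc'] using h2
    obtain ⟨m, hm⟩ := (eventually_notMem_sepCone_of_posSemidef hlim hρ.1 hs).exists
    exact hm (hf _ (by positivity))
  obtain ⟨δ, h0, hδ⟩ := hδ
  obtain ⟨K, hK⟩ := exists_nat_gt (1 / δ ^ 2)
  obtain ⟨-, σ, hσ⟩ := h (max n K) (le_max_left _ _)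
  have := purity_growth h0 hδ (max n K) PUnit (fun _ => σ) (fun _ => hσ.isState.1)
    (fun i => by simpa using hσ.extends_state i) (by simp [trace_traceA, hσ.isState.2])
  have h3 : 0 ≤ purity (traceA σ) := div_nonneg (by positivity)
    (by rw [trace_traceA, hσ.isState.2]; simp)
  simp only [Finset.univ_unique, Finset.sum_const, Finset.card_singleton, one_smul] at this
  rw [div_lt_iff₀ (by positivity)] at hK
  have h4 : (K : ℝ) ≤ (max n K : ℕ) := by exact_mod_cast le_max_right _ _
  nlinarith [mul_le_mul_of_nonneg_right h4 (sq_nonneg δ)]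

end DeFinetti

/-! ### Extremal rays of the PPT cone. -/

section Extremal

variable {α β n m : Type*} [Fintype n] [Fintype m]

open scoped Matrix.Norms.L2Operator MatrixOrder in
lemma exists_posSemidef_add_sub [DecidableEq n] {K : Matrix n n ℂ} (hK : K.IsHermitian) :
    ∃ C : ℝ, 0 < C ∧ ((C : ℂ) • 1 + K).PosSemidef ∧ ((C : ℂ) • 1 - K).PosSemidef := by
  have h1 := IsSelfAdjoint.le_algebraMap_norm_self (a := K) hK
  have h2 := IsSelfAdjoint.neg_algebraMap_norm_le_self (a := K) hK
  rw [Matrix.le_iff, Algebra.algebraMap_eq_smul_one] at h1 h2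
  have e : ((‖K‖ + 1 : ℝ) : ℂ) • (1 : Matrix n n ℂ) = ‖K‖ • 1 + 1 := by
    ext i j
    simp [add_mul]
  refine ⟨‖K‖ + 1, by positivity, ?_, ?_⟩
  · rw [show ((‖K‖ + 1 : ℝ) : ℂ) • (1 : Matrix n n ℂ) + K = K - -(‖K‖ • 1) + 1 by rw [e]; abel]
    exact h2.add PosSemidef.one
  · rw [show ((‖K‖ + 1 : ℝ) : ℂ) • (1 : Matrix n n ℂ) - K = ‖K‖ • 1 - K + 1 by rw [e]; abel]
    exact h1.add PosSemidef.one

/-- Vectors in the range of `G` may be subtracted from anything dominating `G * Gᴴ`, since a small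
multiple of `ketBra k` lies below the identity. -/
lemma exists_sub_ketBra_posSemidef [DecidableEq m] {M : Matrix n n ℂ} {G : Matrix n m ℂ}
    (h : (M - G * Gᴴ).PosSemidef) (k : m → ℂ) :
    ∃ ε : ℝ, 0 < ε ∧ ∀ ε' : ℝ, 0 ≤ ε' → ε' ≤ ε →
      (M - (ε' : ℂ) • ketBra (G *ᵥ k)).PosSemidef := by
  obtain ⟨C, hC, -, h2⟩ := exists_posSemidef_add_sub (posSemidef_ketBra k).isHermitian
  refine ⟨C⁻¹, inv_pos.mpr hC, fun ε h0 hε => ?_⟩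
  have e : M - (ε : ℂ) • ketBra (G *ᵥ k) = (M - G * Gᴴ) +
      (ε : ℂ) • (G * ((C : ℂ) • 1 - ketBra k) * Gᴴ) + ((1 - ε * C : ℝ) : ℂ) • (G * Gᴴ) := by
    rw [Matrix.mul_sub, Matrix.sub_mul, mul_ketBra_mul]
    simp only [Matrix.mul_smul, Matrix.smul_mul, Matrix.mul_one]
    push_cast
    module
  rw [e]
  refine (h.add ((h2.mul_mul_conjTranspose_same G).smul ?_)).add
    ((posSemidef_self_mul_conjTranspose G).smul ?_)
  · exact_mod_cast h0
  · rw [Complex.zero_le_real, sub_nonneg]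
    calc ε * C ≤ C⁻¹ * C := by gcongr
      _ = 1 := inv_mul_cancel₀ hC.ne'

open scoped MatrixOrder Matrix.Norms.L2Operator in
lemma exists_eq_conjTranspose_mul_self [DecidableEq n] {M : Matrix n n ℂ} (h : M.PosSemidef) :
    ∃ C : Matrix n n ℂ, M = Cᴴ * C :=
  CStarAlgebra.nonneg_iff_eq_star_mul_self.mp (Matrix.nonneg_iff_posSemidef.mpr h)

lemma exists_sub_ketBra_mulVec_posSemidef {M : Matrix n n ℂ} (h : M.PosSemidef) (y : n → ℂ) :
    ∃ ε : ℝ, 0 < ε ∧ ∀ ε' : ℝ, 0 ≤ ε' → ε' ≤ ε → (M - (ε' : ℂ) • ketBra (M *ᵥ y)).PosSemidef := by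
  classical
  obtain ⟨C, rfl⟩ := exists_eq_conjTranspose_mul_self h
  have := exists_sub_ketBra_posSemidef (M := Cᴴ * C) (G := Cᴴ) (by simp [PosSemidef.zero]) (C *ᵥ y)
  rwa [mulVec_mulVec] at this

/-- Positive operators with positive partial transpose. -/
def IsPPT (ρ : Matrix (α × β) (α × β) ℂ) : Prop :=
  ρ.PosSemidef ∧ (partialTransposeA ρ).PosSemidef

/-- An operator spanning an extremal ray of the cone of operators with positive partial transpose. -/
def IsExtremal (ρ : Matrix (α × β) (α × β) ℂ) : Prop :=
  IsPPT ρ ∧ ∀ A B, IsPPT A → IsPPT B → A + B = ρ → ∃ c : ℂ, A = c • ρ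

lemma partialTransposeA_smul (c : ℂ) (M : Matrix (α × β) (α × β) ℂ) :
    partialTransposeA (c • M) = c • partialTransposeA M := rfl

lemma partialTransposeA_sub (M N : Matrix (α × β) (α × β) ℂ) :
    partialTransposeA (M - N) = partialTransposeA M - partialTransposeA N := rfl

lemma partialTransposeA_conjTranspose (M : Matrix (α × β) (α × β) ℂ) :
    partialTransposeA Mᴴ = (partialTransposeA M)ᴴ := rfl

lemma partialTransposeA_partialTransposeA (M : Matrix (α × β) (α × β) ℂ) :
    partialTransposeA (partialTransposeA M) = M := rfl

lemma IsPPT.smul {ρ : Matrix (α × β) (α × β) ℂ} (h : IsPPT ρ) {c : ℝ} (hc : 0 ≤ c) :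
    IsPPT ((c : ℂ) • ρ) := by
  have hc' : (0 : ℂ) ≤ (c : ℂ) := by exact_mod_cast hc
  exact ⟨h.1.smul hc', by rw [partialTransposeA_smul]; exact h.2.smul hc'⟩

lemma IsExtremal.eq_smul_of_add_eq_smul {ρ A B : Matrix (α × β) (α × β) ℂ} (h : IsExtremal ρ)
    (hA : IsPPT A) (hB : IsPPT B) {r : ℝ} (hr : 0 < r) (e : A + B = (r : ℂ) • ρ) :
    ∃ c : ℂ, A = c • ρ := by
  have hr' : (r : ℂ) ≠ 0 := by exact_mod_cast hr.ne'
  obtain ⟨c, hc⟩ := h.2 _ _ (hA.smul (inv_nonneg.mpr hr.le)) (hB.smul (inv_nonneg.mpr hr.le)) (by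
    rw [← smul_add, e, smul_smul, Complex.ofReal_inv, inv_mul_cancel₀ hr', one_smul])
  refine ⟨r * c, ?_⟩
  rw [mul_smul, ← hc, smul_smul, Complex.ofReal_inv, mul_inv_cancel₀ hr', one_smul]

variable [Fintype α] [Fintype β]

/-- If a product vector and its partial conjugate can be subtracted, an extremal operator is
separable. -/
lemma IsExtremal.mem_sepCone {ρ : Matrix (α × β) (α × β) ℂ} (h : IsExtremal ρ) {ψ : α → ℂ}
    {φ : β → ℂ} (hψ : ψ ≠ 0) (hφ : φ ≠ 0) {ε ε' : ℝ} (hε : 0 < ε) (hε' : 0 < ε')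
    (h1 : ∀ t : ℝ, 0 ≤ t → t ≤ ε →
      (ρ - (t : ℂ) • ketBra fun x : α × β => ψ x.1 * φ x.2).PosSemidef)
    (h2 : ∀ t : ℝ, 0 ≤ t → t ≤ ε' → (partialTransposeA ρ -
      (t : ℂ) • ketBra fun x : α × β => star ψ x.1 * φ x.2).PosSemidef) : ρ ∈ sepCone α β := by
  set t := min ε ε' with ht
  have ht0 : 0 < t := lt_min hε hε'
  have ht0' : (0 : ℂ) ≤ t := by exact_mod_cast ht0.le
  have htne : (t : ℂ) ≠ 0 := by exact_mod_cast ht0.ne'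
  have hmem := sepCone_smul (ketBra_kron_mem_sepCone ψ φ) ht0.le
  obtain ⟨c, hc⟩ := h.2 ((t : ℂ) • (ketBra ψ ⊗ₖ ketBra φ))
    (ρ - (t : ℂ) • (ketBra ψ ⊗ₖ ketBra φ))
    ⟨posSemidef_of_mem_sepCone hmem,
      posSemidef_of_mem_sepCone (partialTransposeA_mem_sepCone hmem)⟩
    ⟨by
      rw [ketBra_kron_ketBra]
      exact h1 t ht0.le (min_le_left _ _), by
      rw [partialTransposeA_sub, partialTransposeA_smul, partialTransposeA_ketBra_kron,
        ketBra_kron_ketBra]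
      exact h2 t ht0.le (min_le_right _ _)⟩ (by abel)
  -- A nonzero diagonal entry of the product projector shows that the complex factor `c` is a
  -- positive real, so it can be divided out within the cone.
  obtain ⟨a, ha⟩ := Function.ne_iff.mp hψ
  obtain ⟨b, hb⟩ := Function.ne_iff.mp hφ
  have htr : 0 < ((t : ℂ) • (ketBra ψ ⊗ₖ ketBra φ)) (a, b) (a, b) := by
    have e : ((t : ℂ) • (ketBra ψ ⊗ₖ ketBra φ)) (a, b) (a, b) =
        ((t * (Complex.normSq (ψ a) * Complex.normSq (φ b)) : ℝ) : ℂ) := by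
      simp [ketBra, vecMulVec_apply, Complex.mul_conj]
    rw [e, Complex.zero_lt_real]
    have := Complex.normSq_pos.mpr ha
    have := Complex.normSq_pos.mpr hb
    positivity
  have hρ0 : 0 ≤ ρ (a, b) (a, b) := h.1.1.diag_nonneg
  rw [hc, Matrix.smul_apply, smul_eq_mul] at htr
  have hρr : ρ (a, b) (a, b) = ((ρ (a, b) (a, b)).re : ℂ) :=
    Complex.ext rfl (by simpa using (Complex.nonneg_iff.mp hρ0).2.symm)
  have hρpos : 0 < (ρ (a, b) (a, b)).re := by
    refine lt_of_le_of_ne (Complex.nonneg_iff.mp hρ0).1 fun h0 => ?_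
    rw [hρr, ← h0] at htr
    simp at htr
  rw [hρr] at htr
  have hcpos := Complex.pos_iff.mp htr
  simp only [Complex.mul_re, Complex.mul_im, Complex.ofReal_re, Complex.ofReal_im, mul_zero,
    sub_zero, zero_add] at hcpos
  have hcim : c.im = 0 := by
    rcases mul_eq_zero.mp hcpos.2.symm with h | h
    · exact h
    · exact absurd h hρpos.ne'
  have hcre : 0 < c.re := (pos_iff_pos_of_mul_pos hcpos.1).mpr hρpos
  have hce : c = (c.re : ℂ) := Complex.ext rfl (by simpa using hcim)
  rw [hce] at hc
  rw [← smul_mem_sepCone_iff hcre, ← hc]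
  exact hmem

omit [Fintype α] [Fintype β] in
lemma eq_zero_of_mul_mul_conjTranspose_eq_zero [DecidableEq m] {G : Matrix n m ℂ}
    {L : Matrix m n ℂ} (hL : L * G = 1) {K : Matrix m m ℂ} (hK : G * K * Gᴴ = 0) : K = 0 := by
  calc K = (L * G) * K * (L * G)ᴴ := by rw [hL]; simp
    _ = L * (G * K * Gᴴ) * Lᴴ := by rw [conjTranspose_mul]; simp only [Matrix.mul_assoc]
    _ = 0 := by rw [hK]; simp

/-- Dimension bound for extremal operators. -/
lemma IsExtremal.card_le {κ κ' : Type*} [Fintype κ] [Fintype κ'] [DecidableEq κ] [DecidableEq κ']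
    {ρ : Matrix (α × β) (α × β) ℂ} (h : IsExtremal ρ) {G : Matrix (α × β) κ ℂ}
    {L : Matrix κ (α × β) ℂ} (hL : L * G = 1) {G' : Matrix (α × β) κ' ℂ}
    {L' : Matrix κ' (α × β) ℂ} (hL' : L' * G' = 1) (hG : (ρ - G * Gᴴ).PosSemidef)
    (hG' : (partialTransposeA ρ - G' * G'ᴴ).PosSemidef) :
    Fintype.card κ ^ 2 + Fintype.card κ' ^ 2 ≤ Fintype.card (α × β) ^ 2 + 1 := by
  -- The kernel of `Φ` consists of directions supported in the ranges of both `G` and, after partial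
  -- transposition, `G'`. Extremality makes it at most one-dimensional, and rank-nullity gives the
  -- bound.
  let Φ : (Matrix κ κ ℂ × Matrix κ' κ' ℂ) →ₗ[ℂ] Matrix (α × β) (α × β) ℂ :=
    { toFun := fun Z => G * Z.1 * Gᴴ - partialTransposeA (G' * Z.2 * G'ᴴ)
      map_add' := fun Y Z => by
        simp only [Prod.fst_add, Prod.snd_add, Matrix.mul_add, Matrix.add_mul,
          partialTransposeA_add]
        abel
      map_smul' := fun c Z => by
        simp only [Prod.smul_fst, Prod.smul_snd, Matrix.mul_smul, Matrix.smul_mul,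
          partialTransposeA_smul, RingHom.id_apply, smul_sub] }
  have hΦ : ∀ Z, Φ Z = G * Z.1 * Gᴴ - partialTransposeA (G' * Z.2 * G'ᴴ) := fun _ => rfl
  -- For a Hermitian kernel element, a large multiple of `ρ` plus or minus the perturbation stays
  -- PPT, and the two sum to a multiple of `ρ`.
  have herm : ∀ Z, Φ Z = 0 → Z.1.IsHermitian → Z.2.IsHermitian →
      G * Z.1 * Gᴴ ∈ Submodule.span ℂ {ρ} := by
    intro Z hZ h1 h2
    rw [hΦ, sub_eq_zero] at hZ
    obtain ⟨C, hC, p1, p2⟩ := exists_posSemidef_add_sub h1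
    obtain ⟨C', hC', q1, q2⟩ := exists_posSemidef_add_sub h2
    have nn : (0 : ℂ) ≤ C := by exact_mod_cast hC.le
    have nn' : (0 : ℂ) ≤ C' := by exact_mod_cast hC'.le
    have nn2 : (0 : ℂ) ≤ ((C + C' : ℝ) : ℂ) := by exact_mod_cast (add_pos hC hC').le
    have pTZ : partialTransposeA (G * Z.1 * Gᴴ) = G' * Z.2 * G'ᴴ := by rw [hZ]; rfl
    have hA : IsPPT (((C + C' : ℝ) : ℂ) • ρ + G * Z.1 * Gᴴ) := by
      constructor
      · have e : ((C + C' : ℝ) : ℂ) • ρ + G * Z.1 * Gᴴ = ((C + C' : ℝ) : ℂ) • (ρ - G * Gᴴ) +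
            G * ((C : ℂ) • 1 + Z.1) * Gᴴ + (C' : ℂ) • (G * Gᴴ) := by
          simp only [Matrix.mul_add, Matrix.add_mul, Matrix.mul_smul, Matrix.smul_mul,
            Matrix.mul_one]
          push_cast
          module
        rw [e]
        exact ((hG.smul nn2).add (p1.mul_mul_conjTranspose_same G)).add
          ((posSemidef_self_mul_conjTranspose G).smul nn')
      · rw [partialTransposeA_add, partialTransposeA_smul, pTZ]
        have e : ((C + C' : ℝ) : ℂ) • partialTransposeA ρ + G' * Z.2 * G'ᴴ =
            ((C + C' : ℝ) : ℂ) • (partialTransposeA ρ - G' * G'ᴴ) +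
            G' * ((C' : ℂ) • 1 + Z.2) * G'ᴴ + (C : ℂ) • (G' * G'ᴴ) := by
          simp only [Matrix.mul_add, Matrix.add_mul, Matrix.mul_smul, Matrix.smul_mul,
            Matrix.mul_one]
          push_cast
          module
        rw [e]
        exact ((hG'.smul nn2).add (q1.mul_mul_conjTranspose_same G')).add
          ((posSemidef_self_mul_conjTranspose G').smul nn)
    have hB : IsPPT (((C + C' : ℝ) : ℂ) • ρ - G * Z.1 * Gᴴ) := by
      constructor
      · have e : ((C + C' : ℝ) : ℂ) • ρ - G * Z.1 * Gᴴ = ((C + C' : ℝ) : ℂ) • (ρ - G * Gᴴ) +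
            G * ((C : ℂ) • 1 - Z.1) * Gᴴ + (C' : ℂ) • (G * Gᴴ) := by
          simp only [Matrix.mul_sub, Matrix.sub_mul, Matrix.mul_smul, Matrix.smul_mul,
            Matrix.mul_one]
          push_cast
          module
        rw [e]
        exact ((hG.smul nn2).add (p2.mul_mul_conjTranspose_same G)).add
          ((posSemidef_self_mul_conjTranspose G).smul nn')
      · rw [partialTransposeA_sub, partialTransposeA_smul, pTZ]
        have e : ((C + C' : ℝ) : ℂ) • partialTransposeA ρ - G' * Z.2 * G'ᴴ =
            ((C + C' : ℝ) : ℂ) • (partialTransposeA ρ - G' * G'ᴴ) +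
            G' * ((C' : ℂ) • 1 - Z.2) * G'ᴴ + (C : ℂ) • (G' * G'ᴴ) := by
          simp only [Matrix.mul_sub, Matrix.sub_mul, Matrix.mul_smul, Matrix.smul_mul,
            Matrix.mul_one]
          push_cast
          module
        rw [e]
        exact ((hG'.smul nn2).add (q2.mul_mul_conjTranspose_same G')).add
          ((posSemidef_self_mul_conjTranspose G').smul nn)
    obtain ⟨c, hc⟩ := h.eq_smul_of_add_eq_smul hA hB (r := 2 * (C + C')) (by positivity) (by
      push_cast
      module)
    refine Submodule.mem_span_singleton.mpr ⟨c - ((C + C' : ℝ) : ℂ), ?_⟩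
    rw [sub_smul, ← hc]
    abel
  have hstar : ∀ Z, Φ Z = 0 → Φ (Z.1ᴴ, Z.2ᴴ) = 0 := by
    intro Z hZ
    rw [hΦ] at hZ ⊢
    have := congrArg conjTranspose hZ
    rw [conjTranspose_sub, ← partialTransposeA_conjTranspose, conjTranspose_zero] at this
    simpa [conjTranspose_mul, Matrix.mul_assoc] using this
  have hspan : ∀ Z, Φ Z = 0 → G * Z.1 * Gᴴ ∈ Submodule.span ℂ {ρ} := by
    intro Z hZ
    have h1 := herm (Z + (Z.1ᴴ, Z.2ᴴ)) (by rw [map_add, hZ, hstar Z hZ, add_zero])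
      (by simp [IsHermitian, add_comm]) (by simp [IsHermitian, add_comm])
    have h2 := herm (Complex.I • (Z - (Z.1ᴴ, Z.2ᴴ)))
      (by rw [map_smul, map_sub, hZ, hstar Z hZ, sub_zero, smul_zero])
      (by simp [IsHermitian, ← smul_neg]) (by simp [IsHermitian, ← smul_neg])
    have h3 := add_mem (Submodule.smul_mem _ (1 / 2 : ℂ) h1)
      (Submodule.smul_mem _ (-Complex.I / 2 : ℂ) h2)
    convert h3 using 1
    have hI : -Complex.I / 2 * Complex.I = 1 / 2 := by linear_combination (-1 / 2) * Complex.I_sq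
    simp only [Prod.fst_add, Prod.smul_fst, Prod.fst_sub, Matrix.mul_add, Matrix.add_mul,
      Matrix.mul_sub, Matrix.sub_mul, Matrix.mul_smul, Matrix.smul_mul, smul_smul, hI]
    module
  let Ψ : LinearMap.ker Φ →ₗ[ℂ] Submodule.span ℂ {ρ} :=
    { toFun := fun Z => ⟨G * Z.1.1 * Gᴴ, hspan Z.1 Z.2⟩
      map_add' := fun Y Z => by
        ext : 1
        simp [Matrix.mul_add, Matrix.add_mul]
      map_smul' := fun c Z => by
        ext : 1
        simp }
  have hinj : Function.Injective Ψ := by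
    rw [injective_iff_map_eq_zero]
    rintro ⟨Z, hZ⟩ h0
    have h0' : G * Z.1 * Gᴴ = 0 := congrArg Subtype.val h0
    have hZ1 := eq_zero_of_mul_mul_conjTranspose_eq_zero hL h0'
    rw [LinearMap.mem_ker, hΦ, h0', zero_sub, neg_eq_zero] at hZ
    have hZ2 := eq_zero_of_mul_mul_conjTranspose_eq_zero hL' (K := Z.2) (by
      rw [← partialTransposeA_partialTransposeA (G' * Z.2 * G'ᴴ), hZ]; rfl)
    exact Subtype.ext (Prod.ext hZ1 hZ2)
  have d1 := LinearMap.finrank_le_finrank_of_injective hinj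
  have d2 : Module.finrank ℂ (Submodule.span ℂ {ρ}) ≤ 1 := 
    (finrank_span_le_card ({ρ} : Set (Matrix (α × β) (α × β) ℂ))).trans (by simp)
  have d3 := LinearMap.finrank_range_add_finrank_ker Φ
  have d4 := Submodule.finrank_le (LinearMap.range Φ)
  rw [Module.finrank_prod] at d3
  simp only [Module.finrank_matrix, Module.finrank_self, mul_one] at d3 d4
  nlinarith

end Extremal

/-! ### Reduction to extremal operators by the Krein–Milman theorem. -/

section KreinMilman

variable {α β : Type*} [Fintype α] [Fintype β]

lemma isClosed_posSemidef {n : Type*} [Fintype n] :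
    IsClosed {M : Matrix n n ℂ | M.PosSemidef} := by
  have : {M : Matrix n n ℂ | M.PosSemidef} =
      ⋂ v : n → ℂ, {M | 0 ≤ ∑ i, ∑ j, star (v i) * M i j * v j} := by
    ext M
    simp only [Set.mem_ofPred_eq, Set.mem_iInter]
    exact ⟨fun h v => PosSemidef.sum_nonneg h v, posSemidef_of_forall_nonneg⟩
  rw [this]
  refine isClosed_iInter fun v => isClosed_le continuous_const ?_
  refine continuous_finsetSum _ fun i _ => continuous_finsetSum _ fun j _ => ?_
  exact (continuous_const.mul (continuous_apply_apply i j)).mul continuous_const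

lemma isCompact_ppt : IsCompact {ρ : Matrix (α × β) (α × β) ℂ | IsPPT ρ ∧ ρ.trace = 1} := by
  have hc : IsCompact (Set.pi Set.univ fun _ : α × β => Set.pi Set.univ
      fun _ : α × β => Metric.closedBall (0 : ℂ) 1) :=
    isCompact_univ_pi fun _ => isCompact_univ_pi fun _ => isCompact_closedBall _ _
  have hT : Continuous (partialTransposeA : Matrix (α × β) (α × β) ℂ → _) :=
    continuous_matrix fun x y => continuous_apply_apply (y.1, x.2) (x.1, y.2)
  refine hc.of_isClosed_subset ((isClosed_posSemidef.inter (isClosed_posSemidef.preimage hT)).inter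
    (isClosed_eq continuous_id.matrix_trace continuous_const)) ?_
  rintro ρ ⟨⟨h, -⟩, htr⟩ x - y -
  rw [mem_closedBall_zero_iff]
  have hd : ∀ z, 0 ≤ (ρ z z).re := fun z => (Complex.nonneg_iff.mp h.diag_nonneg).1
  have h1 : ∀ z, (ρ z z).re ≤ 1 := fun z => by
    have : ∑ z, (ρ z z).re = 1 := by
      rw [← Complex.re_sum]
      exact congrArg Complex.re htr
    rw [← this]
    exact Finset.single_le_sum (f := fun z => (ρ z z).re) (fun z _ => hd z) (Finset.mem_univ z)
  have := PosSemidef.norm_sq_apply_le h x y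
  have h2 : (ρ x x).re * (ρ y y).re ≤ 1 := mul_le_one₀ (h1 x) (hd y) (h1 y)
  exact (sq_le_one_iff₀ (norm_nonneg _)).mp (this.trans h2)

omit [Fintype α] [Fintype β] in
lemma IsPPT.add {ρ σ : Matrix (α × β) (α × β) ℂ} (h : IsPPT ρ) (h' : IsPPT σ) : IsPPT (ρ + σ) :=
  ⟨h.1.add h'.1, h.2.add h'.2⟩

lemma trace_eq_ofReal {n : Type*} [Fintype n] {M : Matrix n n ℂ} (h : M.PosSemidef) :
    M.trace = (M.trace.re : ℂ) :=
  Complex.ext rfl (by simpa using (Complex.nonneg_iff.mp h.trace_nonneg).2.symm)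

/-- To prove that positive partial transpose implies separability, it suffices to consider extremal
operators. -/
lemma IsPPT.mem_sepCone_of_extremal {ρ : Matrix (α × β) (α × β) ℂ} (h : IsPPT ρ)
    (hext : ∀ ρ : Matrix (α × β) (α × β) ℂ, IsExtremal ρ → ρ ∈ sepCone α β) :
    ρ ∈ sepCone α β := by
  by_contra hs
  obtain ⟨r, hr, e⟩ := trace_pos_of_notMem_sepCone h.1 hs
  have hr' : (r : ℂ) ≠ 0 := by exact_mod_cast hr.ne'
  set K := {ρ : Matrix (α × β) (α × β) ℂ | IsPPT ρ ∧ ρ.trace = 1} with hK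
  have : LocallyConvexSpace ℝ (Matrix (α × β) (α × β) ℂ) :=
    inferInstanceAs (LocallyConvexSpace ℝ (α × β → α × β → ℂ))
  have hconv : Convex ℝ K := by
    rintro x ⟨hx, tx⟩ y ⟨hy, ty⟩ a b ha hb hab
    refine ⟨(hx.smul ha).add (hy.smul hb), ?_⟩
    rw [trace_add, trace_smul, trace_smul, tx, ty, ← add_smul, hab, one_smul]
  have hsub : closure (convexHull ℝ (K.extremePoints ℝ)) ⊆
      {ρ : Matrix (α × β) (α × β) ℂ | IsSeparable ρ} := by
    refine closure_minimal (convexHull_min ?_ convex_isSeparable) isClosed_isSeparable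
    intro x hx
    rw [mem_extremePoints] at hx
    obtain ⟨⟨hp, ht⟩, hx⟩ := hx
    -- An extreme point of the trace-one slice spans an extremal ray: in a decomposition, normalise
    -- both summands by their traces. A summand of trace zero vanishes.
    refine isSeparable_iff.mpr ⟨hext x ⟨hp, fun A B hA hB hAB => ?_⟩, ht⟩
    have hA0 := (Complex.nonneg_iff.mp hA.1.trace_nonneg).1
    have hB0 := (Complex.nonneg_iff.mp hB.1.trace_nonneg).1
    have hsum : A.trace.re + B.trace.re = 1 := by
      rw [← Complex.add_re, ← trace_add, hAB, ht, Complex.one_re]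
    rcases hA0.eq_or_lt with h0 | h0
    · exact ⟨0, by rw [PosSemidef.eq_zero_of_trace_re_eq_zero hA.1 h0.symm, zero_smul]⟩
    rcases hB0.eq_or_lt with h1 | h1
    · refine ⟨1, ?_⟩
      rw [PosSemidef.eq_zero_of_trace_re_eq_zero hB.1 h1.symm, add_zero] at hAB
      rw [hAB, one_smul]
    have norm : ∀ {M : Matrix (α × β) (α × β) ℂ}, IsPPT M → 0 < M.trace.re →
        ((M.trace.re⁻¹ : ℝ) : ℂ) • M ∈ K := fun {M} hM h0 => by
      refine ⟨hM.smul (inv_nonneg.mpr h0.le), ?_⟩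
      rw [trace_smul, smul_eq_mul, trace_eq_ofReal hM.1, Complex.ofReal_re, ← Complex.ofReal_mul,
        inv_mul_cancel₀ h0.ne', Complex.ofReal_one]
    have cancel : ∀ {M : Matrix (α × β) (α × β) ℂ}, 0 < M.trace.re →
        M.trace.re • ((M.trace.re⁻¹ : ℝ) : ℂ) • M = M := fun {M} h0 => by
      ext i j
      simp only [Matrix.smul_apply, Complex.real_smul, smul_eq_mul]
      rw [← mul_assoc, ← Complex.ofReal_mul, mul_inv_cancel₀ h0.ne', Complex.ofReal_one, one_mul]
    have := (hx _ (norm hA h0) _ (norm hB h1)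
      ⟨A.trace.re, B.trace.re, h0, h1, hsum, by rw [cancel h0, cancel h1, hAB]⟩).1
    refine ⟨A.trace.re, ?_⟩
    rw [← this, smul_smul, ← Complex.ofReal_mul, mul_inv_cancel₀ h0.ne', Complex.ofReal_one,
      one_smul]
  rw [closure_convexHull_extremePoints isCompact_ppt hconv] at hsub
  have hmem : (((r⁻¹ : ℝ) : ℂ) • ρ) ∈ K := by
    refine ⟨h.smul (inv_nonneg.mpr hr.le), ?_⟩
    rw [trace_smul, e, smul_eq_mul, ← Complex.ofReal_mul, inv_mul_cancel₀ hr.ne',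
      Complex.ofReal_one]
  exact hs ((smul_mem_sepCone_iff (inv_pos.mpr hr)).mp (isSeparable_iff.mp (hsub hmem)).1)

end KreinMilman

/-! ### Extending a `3 × 3` matrix to a normal `4 × 4` matrix. -/

section NormalExtension

/-- A normal matrix and its adjoint have a common eigenvector. -/
lemma exists_eigenvector_of_normal {n : Type*} [Fintype n] [DecidableEq n] [Nonempty n]
    {M : Matrix n n ℂ} (h : M * Mᴴ = Mᴴ * M) :
    ∃ (c : ℂ) (f : n → ℂ), f ≠ 0 ∧ M *ᵥ f = c • f ∧ Mᴴ *ᵥ f = star c • f := by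
  obtain ⟨c, hc⟩ := Module.End.exists_eigenvalue (Matrix.toLin' M)
  obtain ⟨f, hf⟩ := hc.exists_hasEigenvector
  have h1 : M *ᵥ f = c • f := by simpa using hf.apply_eq_smul
  refine ⟨c, f, hf.2, h1, ?_⟩
  -- `N = M - c` is normal, so `Nᴴ *ᵥ f` and `N *ᵥ f` have the same norm.
  have key : star (Mᴴ *ᵥ f - star c • f) ⬝ᵥ (Mᴴ *ᵥ f - star c • f) = 0 := by
    set N := M - c • 1 with hN
    have hNf : N *ᵥ f = 0 := by rw [hN, sub_mulVec, h1, smul_mulVec, one_mulVec, sub_self]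
    have hNH : Nᴴ *ᵥ f = Mᴴ *ᵥ f - star c • f := by
      rw [hN, conjTranspose_sub, conjTranspose_smul, conjTranspose_one, sub_mulVec, smul_mulVec,
        one_mulVec]
    have hcomm : N * Nᴴ = Nᴴ * N := by
      rw [hN, conjTranspose_sub, conjTranspose_smul, conjTranspose_one]
      simp only [Matrix.mul_sub, Matrix.sub_mul, h, Matrix.mul_smul, Matrix.smul_mul,
        Matrix.mul_one, Matrix.one_mul]
      module
    rw [← hNH, star_mulVec, conjTranspose_conjTranspose, ← dotProduct_mulVec, mulVec_mulVec, hcomm,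
      ← mulVec_mulVec, hNf, mulVec_zero, dotProduct_zero]
  exact sub_eq_zero.mp (dotProduct_star_self_eq_zero.mp key)

/-- The product equation makes `(r₀, r₁)` proportional to `(l₁, l₀)`; equality of norms makes the
factor a phase. -/
lemma exists_phase_of_mul_eq_mul {r₀ r₁ l₀ l₁ : ℂ} (h : r₀ * l₀ = r₁ * l₁)
    (h' : r₀ * star r₀ + r₁ * star r₁ = l₀ * star l₀ + l₁ * star l₁) :
    ∃ μ : ℂ, μ * star μ = 1 ∧ r₀ = μ * l₁ ∧ r₁ = μ * l₀ := by
  have hn : ∀ z : ℂ, z * star z = (Complex.normSq z : ℂ) := Complex.mul_conj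
  have norm : ∀ μ : ℂ, r₀ = μ * l₁ → r₁ = μ * l₀ → ¬ (l₀ = 0 ∧ l₁ = 0) → μ * star μ = 1 := by
    intro μ e0 e1 hl
    have hne : l₀ * star l₀ + l₁ * star l₁ ≠ 0 := by
      rw [hn, hn, ← Complex.ofReal_add]
      norm_cast
      intro h0
      have h3 := (add_eq_zero_iff_of_nonneg (Complex.normSq_nonneg _) (Complex.normSq_nonneg _)).mp h0
      exact hl ⟨Complex.normSq_eq_zero.mp h3.1, Complex.normSq_eq_zero.mp h3.2⟩
    apply mul_right_cancel₀ hne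
    rw [e0, e1, star_mul', star_mul'] at h'
    linear_combination h'
  by_cases h1 : l₁ = 0
  · by_cases h0 : l₀ = 0
    · subst h1 h0
      rw [hn, hn] at h'
      simp only [zero_mul, add_zero] at h'
      norm_cast at h'
      have h3 := (add_eq_zero_iff_of_nonneg (Complex.normSq_nonneg _) (Complex.normSq_nonneg _)).mp h'
      exact ⟨1, by simp, by simpa using h3.1, by simpa using h3.2⟩
    · have e0 : r₀ = 0 := by
        rw [h1, mul_zero] at h
        exact (mul_eq_zero.mp h).resolve_right h0
      have e1 : r₁ = r₁ / l₀ * l₀ := by field_simp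
      exact ⟨r₁ / l₀, norm _ (by rw [e0, h1, mul_zero]) e1 (by tauto), by rw [e0, h1, mul_zero], e1⟩
  · have e0 : r₀ = r₀ / l₁ * l₁ := by field_simp
    have e1 : r₁ = r₀ / l₁ * l₀ := by
      field_simp
      exact h.symm
    exact ⟨r₀ / l₁, norm _ e0 e1 (by tauto), e0, e1⟩

/-- The corner of the normal extension, in a basis diagonalising the self-commutator. -/
lemma exists_corner {Q : Matrix (Fin 3) (Fin 3) ℂ} {u v : Fin 3 → ℂ} {d : Fin 3 → ℂ}
    (h1 : Q * Qᴴ - Qᴴ * Q = diagonal d) (h2 : ketBra u - ketBra v = diagonal d)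
    (hd2 : d 2 = 0) (hd0 : d 0 ≠ 0) (hds : star (d 0) = d 0) :
    ∃ ω n : ℂ, ω * star ω = 1 ∧
      Q *ᵥ (ω • u) + star n • v = Qᴴ *ᵥ v + n • ω • u := by
  have e1 : ∀ i j, ∑ k, Q i k * star (Q j k) - ∑ k, star (Q k i) * Q k j = diagonal d i j := by
    intro i j
    rw [← h1]
    simp [Matrix.mul_apply]
  have e2 : ∀ i j, u i * star (u j) - v i * star (v j) = diagonal d i j := by
    intro i j
    rw [← h2]
    simp [ketBra, vecMulVec_apply]
  simp only [Fin.sum_univ_three] at e1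
  have e1' := fun i j (hij : i ≠ j) => (e1 i j).trans (diagonal_apply_ne d hij)
  have e2' := fun i j (hij : i ≠ j) => (e2 i j).trans (diagonal_apply_ne d hij)
  have a00 := (e1 0 0).trans (diagonal_apply_eq d 0)
  have a11 := (e1 1 1).trans (diagonal_apply_eq d 1)
  have a22 := (e1 2 2).trans (diagonal_apply_eq d 2)
  have a01 := e1' 0 1 (by decide)
  have a02 := e1' 0 2 (by decide)
  have a10 := e1' 1 0 (by decide)
  have a12 := e1' 1 2 (by decide)
  have a20 := e1' 2 0 (by decide)
  have a21 := e1' 2 1 (by decide)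
  have b00 := (e2 0 0).trans (diagonal_apply_eq d 0)
  have b11 := (e2 1 1).trans (diagonal_apply_eq d 1)
  have b22 := (e2 2 2).trans (diagonal_apply_eq d 2)
  have b01 := e2' 0 1 (by decide)
  have b02 := e2' 0 2 (by decide)
  have b10 := e2' 1 0 (by decide)
  have b12 := e2' 1 2 (by decide)
  have b20 := e2' 2 0 (by decide)
  have b21 := e2' 2 1 (by decide)
  clear e1 e2 e1' e2'
  rw [hd2] at a22 b22
  have hd1 : d 1 = -d 0 := by linear_combination -a00 - a11 - a22
  rw [hd1] at a11 b11
  -- This is the vanishing of the trace of `Q * [Q, Qᴴ]`, where the commutator is `diagonal (d 0, -d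
  -- 0, 0)`. The next identity `t2` is the same with `Q ^ 2`.
  have t1 : Q 0 0 = Q 1 1 := by
    apply mul_right_cancel₀ hd0
    linear_combination -(Q 0 0 * a00 + Q 1 1 * a11 + Q 2 2 * a22 + Q 1 0 * a01 + Q 2 0 * a02 +
      Q 0 1 * a10 + Q 2 1 * a12 + Q 0 2 * a20 + Q 1 2 * a21)
  have t2 : Q 0 2 * Q 2 0 = Q 1 2 * Q 2 1 := by
    apply mul_right_cancel₀ hd0
    linear_combination -((Q 0 0 * Q 0 0 + Q 0 1 * Q 1 0 + Q 0 2 * Q 2 0) * a00 +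
      (Q 1 0 * Q 0 1 + Q 1 1 * Q 1 1 + Q 1 2 * Q 2 1) * a11 +
      (Q 2 0 * Q 0 2 + Q 2 1 * Q 1 2 + Q 2 2 * Q 2 2) * a22 +
      (Q 1 0 * Q 0 0 + Q 1 1 * Q 1 0 + Q 1 2 * Q 2 0) * a01 +
      (Q 2 0 * Q 0 0 + Q 2 1 * Q 1 0 + Q 2 2 * Q 2 0) * a02 +
      (Q 0 0 * Q 0 1 + Q 0 1 * Q 1 1 + Q 0 2 * Q 2 1) * a10 +
      (Q 2 0 * Q 0 1 + Q 2 1 * Q 1 1 + Q 2 2 * Q 2 1) * a12 +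
      (Q 0 0 * Q 0 2 + Q 0 1 * Q 1 2 + Q 0 2 * Q 2 2) * a20 +
      (Q 1 0 * Q 0 2 + Q 1 1 * Q 1 2 + Q 1 2 * Q 2 2) * a21) - (Q 0 0 + Q 1 1) * d 0 * t1
  obtain ⟨μ, hμ, r0, r1⟩ := exists_phase_of_mul_eq_mul t2 (by linear_combination -a22)
  have mulstar : ∀ z : ℂ, z * star z = 0 → z = 0 := fun z hz => by simpa using hz
  -- The rank-two operator `ketBra u - ketBra v` is supported on the first two coordinates, hence so
  -- are `u` and `v`; comparing entries there gives `v` from `star u` by exchanging coordinates, up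
  -- to a phase `κ`.
  have u2 : u 2 = 0 := by
    apply mulstar
    apply mul_right_cancel₀ hd0
    linear_combination -(u 2 * star (u 2)) * b00 + u 2 * star (u 0) * b02 +
      v 0 * star (v 2) * b20 - v 0 * star (v 0) * b22
  have v2 : v 2 = 0 := by
    apply mulstar
    rw [u2] at b22
    linear_combination -b22
  have m1 : v 1 * star (v 1) = u 0 * star (u 0) := by
    apply mul_right_cancel₀ hd0
    linear_combination -(v 1 * star (v 1) - u 0 * star (u 0)) * b00 + u 1 * star (u 0) * b01 +
      v 0 * star (v 1) * b10 - u 0 * star (u 0) * (b11 + b00)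
  have m0 : v 0 * star (v 0) = u 1 * star (u 1) := by linear_combination -m1 - b11 - b00
  obtain ⟨κ, hκ, v0, v1⟩ := exists_phase_of_mul_eq_mul (r₀ := v 0) (r₁ := v 1)
    (l₀ := star (u 0)) (l₁ := star (u 1)) (by
      by_cases h0 : u 0 = 0
      · rw [h0, zero_mul] at m1
        rw [h0, mulstar _ m1]
        simp
      · apply mul_left_cancel₀ h0
        linear_combination -v 0 * m1 - v 1 * b01)
    (by
      rw [star_star, star_star]
      linear_combination m0 + m1)
  clear m0 m1
  -- The free phase of `u` is spent on the third coordinate of the required vector equation.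
  obtain ⟨ω, hω, hωc⟩ : ∃ ω : ℂ, ω * star ω = 1 ∧ ω * (Q 2 0 * u 0 + Q 2 1 * u 1) =
      star μ * κ * star (Q 2 0 * u 0 + Q 2 1 * u 1) := by
    by_cases hc : Q 2 0 * u 0 + Q 2 1 * u 1 = 0
    · exact ⟨1, by simp, by rw [hc]; simp⟩
    · have hc' : star (Q 2 0 * u 0 + Q 2 1 * u 1) ≠ 0 := by rwa [ne_eq, star_eq_zero]
      refine ⟨star μ * κ * star (Q 2 0 * u 0 + Q 2 1 * u 1) / (Q 2 0 * u 0 + Q 2 1 * u 1), ?_, ?_⟩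
      · rw [star_div₀, star_mul', star_mul', star_star, star_star, div_mul_div_comm,
          div_eq_one_iff_eq (mul_ne_zero hc hc')]
        linear_combination (Q 2 0 * u 0 + Q 2 1 * u 1) * star (Q 2 0 * u 0 + Q 2 1 * u 1) *
          (κ * star κ * hμ + hκ)
      · field_simp
  set κ' := κ * ω with hκ'
  have hκκ : κ' * star κ' = 1 := by
    rw [hκ', star_mul']
    linear_combination ω * star ω * hκ + hω
  set x := ω * u 0 with hx
  set y := ω * u 1 with hy
  have hvx : v 1 = κ' * star x := by
    rw [hκ', hx, star_mul', v1]
    linear_combination -κ * star (u 0) * hω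
  have hvy : v 0 = κ' * star y := by
    rw [hκ', hy, star_mul', v0]
    linear_combination -κ * star (u 1) * hω
  have hd : x * star x - y * star y = d 0 := by
    rw [← b00, hx, hy, star_mul', star_mul', v0, star_mul', star_star]
    linear_combination (u 0 * star (u 0) - u 1 * star (u 1)) * hω + u 1 * star (u 1) * hκ
  -- The other two coordinates are the same equation up to conjugation, real-linear in `m`, and
  -- solvable because `|x|^2 - |y|^2 = d 0` is nonzero.
  have hm : ∃ m : ℂ, m * x - κ' * star y * star m = Q 0 1 * y - κ' * star (Q 1 0) * star x := by
    refine ⟨(star x * (Q 0 1 * y - κ' * star (Q 1 0) * star x) +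
      κ' * star y * star (Q 0 1 * y - κ' * star (Q 1 0) * star x)) / d 0, ?_⟩
    rw [star_div₀, hds]
    field_simp
    rw [← hd]
    simp only [star_add, star_sub, star_mul', star_star]
    linear_combination (-(y * star y * (Q 0 1 * y - κ' * star (Q 1 0) * star x))) * hκκ
  obtain ⟨m, hm⟩ := hm
  refine ⟨ω, Q 0 0 + m, hω, ?_⟩
  have hmc := congrArg star hm
  simp only [star_sub, star_mul', star_star] at hmc
  have hωc' : Q 2 0 * x + Q 2 1 * y = star (Q 0 2) * v 0 + star (Q 1 2) * v 1 := by
    rw [r0, r1, v0, v1, hx, hy]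
    simp only [star_mul', star_add] at hωc ⊢
    linear_combination hωc
  ext i
  fin_cases i
  · simp only [Fin.zero_eta, Pi.add_apply, Pi.smul_apply, smul_eq_mul, mulVec, dotProduct,
      Fin.sum_univ_three, conjTranspose_apply, u2, v2, ← hx, ← hy, star_add]
    rw [hvx, hvy]
    linear_combination -hm
  · simp only [Fin.mk_one, Pi.add_apply, Pi.smul_apply, smul_eq_mul, mulVec, dotProduct,
      Fin.sum_univ_three, conjTranspose_apply, u2, v2, ← hx, ← hy, star_add]
    rw [hvx, hvy, ← t1]
    linear_combination κ' * hmc - (Q 1 0 * x - m * y) * hκκ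
  · simp only [Fin.reduceFinMk, Pi.add_apply, Pi.smul_apply, smul_eq_mul, mulVec, dotProduct,
      Fin.sum_univ_three, conjTranspose_apply, u2, v2, ← hx, ← hy, star_add]
    linear_combination hωc'

/-- The hypotheses say that bordering `Q` with the column `v`, the row `star u` and the corner `c`
gives a normal matrix. The upper part of its eigenvector is the required vector; it is nonzero
because `v` is. -/
lemma exists_joint_vector_of_corner {n : Type*} [Fintype n] [DecidableEq n] {Q : Matrix n n ℂ}
    {u v : n → ℂ} (h : Q * Qᴴ + ketBra v = Qᴴ * Q + ketBra u) (hv : v ≠ 0) {c : ℂ}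
    (hc : Q *ᵥ u + star c • v = Qᴴ *ᵥ v + c • u) :
    ∃ (l : ℂ) (f : n → ℂ) (b b' : ℂ), f ≠ 0 ∧ Q *ᵥ f = l • f + b • v ∧
      Qᴴ *ᵥ f = star l • f + b' • u := by
  have htr : star u ⬝ᵥ u = star v ⬝ᵥ v := by
    have := congrArg trace h
    rw [trace_add, trace_add, trace_mul_comm, trace_ketBra, trace_ketBra] at this
    exact (add_left_cancel this).symm
  let M : Matrix (n ⊕ Unit) (n ⊕ Unit) ℂ :=
    fromBlocks Q (replicateCol Unit v) (replicateRow Unit (star u)) (c • 1)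
  have hMH : Mᴴ = fromBlocks Qᴴ (replicateCol Unit u) (replicateRow Unit (star v)) (star c • 1) := by
    simp [M, fromBlocks_conjTranspose]
  have hvv : ∀ w : n → ℂ, replicateCol Unit w * replicateRow Unit (star w) = ketBra w := by
    intro w
    ext i j
    simp [Matrix.mul_apply, ketBra, vecMulVec_apply]
  have hM : M * Mᴴ = Mᴴ * M := by
    rw [hMH, fromBlocks_multiply, fromBlocks_multiply, hvv, hvv, h]
    congr 1
    · ext i j
      have := congrFun hc i
      simp only [Pi.add_apply, Pi.smul_apply, smul_eq_mul, mulVec, dotProduct] at this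
      simpa [Matrix.mul_apply, mul_comm] using this
    · ext i j
      have := congrArg star (congrFun hc j)
      simp only [Pi.add_apply, Pi.smul_apply, smul_eq_mul, mulVec, dotProduct, star_add, star_sum,
        star_mul', star_star, conjTranspose_apply] at this
      simpa [Matrix.mul_apply, mul_comm] using this
    · ext i j
      have := htr
      simp only [dotProduct, Pi.star_apply] at this
      simp [Matrix.mul_apply, mul_comm] at this ⊢
      exact this
  obtain ⟨l, F, hF, e1, e2⟩ := exists_eigenvector_of_normal hM
  rw [hMH] at e2
  have q1 : Q *ᵥ (F ∘ Sum.inl) = l • (F ∘ Sum.inl) + (-F (Sum.inr ())) • v := by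
    ext i
    have := congrFun e1 (Sum.inl i)
    simp only [M, mulVec, dotProduct, Fintype.sum_sum_type, fromBlocks_apply₁₁, fromBlocks_apply₁₂,
      Finset.univ_unique, Finset.sum_singleton, replicateCol_apply, Pi.smul_apply,
      smul_eq_mul] at this
    simp only [mulVec, dotProduct, Function.comp_apply, Pi.add_apply, Pi.smul_apply, smul_eq_mul]
    linear_combination this
  have q2 : Qᴴ *ᵥ (F ∘ Sum.inl) = star l • (F ∘ Sum.inl) + (-F (Sum.inr ())) • u := by
    ext i
    have := congrFun e2 (Sum.inl i)
    simp only [mulVec, dotProduct, Fintype.sum_sum_type, fromBlocks_apply₁₁, fromBlocks_apply₁₂,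
      Finset.univ_unique, Finset.sum_singleton, replicateCol_apply, Pi.smul_apply,
      smul_eq_mul] at this
    simp only [mulVec, dotProduct, Function.comp_apply, Pi.add_apply, Pi.smul_apply, smul_eq_mul]
    linear_combination this
  refine ⟨l, F ∘ Sum.inl, -F (Sum.inr ()), -F (Sum.inr ()), fun h0 => hF ?_, q1, q2⟩
  have hb : F (Sum.inr ()) = 0 := by
    rw [h0, mulVec_zero, smul_zero, zero_add] at q1
    have := (smul_eq_zero.mp q1.symm).resolve_right hv
    simpa using this
  funext i
  rcases i with i | i
  · exact congrFun h0 i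
  · exact hb

/-- Two rank-one perturbations of the self-commutator of a `3 × 3` matrix cancel only if the matrix
and its adjoint have a common eigenvector modulo these perturbations. -/
lemma exists_joint_vector {Q : Matrix (Fin 3) (Fin 3) ℂ} {u v : Fin 3 → ℂ}
    (h : Q * Qᴴ + ketBra v = Qᴴ * Q + ketBra u) :
    ∃ (l : ℂ) (f : Fin 3 → ℂ) (b b' : ℂ), f ≠ 0 ∧ Q *ᵥ f = l • f + b • v ∧
      Qᴴ *ᵥ f = star l • f + b' • u := by
  have hD : Q * Qᴴ - Qᴴ * Q = ketBra u - ketBra v := by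
    rw [sub_eq_sub_iff_add_eq_add, h, add_comm]
  by_cases hD0 : ketBra u - ketBra v = 0
  · obtain ⟨l, f, hf, h1, h2⟩ := exists_eigenvector_of_normal (M := Q)
      (sub_eq_zero.mp (hD.trans hD0))
    exact ⟨l, f, 0, 0, hf, by rw [h1]; simp, by rw [h2]; simp⟩
  by_cases hv : v = 0
  · have htr := congrArg trace h
    rw [trace_add, trace_add, trace_mul_comm, trace_ketBra, trace_ketBra] at htr
    replace htr := add_left_cancel htr
    rw [hv, dotProduct_zero] at htr
    have hu : u = 0 := dotProduct_star_self_eq_zero.mp htr.symm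
    exact absurd (by rw [hu, hv, sub_self]) hD0
  have hH : (ketBra u - ketBra v).IsHermitian :=
    (posSemidef_ketBra u).isHermitian.sub (posSemidef_ketBra v).isHermitian
  have hdet : (ketBra u - ketBra v).det = 0 := by
    rw [det_fin_three]
    simp only [ketBra, vecMulVec_apply, Matrix.sub_apply, Pi.star_apply]
    ring
  -- A difference of two rank-one operators in dimension three is singular. Its eigenbasis is
  -- permuted so that a nonzero eigenvalue stands at 0 and a zero one at 2.
  obtain ⟨k, hk⟩ : ∃ k, hH.eigenvalues k = 0 := by
    rw [hH.det_eq_prod_eigenvalues, Finset.prod_eq_zero_iff] at hdet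
    obtain ⟨k, -, hk⟩ := hdet
    exact ⟨k, RCLike.ofReal_eq_zero.mp hk⟩
  have hspec := hH.spectral_theorem
  rw [Unitary.conjStarAlgAut_apply] at hspec
  obtain ⟨j, hj⟩ : ∃ j, hH.eigenvalues j ≠ 0 := by
    by_contra! h0
    refine hD0 ?_
    rw [hspec]
    have : hH.eigenvalues = 0 := funext h0
    rw [this]
    simp [Function.comp_def]
  obtain ⟨σ, hσ0, hσ2⟩ : ∃ σ : Equiv.Perm (Fin 3), σ 0 = j ∧ σ 2 = k := by
    have hjk : j ≠ k := fun e => hj (e ▸ hk)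
    have perm : ∀ j k : Fin 3, j ≠ k → ∃ σ : Equiv.Perm (Fin 3), σ 0 = j ∧ σ 2 = k := by decide
    exact perm j k hjk
  set U : Matrix (Fin 3) (Fin 3) ℂ := (hH.eigenvectorUnitary : Matrix (Fin 3) (Fin 3) ℂ)
  have hUU : U * Uᴴ = 1 := Unitary.coe_mul_star_self hH.eigenvectorUnitary
  set W := U.submatrix id σ with hW
  have hWW : W * Wᴴ = 1 := by
    rw [hW, conjTranspose_submatrix, submatrix_mul_equiv, hUU, submatrix_id_id]
  have hWW' : Wᴴ * W = 1 := mul_eq_one_comm.mp hWW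
  have hDW : ketBra u - ketBra v =
      W * diagonal (fun i => ((hH.eigenvalues (σ i) : ℝ) : ℂ)) * Wᴴ := by
    conv_lhs => rw [hspec]
    rw [hW, conjTranspose_submatrix,
      show diagonal (fun i => ((hH.eigenvalues (σ i) : ℝ) : ℂ)) =
        (diagonal fun i => ((hH.eigenvalues i : ℝ) : ℂ)).submatrix σ σ by
          rw [submatrix_diagonal_equiv]; rfl,
      submatrix_mul_equiv, submatrix_mul_equiv, submatrix_id_id]
    rfl
  have hDW' : Wᴴ * (ketBra u - ketBra v) * W =
      diagonal (fun i => ((hH.eigenvalues (σ i) : ℝ) : ℂ)) := by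
    refine (congrArg (fun X => Wᴴ * X * W) hDW).trans ?_
    calc _ = (Wᴴ * W) * diagonal (fun i => ((hH.eigenvalues (σ i) : ℝ) : ℂ)) * (Wᴴ * W) := by
          simp only [Matrix.mul_assoc]
      _ = _ := by rw [hWW', Matrix.one_mul, Matrix.mul_one]
  have hket : ∀ w : Fin 3 → ℂ, ketBra (Wᴴ *ᵥ w) = Wᴴ * ketBra w * W := fun w => by
    rw [← mul_ketBra_mul, conjTranspose_conjTranspose]
  have hQ' : (Wᴴ * Q * W)ᴴ = Wᴴ * Qᴴ * W := by
    simp only [conjTranspose_mul, conjTranspose_conjTranspose, Matrix.mul_assoc]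
  have hprod : ∀ A B : Matrix (Fin 3) (Fin 3) ℂ,
      (Wᴴ * A * W) * (Wᴴ * B * W) = Wᴴ * (A * B) * W := fun A B => by
    calc _ = Wᴴ * A * (W * Wᴴ) * B * W := by simp only [Matrix.mul_assoc]
      _ = _ := by rw [hWW, Matrix.mul_one]; simp only [Matrix.mul_assoc]
  obtain ⟨ω, n, hω, hn⟩ := exists_corner (Q := Wᴴ * Q * W) (u := Wᴴ *ᵥ u) (v := Wᴴ *ᵥ v)
    (d := fun i => ((hH.eigenvalues (σ i) : ℝ) : ℂ))
    (by rw [hQ', hprod, hprod, ← Matrix.sub_mul, ← Matrix.mul_sub, hD, hDW'])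
    (by rw [hket, hket, ← Matrix.sub_mul, ← Matrix.mul_sub, hDW'])
    (by simp [hσ2, hk]) (by simpa [hσ0] using hj) (by simp)
  have hωu : ketBra (ω • u) = ketBra u := by rw [ketBra_smul, hω, one_smul]
  have hback : ∀ w : Fin 3 → ℂ, W *ᵥ (Wᴴ *ᵥ w) = w := fun w => by
    rw [mulVec_mulVec, hWW, one_mulVec]
  have hn' := congrArg (W *ᵥ ·) hn
  simp only [mulVec_add, hQ', ← mulVec_mulVec, mulVec_smul, hback] at hn'
  rw [← mulVec_smul] at hn'
  obtain ⟨l, f, b, b', hf, f1, f2⟩ := exists_joint_vector_of_corner (u := ω • u)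
    (by rw [hωu]; exact h) hv hn'
  exact ⟨l, f, b, b' * ω, hf, f1, by rw [f2, mul_smul]⟩

end NormalExtension

/-! ### Rank-one operators and left inverses. -/

section RankOne

variable {n : Type*} [Fintype n]

lemma exists_left_inverse_of_mulVec_injective {m : Type*} [Fintype m] [DecidableEq m]
    [DecidableEq n] {G : Matrix n m ℂ} (h : ∀ x, G *ᵥ x = 0 → x = 0) :
    ∃ L : Matrix m n ℂ, L * G = 1 := by
  obtain ⟨g, hg⟩ := LinearMap.exists_leftInverse_of_injective (Matrix.toLin' G)
    (LinearMap.ker_eq_bot'.mpr fun x hx => h x (by simpa using hx))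
  refine ⟨LinearMap.toMatrix' g, ?_⟩
  rw [← LinearMap.toMatrix'_toLin' G, ← LinearMap.toMatrix'_comp, hg, LinearMap.toMatrix'_id]

/-- A positive operator has rank at most one or dominates an operator of rank two. -/
lemma eq_ketBra_or_exists_pair {X : Matrix n n ℂ} (hX : X.PosSemidef) :
    (∃ u, X = ketBra u) ∨ ∃ U : Fin 2 → n → ℂ, LinearIndependent ℂ U ∧
      (X - ∑ k, ketBra (U k)).PosSemidef := by
  obtain ⟨m, v, rfl⟩ := posSemidef_iff_eq_sum_vecMulVec.mp hX
  by_cases hv : ∀ i, v i = 0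
  · exact Or.inl ⟨0, by simp [hv, ketBra]⟩
  push Not at hv
  obtain ⟨i, hi⟩ := hv
  by_cases hpar : ∀ j, ∃ a : ℂ, a • v i = v j
  · choose a ha using hpar
    left
    refine ⟨((Real.sqrt (∑ j, Complex.normSq (a j)) : ℝ) : ℂ) • v i, ?_⟩
    rw [ketBra_smul, sqrt_mul_star_sqrt (Finset.sum_nonneg fun j _ => Complex.normSq_nonneg _)]
    push_cast
    rw [Finset.sum_smul]
    refine Finset.sum_congr rfl fun j _ => ?_
    change ketBra (v j) = _
    rw [← ha j, ketBra_smul, Complex.star_def, Complex.mul_conj]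
  · push Not at hpar
    obtain ⟨j, hj⟩ := hpar
    right
    refine ⟨![v i, v j], (LinearIndependent.pair_iff' hi).mpr hj, ?_⟩
    have hij : i ≠ j := fun e => hj 1 (by rw [one_smul, e])
    have : ∑ k, vecMulVec (v k) (star (v k)) - ∑ k : Fin 2, ketBra (![v i, v j] k) =
        ∑ k ∈ (Finset.univ.erase i).erase j, ketBra (v k) := by
      rw [Fin.sum_univ_two, ← Finset.add_sum_erase _ _ (Finset.mem_univ i),
        ← Finset.add_sum_erase _ _ (Finset.mem_erase.mpr ⟨hij.symm, Finset.mem_univ j⟩)]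
      simp only [ketBra, Matrix.cons_val_zero, Matrix.cons_val_one]
      abel
    rw [this]
    exact posSemidef_sum _ fun k _ => posSemidef_ketBra _

lemma exists_sub_ketBra_posSemidef_of_ne_zero {X : Matrix n n ℂ} (hX : X.PosSemidef) (h0 : X ≠ 0) :
    ∃ u, u ≠ 0 ∧ (X - ketBra u).PosSemidef := by
  rcases eq_ketBra_or_exists_pair hX with ⟨u, rfl⟩ | ⟨U, hU, hp⟩
  · refine ⟨u, fun hu => h0 (by rw [hu]; ext; simp [ketBra, vecMulVec_apply]), ?_⟩
    rw [sub_self]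
    exact PosSemidef.zero
  · refine ⟨U 0, hU.ne_zero 0, ?_⟩
    have := hp.add (posSemidef_ketBra (U 1))
    rw [Fin.sum_univ_two] at this
    convert this using 1
    abel

end RankOne

/-! ### Gram factors of operators on `2 × N` with identity first block. -/

section GramFactor

variable {N k : ℕ}

/-- The Gram factor of an operator on `2 × N` whose first block is the identity. -/
def gramFactor (Q : Matrix (Fin N) (Fin N) ℂ) (U : Fin k → Fin N → ℂ) :
    Matrix (Fin 2 × Fin N) (Fin N ⊕ Fin k) ℂ :=
  Matrix.of fun x m => if x.1 = 0 then Sum.elim (fun j => (1 : Matrix (Fin N) (Fin N) ℂ) x.2 j)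
    (fun _ => 0) m else Sum.elim (fun j => Qᴴ x.2 j) (fun j => U j x.2) m

lemma gramFactor_mulVec_zero (Q : Matrix (Fin N) (Fin N) ℂ) (U : Fin k → Fin N → ℂ)
    (y : Fin N ⊕ Fin k → ℂ) (i : Fin N) : (gramFactor Q U *ᵥ y) (0, i) = y (Sum.inl i) := by
  simp [gramFactor, mulVec, dotProduct, Matrix.one_apply]

lemma gramFactor_mulVec_one (Q : Matrix (Fin N) (Fin N) ℂ) (U : Fin k → Fin N → ℂ)
    (y : Fin N ⊕ Fin k → ℂ) (i : Fin N) : (gramFactor Q U *ᵥ y) (1, i) =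
      (Qᴴ *ᵥ (y ∘ Sum.inl)) i + ∑ j, y (Sum.inr j) * U j i := by
  simp [gramFactor, mulVec, dotProduct, mul_comm]

lemma exists_left_inverse_gramFactor (Q : Matrix (Fin N) (Fin N) ℂ) {U : Fin k → Fin N → ℂ}
    (hU : LinearIndependent ℂ U) :
    ∃ L : Matrix (Fin N ⊕ Fin k) (Fin 2 × Fin N) ℂ, L * gramFactor Q U = 1 := by
  refine exists_left_inverse_of_mulVec_injective fun y hy => ?_
  have h0 : y ∘ Sum.inl = 0 := by
    ext i
    have := gramFactor_mulVec_zero Q U y i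
    rw [hy] at this
    exact this.symm
  have h1 : ∀ j, y (Sum.inr j) = 0 := by
    refine Fintype.linearIndependent_iff.mp hU (fun j => y (Sum.inr j)) ?_
    ext i
    have := gramFactor_mulVec_one Q U y i
    rw [hy, h0, mulVec_zero] at this
    simpa using this.symm
  ext i
  rcases i with i | i
  · exact congrFun h0 i
  · exact h1 i

/-- The Gram factor reproduces every block except the last, where the remainder of the Schur
complement is left. -/
lemma sub_gramFactor_posSemidef {ρ : Matrix (Fin 2 × Fin N) (Fin 2 × Fin N) ℂ}
    (h1 : blockA ρ 0 0 = 1) {Q : Matrix (Fin N) (Fin N) ℂ} (hQ : blockA ρ 0 1 = Q)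
    (hQ' : blockA ρ 1 0 = Qᴴ) {U : Fin k → Fin N → ℂ}
    (h : (blockA ρ 1 1 - Qᴴ * Q - ∑ j, ketBra (U j)).PosSemidef) :
    (ρ - gramFactor Q U * (gramFactor Q U)ᴴ).PosSemidef := by
  have e : ρ - gramFactor Q U * (gramFactor Q U)ᴴ =
      ketBra (Pi.single 1 1 : Fin 2 → ℂ) ⊗ₖ (blockA ρ 1 1 - Qᴴ * Q - ∑ j, ketBra (U j)) := by
    ext ⟨a, i⟩ ⟨b, j⟩
    have hρ : ρ (a, i) (b, j) = blockA ρ a b i j := rfl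
    rw [Matrix.sub_apply, hρ]
    have h01 : ∀ a : Fin 2, a = 0 ∨ a = 1 := by decide
    rcases h01 a with rfl | rfl <;> rcases h01 b with rfl | rfl
    · simp [h1, gramFactor, Matrix.mul_apply, ketBra, vecMulVec_apply, Matrix.one_apply, eq_comm]
    · simp [hQ, gramFactor, Matrix.mul_apply, ketBra, vecMulVec_apply, Matrix.one_apply]
    · simp [hQ', gramFactor, Matrix.mul_apply, ketBra, vecMulVec_apply, Matrix.one_apply]
    · simp only [gramFactor, Matrix.mul_apply, conjTranspose_apply, of_apply, one_ne_zero, if_false,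
        Fintype.sum_sum_type, Sum.elim_inl, Sum.elim_inr, kroneckerMap_apply, ketBra,
        vecMulVec_apply, Pi.star_apply, Pi.single_eq_same, star_one, mul_one, one_mul,
        Matrix.sub_apply, Matrix.sum_apply, star_star]
      ring
  rw [e]
  exact (posSemidef_ketBra _).kronecker h

end GramFactor

/-! ### Separability of extremal operators in normal form. -/

section TwoByN

variable {N : ℕ}

lemma blockA_partialTransposeA {α β : Type*} (ρ : Matrix (α × β) (α × β) ℂ) (a a' : α) :
    blockA (partialTransposeA ρ) a a' = blockA ρ a' a := rfl

/-- An extremal operator on `2 × N` with a common eigenvector of the off-diagonal block and its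
adjoint, modulo the ranges of the Schur complements, is separable. -/
lemma IsExtremal.mem_sepCone_of_joint_vector {ρ : Matrix (Fin 2 × Fin N) (Fin 2 × Fin N) ℂ}
    (h : IsExtremal ρ) (h1 : blockA ρ 0 0 = 1) {Q : Matrix (Fin N) (Fin N) ℂ}
    (hQ : blockA ρ 0 1 = Q) {u v : Fin N → ℂ} (hX : blockA ρ 1 1 - Qᴴ * Q = ketBra u)
    (hY : blockA ρ 1 1 - Q * Qᴴ = ketBra v) {l b b' : ℂ} {f : Fin N → ℂ} (hf : f ≠ 0)
    (e1 : Q *ᵥ f = l • f + b • v) (e2 : Qᴴ *ᵥ f = star l • f + b' • u) :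
    ρ ∈ sepCone (Fin 2) (Fin N) := by
  have hQ' : blockA ρ 1 0 = Qᴴ := by rw [← hQ, conjTranspose_blockA h.1.1.isHermitian]
  obtain ⟨ε, hε, p⟩ := exists_sub_ketBra_posSemidef
    (sub_gramFactor_posSemidef h1 hQ hQ' (U := fun _ : Fin 1 => u) (by
      simp only [Fin.sum_univ_one, hX, sub_self]; exact PosSemidef.zero))
    (Sum.elim f fun _ => -b')
  obtain ⟨ε', hε', p'⟩ := exists_sub_ketBra_posSemidef
    (sub_gramFactor_posSemidef (ρ := partialTransposeA ρ) h1 (Q := Qᴴ) hQ'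
      (by rw [conjTranspose_conjTranspose]; exact hQ) (U := fun _ : Fin 1 => v) (by
      simp only [Fin.sum_univ_one, blockA_partialTransposeA, conjTranspose_conjTranspose, hY,
        sub_self]
      exact PosSemidef.zero))
    (Sum.elim f fun _ => -b)
  have h01 : ∀ a : Fin 2, a = 0 ∨ a = 1 := by decide
  -- The joint vector puts `(1, star l) ⊗ f` in the range of `ρ` and its partial conjugate `(1, l) ⊗
  -- f` in the range of the partial transpose.
  have g : gramFactor Q (fun _ : Fin 1 => u) *ᵥ (Sum.elim f fun _ => -b') =
      fun x => ![1, star l] x.1 * f x.2 := by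
    ext ⟨a, i⟩
    rcases h01 a with rfl | rfl
    · rw [gramFactor_mulVec_zero]
      simp
    · rw [gramFactor_mulVec_one, Sum.elim_comp_inl, e2]
      simp
  have g' : gramFactor Qᴴ (fun _ : Fin 1 => v) *ᵥ (Sum.elim f fun _ => -b) =
      fun x => star ![1, star l] x.1 * f x.2 := by
    ext ⟨a, i⟩
    rcases h01 a with rfl | rfl
    · rw [gramFactor_mulVec_zero]
      simp
    · rw [gramFactor_mulVec_one, Sum.elim_comp_inl, conjTranspose_conjTranspose, e1]
      simp
  rw [g] at p
  rw [g'] at p'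
  exact h.mem_sepCone (fun h0 => one_ne_zero (congrFun h0 0)) hf hε hε' p p'

/-- Extremal operators in normal form are separable. -/
lemma IsExtremal.mem_sepCone_of_blockA_eq_one (hN0 : 0 < N) (hN : N ≤ 3)
    {ρ : Matrix (Fin 2 × Fin N) (Fin 2 × Fin N) ℂ} (h : IsExtremal ρ) (h1 : blockA ρ 0 0 = 1) :
    ρ ∈ sepCone (Fin 2) (Fin N) := by
  obtain ⟨Q, hQ⟩ : ∃ Q, blockA ρ 0 1 = Q := ⟨_, rfl⟩
  have hQ' : blockA ρ 1 0 = Qᴴ := by rw [← hQ, conjTranspose_blockA h.1.1.isHermitian]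
  have hpd : (blockA ρ 0 0).PosDef := by rw [h1]; exact PosDef.one
  have hX : (blockA ρ 1 1 - Qᴴ * Q).PosSemidef := by
    have := posSemidef_schur (a := 0) (a' := 1) h.1.1 hpd
    rwa [h1, inv_one, Matrix.mul_one, hQ, hQ'] at this
  have hY : (blockA ρ 1 1 - Q * Qᴴ).PosSemidef := by
    have := posSemidef_schur (a := 0) (a' := 1) h.1.2 hpd
    simp only [blockA_partialTransposeA] at this
    rwa [h1, inv_one, Matrix.mul_one, hQ, hQ'] at this
  have htr : (blockA ρ 1 1 - Qᴴ * Q).trace = (blockA ρ 1 1 - Q * Qᴴ).trace := by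
    rw [trace_sub, trace_sub, trace_mul_comm]
  have hX0iff : blockA ρ 1 1 - Qᴴ * Q = 0 ↔ blockA ρ 1 1 - Q * Qᴴ = 0 := by
    rw [← hX.trace_eq_zero_iff, htr, hY.trace_eq_zero_iff]
  have hket0 : ketBra (0 : Fin N → ℂ) = 0 := by ext; simp [ketBra, vecMulVec_apply]
  -- The two Schur complements have equal traces, so they vanish together, and then `Q` is normal.
  by_cases hX0 : blockA ρ 1 1 - Qᴴ * Q = 0
  · have hY0 := hX0iff.mp hX0
    have : Nonempty (Fin N) := ⟨⟨0, hN0⟩⟩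
    obtain ⟨l, f, hf, e1, e2⟩ := exists_eigenvector_of_normal (M := Q)
      (by rw [sub_eq_zero] at hX0 hY0; rw [← hX0, ← hY0])
    exact h.mem_sepCone_of_joint_vector h1 hQ (u := 0) (v := 0) (l := l) (b := 0) (b' := 0)
      (by rw [hX0, hket0]) (by rw [hY0, hket0]) hf (by rw [e1]; simp) (by rw [e2]; simp)
  have hY0 : blockA ρ 1 1 - Q * Qᴴ ≠ 0 := fun e => hX0 (hX0iff.mpr e)
  obtain ⟨u₁, hu₁, hu₁'⟩ := exists_sub_ketBra_posSemidef_of_ne_zero hX hX0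
  obtain ⟨v₁, hv₁, hv₁'⟩ := exists_sub_ketBra_posSemidef_of_ne_zero hY hY0
  -- For nonzero Schur complements and `N ≤ 3` this dimension bound leaves only `N = 3` with both of
  -- rank one: `16 + 16 ≤ 37`, whereas `16 + 25 > 37`.
  have bound : ∀ {k k' : ℕ} (U : Fin k → Fin N → ℂ) (V : Fin k' → Fin N → ℂ),
      LinearIndependent ℂ U → LinearIndependent ℂ V →
      (blockA ρ 1 1 - Qᴴ * Q - ∑ j, ketBra (U j)).PosSemidef →
      (blockA ρ 1 1 - Q * Qᴴ - ∑ j, ketBra (V j)).PosSemidef →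
      (N + k) ^ 2 + (N + k') ^ 2 ≤ (2 * N) ^ 2 + 1 := by
    intro k k' U V hU hV pU pV
    obtain ⟨L, hL⟩ := exists_left_inverse_gramFactor Q hU
    obtain ⟨L', hL'⟩ := exists_left_inverse_gramFactor Qᴴ hV
    have := h.card_le hL hL' (sub_gramFactor_posSemidef h1 hQ hQ' pU)
      (sub_gramFactor_posSemidef (ρ := partialTransposeA ρ) h1 (Q := Qᴴ) hQ'
        (by rw [conjTranspose_conjTranspose]; exact hQ)
        (by rw [conjTranspose_conjTranspose]; exact pV))
    simpa using this
  have li : ∀ {w : Fin N → ℂ}, w ≠ 0 → LinearIndependent ℂ fun _ : Fin 1 => w := fun hw =>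
    linearIndependent_unique_iff.mpr hw
  have hu₁'' : (blockA ρ 1 1 - Qᴴ * Q - ∑ _j : Fin 1, ketBra u₁).PosSemidef := by
    rwa [Fin.sum_univ_one]
  have hv₁'' : (blockA ρ 1 1 - Q * Qᴴ - ∑ _j : Fin 1, ketBra v₁).PosSemidef := by
    rwa [Fin.sum_univ_one]
  rcases eq_ketBra_or_exists_pair hX with ⟨u, hu⟩ | ⟨U, hU, pU⟩
  · rcases eq_ketBra_or_exists_pair hY with ⟨v, hv⟩ | ⟨V, hV, pV⟩
    · have := bound _ _ (li hu₁) (li hv₁) hu₁'' hv₁''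
      obtain rfl : N = 3 := by
        interval_cases N <;> omega
      obtain ⟨l, f, b, b', hf, e1, e2⟩ := exists_joint_vector (Q := Q) (u := u) (v := v)
        (by rw [← hu, ← hv]; abel)
      exact h.mem_sepCone_of_joint_vector h1 hQ hu hv hf e1 e2
    · have := bound _ _ (li hu₁) hV hu₁'' pV
      interval_cases N <;> omega
  · have := bound _ _ hU (li hv₁) pU hv₁''
    interval_cases N <;> omega

end TwoByN

/-! ### Reduction to normal form; PPT implies separability in `2 × N` for `N ≤ 3`. -/

section Reduction

variable {α β : Type*} [Fintype α] [Fintype β] [DecidableEq α] [DecidableEq β]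

omit [DecidableEq β] in
lemma IsPPT.conj {γ : Type*} [Fintype γ] {ρ : Matrix (α × β) (α × β) ℂ} (h : IsPPT ρ)
    (B : Matrix γ β ℂ) :
    IsPPT (((1 : Matrix α α ℂ) ⊗ₖ B) * ρ * ((1 : Matrix α α ℂ) ⊗ₖ B)ᴴ) := by
  refine ⟨h.1.mul_mul_conjTranspose_same _, ?_⟩
  rw [partialTransposeA_kron_conj]
  exact h.2.mul_mul_conjTranspose_same _

omit [DecidableEq β] in
lemma kron_conj_kron_conj {γ δ : Type*} [Fintype γ] (B : Matrix γ β ℂ) (C : Matrix δ γ ℂ)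
    (ρ : Matrix (α × β) (α × β) ℂ) :
    ((1 : Matrix α α ℂ) ⊗ₖ C) * (((1 : Matrix α α ℂ) ⊗ₖ B) * ρ * ((1 : Matrix α α ℂ) ⊗ₖ B)ᴴ) *
      ((1 : Matrix α α ℂ) ⊗ₖ C)ᴴ =
        ((1 : Matrix α α ℂ) ⊗ₖ (C * B)) * ρ * ((1 : Matrix α α ℂ) ⊗ₖ (C * B))ᴴ := by
  have e : (1 : Matrix α α ℂ) ⊗ₖ (C * B) = ((1 : Matrix α α ℂ) ⊗ₖ C) * ((1 : Matrix α α ℂ) ⊗ₖ B) := by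
    rw [← mul_kronecker_mul, Matrix.one_mul]
  rw [e, conjTranspose_mul]
  simp only [Matrix.mul_assoc]

lemma one_kron_conj_one (ρ : Matrix (α × β) (α × β) ℂ) :
    ((1 : Matrix α α ℂ) ⊗ₖ (1 : Matrix β β ℂ)) * ρ *
      ((1 : Matrix α α ℂ) ⊗ₖ (1 : Matrix β β ℂ))ᴴ = ρ := by
  rw [one_kronecker_one]
  simp

lemma IsExtremal.conj {ρ : Matrix (α × β) (α × β) ℂ} (h : IsExtremal ρ) {B C : Matrix β β ℂ}
    (hBC : B * C = 1) :
    IsExtremal (((1 : Matrix α α ℂ) ⊗ₖ B) * ρ * ((1 : Matrix α α ℂ) ⊗ₖ B)ᴴ) := by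
  have hCB : C * B = 1 := mul_eq_one_comm.mp hBC
  refine ⟨h.1.conj B, fun X Y hX hY hXY => ?_⟩
  obtain ⟨c, hc⟩ := h.2 _ _ (hX.conj C) (hY.conj C) (by
    rw [← Matrix.add_mul, ← Matrix.mul_add, hXY, kron_conj_kron_conj, hCB, one_kron_conj_one])
  refine ⟨c, ?_⟩
  have := congrArg (fun M => ((1 : Matrix α α ℂ) ⊗ₖ B) * M * ((1 : Matrix α α ℂ) ⊗ₖ B)ᴴ) hc
  simp only [kron_conj_kron_conj, hBC, one_kron_conj_one, Matrix.mul_smul, Matrix.smul_mul] at this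
  exact this

omit [DecidableEq β] in
lemma blockA_kron_conj {γ : Type*} (B : Matrix γ β ℂ) (ρ : Matrix (α × β) (α × β) ℂ) (a a' : α) :
    blockA (((1 : Matrix α α ℂ) ⊗ₖ B) * ρ * ((1 : Matrix α α ℂ) ⊗ₖ B)ᴴ) a a' =
      B * blockA ρ a a' * Bᴴ := by
  ext i j
  simp only [blockA, of_apply]
  rw [kron_conj_apply]
  simp [Matrix.mul_apply, Matrix.one_apply, Finset.sum_mul]

/-- If all blocks of a positive operator on `2 × N` have a common kernel vector, it can be
compressed to a smaller dimension. -/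
lemma exists_compression {N : ℕ} {ρ : Matrix (α × Fin (N + 1)) (α × Fin (N + 1)) ℂ}
    (h : ρ.IsHermitian) {f : Fin (N + 1) → ℂ} (hf : f ≠ 0) (h0 : ∀ a a', blockA ρ a a' *ᵥ f = 0) :
    ∃ (B : Matrix (Fin N) (Fin (N + 1)) ℂ) (T : Matrix (Fin (N + 1)) (Fin N) ℂ),
      ((1 : Matrix α α ℂ) ⊗ₖ T) * (((1 : Matrix α α ℂ) ⊗ₖ B) * ρ * ((1 : Matrix α α ℂ) ⊗ₖ B)ᴴ) *
        ((1 : Matrix α α ℂ) ⊗ₖ T)ᴴ = ρ := by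
  obtain ⟨j, hj⟩ := Function.ne_iff.mp hf
  replace hj : f j ≠ 0 := hj
  -- `Z` is the projection onto `f` along the coordinate hyperplane `j`. Since `ρ` kills its range,
  -- `ρ` is recovered from its restriction to the other coordinates.
  set Z : Matrix (Fin (N + 1)) (Fin (N + 1)) ℂ := vecMulVec f (Pi.single j (f j)⁻¹) with hZ
  refine ⟨Matrix.of fun k l => if l = j.succAbove k then 1 else 0,
    Matrix.of fun i k => (1 - Z)ᴴ i (j.succAbove k), ?_⟩
  have hTB : (Matrix.of fun i k => (1 - Z)ᴴ i (j.succAbove k) : Matrix (Fin (N + 1)) (Fin N) ℂ) *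
      (Matrix.of fun k l => if l = j.succAbove k then 1 else 0 : Matrix (Fin N) (Fin (N + 1)) ℂ) =
        (1 - Z)ᴴ := by
    ext i l
    rw [Matrix.mul_apply]
    rcases Fin.eq_self_or_eq_succAbove j l with rfl | ⟨k, rfl⟩
    · have : (1 - Z)ᴴ i l = 0 := by
        simp only [conjTranspose_apply, Matrix.sub_apply, Matrix.one_apply, hZ, vecMulVec_apply]
        by_cases hil : l = i
        · subst hil
          simp [hj]
        · simp [hil, Ne.symm hil]
      rw [this]
      exact Finset.sum_eq_zero fun k _ => by simp [(Fin.succAbove_ne l k).symm]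
    · simp
  rw [kron_conj_kron_conj, hTB]
  have hρZ : ρ * ((1 : Matrix α α ℂ) ⊗ₖ Z) = 0 := by
    ext ⟨a, i⟩ ⟨a', l⟩
    have := congrFun (h0 a a') i
    simp only [mulVec, dotProduct, blockA, of_apply, Pi.zero_apply] at this
    simp only [Matrix.mul_apply, Fintype.sum_prod_type, kroneckerMap_apply, hZ, vecMulVec_apply,
      Matrix.zero_apply]
    rw [Finset.sum_eq_single a']
    · simp only [Matrix.one_apply_eq, one_mul, ← mul_assoc]
      rw [← Finset.sum_mul, this, zero_mul]
    · intro c _ hc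
      simp [Matrix.one_apply_ne hc]
    · simp
  have e : ((1 : Matrix α α ℂ) ⊗ₖ (1 - Z)ᴴ)ᴴ = 1 - (1 : Matrix α α ℂ) ⊗ₖ Z := by
    rw [conjTranspose_kronecker, conjTranspose_conjTranspose, conjTranspose_one]
    ext x y
    rw [← one_kronecker_one]
    exact mul_sub _ _ _
  have e' : ρ * ((1 : Matrix α α ℂ) ⊗ₖ (1 - Z)ᴴ)ᴴ = ρ := by
    rw [e, Matrix.mul_sub, hρZ, Matrix.mul_one, sub_zero]
  have e'' := congrArg conjTranspose e'
  rw [conjTranspose_mul, conjTranspose_conjTranspose, h.eq] at e''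
  rw [e'', e']

omit [DecidableEq β] in
/-- An extremal operator with a singular first block is separable or compressible. -/
lemma IsExtremal.mem_sepCone_or_of_mulVec_eq_zero {ρ : Matrix (Fin 2 × β) (Fin 2 × β) ℂ}
    (h : IsExtremal ρ) {f : β → ℂ} (hf : blockA ρ 0 0 *ᵥ f = 0) :
    ρ ∈ sepCone (Fin 2) β ∨ ∀ a a', blockA ρ a a' *ᵥ f = 0 := by
  have h01 : ∀ a : Fin 2, a = 0 ∨ a = 1 := by decide
  have mv : ∀ (σ : Matrix (Fin 2 × β) (Fin 2 × β) ℂ) (c a : Fin 2) (i : β),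
      (σ *ᵥ fun x => if x.1 = c then f x.2 else 0) (a, i) = (blockA σ a c *ᵥ f) i := by
    intro σ c a i
    simp only [mulVec, dotProduct, Fintype.sum_prod_type, blockA, of_apply]
    rw [Finset.sum_eq_single c]
    · simp
    · intro b _ hb
      simp [hb]
    · simp
  have ker : ∀ σ : Matrix (Fin 2 × β) (Fin 2 × β) ℂ, σ.PosSemidef → blockA σ 0 0 *ᵥ f = 0 →
      blockA σ 1 0 *ᵥ f = 0 := by
    intro σ hσ h0
    have : σ *ᵥ (fun x : Fin 2 × β => if x.1 = 0 then f x.2 else 0) = 0 := by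
      rw [← hσ.dotProduct_mulVec_zero_iff, dotProduct, Fintype.sum_prod_type]
      refine Finset.sum_eq_zero fun a _ => Finset.sum_eq_zero fun i _ => ?_
      rw [mv]
      rcases h01 a with rfl | rfl
      · rw [h0]
        simp
      · simp
    ext i
    rw [← mv, this]
    rfl
  -- Positivity of `ρ` and of its partial transpose kill both off-diagonal blocks on `f`. Thus `ρ`
  -- and its partial transpose both map `e₁ ⊗ f` to the real product vector `e₁ ⊗ (S f)`, where `S`
  -- is the last block.
  have k1 : blockA ρ 1 0 *ᵥ f = 0 := ker ρ h.1.1 hf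
  have k2 : blockA ρ 0 1 *ᵥ f = 0 := ker _ h.1.2 hf
  by_cases hg : blockA ρ 1 1 *ᵥ f = 0
  · right
    intro a a'
    rcases h01 a with rfl | rfl <;> rcases h01 a' with rfl | rfl <;> assumption
  left
  obtain ⟨ε, hε, p⟩ := exists_sub_ketBra_mulVec_posSemidef h.1.1
    (fun x => if x.1 = 1 then f x.2 else 0)
  obtain ⟨ε', hε', p'⟩ := exists_sub_ketBra_mulVec_posSemidef h.1.2
    (fun x => if x.1 = 1 then f x.2 else 0)
  have g : (ρ *ᵥ fun x => if x.1 = 1 then f x.2 else 0) =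
      fun x => ![0, 1] x.1 * (blockA ρ 1 1 *ᵥ f) x.2 := by
    ext ⟨a, i⟩
    rw [mv]
    rcases h01 a with rfl | rfl
    · rw [k2]
      simp
    · simp
  have g' : (partialTransposeA ρ *ᵥ fun x => if x.1 = 1 then f x.2 else 0) =
      fun x => star ![0, 1] x.1 * (blockA ρ 1 1 *ᵥ f) x.2 := by
    ext ⟨a, i⟩
    rw [mv, blockA_partialTransposeA]
    rcases h01 a with rfl | rfl
    · rw [k1]
      simp
    · simp
  rw [g] at p
  rw [g'] at p'
  exact h.mem_sepCone (fun h0 => one_ne_zero (congrFun h0 1)) hg hε hε' p p'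

/-- In dimensions `2 × N` with `N ≤ 3`, positive partial transpose implies separability. -/
theorem IsPPT.mem_sepCone_two {N : ℕ} (hN : N ≤ 3) {ρ : Matrix (Fin 2 × Fin N) (Fin 2 × Fin N) ℂ}
    (h : IsPPT ρ) : ρ ∈ sepCone (Fin 2) (Fin N) := by
  induction N with
  | zero =>
    have : ρ = 0 := by
      ext x
      exact x.2.elim0
    rw [this]
    exact zero_mem _
  | succ N ih =>
    refine h.mem_sepCone_of_extremal fun ρ hρ => ?_
    have hP : (blockA ρ 0 0).PosSemidef := hρ.1.1.submatrix fun b => (0, b)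
    by_cases hdet : (blockA ρ 0 0).det = 0
    · obtain ⟨f, hf, hPf⟩ := exists_mulVec_eq_zero_iff.mpr hdet
      rcases hρ.mem_sepCone_or_of_mulVec_eq_zero hPf with hs | hs
      · exact hs
      · obtain ⟨B, T, e⟩ := exists_compression hρ.1.1.isHermitian hf hs
        rw [← e]
        exact sepCone_conj _ _ (ih (by omega) (hρ.1.conj B))
    -- A local change of basis on `B` turns an invertible first block into the identity, preserving
    -- extremality and separability.
    · obtain ⟨C, hC⟩ := exists_eq_conjTranspose_mul_self hP
      have hCu : IsUnit C.det := by
        rw [isUnit_iff_ne_zero]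
        intro h0
        rw [hC, det_mul, h0, mul_zero] at hdet
        exact hdet rfl
      have hinv : C * C⁻¹ = 1 := mul_nonsing_inv C hCu
      have hBC : (C⁻¹)ᴴ * Cᴴ = 1 := by rw [← conjTranspose_mul, hinv, conjTranspose_one]
      have hCB : Cᴴ * (C⁻¹)ᴴ = 1 := mul_eq_one_comm.mp hBC
      have hmem := (hρ.conj hBC).mem_sepCone_of_blockA_eq_one (Nat.succ_pos N) hN (by
        rw [blockA_kron_conj, hC, conjTranspose_conjTranspose]
        calc (C⁻¹)ᴴ * (Cᴴ * C) * C⁻¹ = ((C⁻¹)ᴴ * Cᴴ) * (C * C⁻¹) := by simp only [Matrix.mul_assoc]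
          _ = 1 := by rw [hBC, hinv, Matrix.one_mul])
      have := sepCone_conj (1 : Matrix (Fin 2) (Fin 2) ℂ) Cᴴ hmem
      rwa [kron_conj_kron_conj, hCB, one_kron_conj_one] at this

theorem mem_sepCone_of_ppt_three_two {ρ : Matrix (Fin 3 × Fin 2) (Fin 3 × Fin 2) ℂ}
    (h : ρ.PosSemidef) (hT : (partialTransposeA ρ).PosSemidef) : ρ ∈ sepCone (Fin 3) (Fin 2) := by
  have hflip : IsPPT (ρ.submatrix Prod.swap Prod.swap) :=
    ⟨h.submatrix _, (hT.submatrix Prod.swap).transpose⟩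
  simpa using submatrix_swap_mem_sepCone (hflip.mem_sepCone_two le_rfl)

end Reduction

/-! ### Case distinction over the dimensions. -/

section Main

variable {α β : Type*} [Fintype α] [Fintype β] [DecidableEq α] [DecidableEq β]

omit [DecidableEq β] in
lemma mem_sepCone_of_subsingleton_left [Subsingleton α] {ρ : Matrix (α × β) (α × β) ℂ}
    (h : ρ.PosSemidef) : ρ ∈ sepCone α β := by
  convert kron_mem_sepCone (PosSemidef.one (n := α) (R := ℂ)) (posSemidef_traceA h) using 1
  ext ⟨a, b⟩ ⟨a', b'⟩
  rw [Subsingleton.elim a' a]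
  simp [traceA, Fintype.sum_subsingleton _ a]

omit [DecidableEq α] in
lemma mem_sepCone_of_subsingleton_right [Subsingleton β] {ρ : Matrix (α × β) (α × β) ℂ}
    (h : ρ.PosSemidef) : ρ ∈ sepCone α β := by
  have := submatrix_swap_mem_sepCone (mem_sepCone_of_subsingleton_left (h.submatrix Prod.swap))
  simpa using this

/-- Entangled states passing the first `k` tests exist as soon as there is a positive nonseparable
operator with positive partial transpose. -/
lemma exists_isEntangled_mem_passing_of_ppt_fin {dA dB : ℕ}
    {ρ : Matrix (Fin dA × Fin dB) (Fin dA × Fin dB) ℂ} (h : ρ.PosSemidef)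
    (hT : (partialTransposeA ρ).PosSemidef) (hs : ρ ∉ sepCone (Fin dA) (Fin dB)) {k : ℕ}
    (hk : 1 ≤ k) : ∃ ρ : Matrix (Fin dA × Fin dB) (Fin dA × Fin dB) ℂ, IsEntangled ρ ∧
      ∀ j, 1 ≤ j → j ≤ k → ρ ∈ passing (Fin dA) (Fin dB) j := by
  by_cases hA : dA ≤ 1
  · have : Subsingleton (Fin dA) := Fin.subsingleton_iff_le_one.mpr hA
    exact absurd (mem_sepCone_of_subsingleton_left h) hs
  by_cases hB : dB ≤ 1
  · have : Subsingleton (Fin dB) := Fin.subsingleton_iff_le_one.mpr hB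
    exact absurd (mem_sepCone_of_subsingleton_right h) hs
  by_cases h2 : dA = 2
  · subst h2
    exact exists_isEntangled_mem_passing_of_ppt h hT hs hk
  by_cases h32 : dA = 3 ∧ dB = 2
  · obtain ⟨rfl, rfl⟩ := h32
    exact absurd (mem_sepCone_of_ppt_three_two h hT) hs
  -- All remaining dimensions contain `3 × 3` or `4 × 2`; the given operator is discarded in favour
  -- of an invariant one.
  obtain ⟨ρ, h, hT, hs⟩ := exists_partialTransposeA_eq (m := dA) (n := dB) (by omega)
  exact exists_isEntangled_mem_passing_of_partialTransposeA_eq h hT hs hk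

lemma exists_ppt_of_lt_mul {dA dB : ℕ} (hA : 2 ≤ dA) (hB : 2 ≤ dB) (h : 6 < dA * dB) :
    ∃ ρ : Matrix (Fin dA × Fin dB) (Fin dA × Fin dB) ℂ,
      ρ.PosSemidef ∧ (partialTransposeA ρ).PosSemidef ∧ ρ ∉ sepCone (Fin dA) (Fin dB) := by
  by_cases h2 : dA = 2
  · subst h2
    exact exists_ppt_two (by omega)
  obtain ⟨ρ, h, hT, hs⟩ := exists_partialTransposeA_eq (m := dA) (n := dB) (by
    by_cases h3 : dA = 3
    · subst h3
      omega
    · omega)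
  exact ⟨ρ, h, by rwa [hT], hs⟩

end Main

end PPTHierarchy

theorem mainTheorem4 (dA dB : ℕ) :
    ((∃ ρ : Matrix (Fin dA × Fin dB) (Fin dA × Fin dB) ℂ, PPTHierarchy.IsPPTEntangled ρ) →
      ∀ k : ℕ, 1 ≤ k →
        ∃ ρ : Matrix (Fin dA × Fin dB) (Fin dA × Fin dB) ℂ,
          PPTHierarchy.IsEntangled ρ ∧ ρ ∈ PPTHierarchy.passing (Fin dA) (Fin dB) k) ∧
    (2 ≤ dA → 2 ≤ dB → 6 < dA * dB →
      (∀ k : ℕ, 1 ≤ k →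
        ∃ ρ : Matrix (Fin dA × Fin dB) (Fin dA × Fin dB) ℂ,
          PPTHierarchy.IsEntangled ρ ∧
          ∀ j : ℕ, 1 ≤ j → j ≤ k → ρ ∈ PPTHierarchy.passing (Fin dA) (Fin dB) j) ∧
      ¬ PPTHierarchy.Collapses (Fin dA) (Fin dB)) := by
  refine ⟨?_, fun hA hB h => ?_⟩
  · rintro ⟨ρ, ⟨⟨h, htr⟩, hs⟩, hT⟩ k hk
    have hs' : ρ ∉ PPTHierarchy.sepCone (Fin dA) (Fin dB) := fun hmem =>
      hs (PPTHierarchy.isSeparable_iff.mpr ⟨hmem, htr⟩)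
    obtain ⟨ρ', hρ', hp⟩ := PPTHierarchy.exists_isEntangled_mem_passing_of_ppt_fin h hT hs' hk
    exact ⟨ρ', hρ', hp k hk le_rfl⟩
  · obtain ⟨ρ, hρ, hT, hs⟩ := PPTHierarchy.exists_ppt_of_lt_mul hA hB h
    have key := fun k hk =>
      PPTHierarchy.exists_isEntangled_mem_passing_of_ppt_fin hρ hT hs (k := k) hk
    refine ⟨key, ?_⟩
    -- If the hierarchy stopped at `n`, an entangled state passing test `n` would pass all later
    -- tests and hence be separable.
    rintro ⟨n, hn, hc⟩
    obtain ⟨ρ', ⟨hst, hns⟩, hp⟩ := key n hn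
    have : Nonempty (Fin dA) := ⟨⟨0, by omega⟩⟩
    refine hns (PPTHierarchy.isSeparable_iff.mpr
      ⟨PPTHierarchy.mem_sepCone_of_forall_mem_passing (n := n) fun k hk => ?_, hst.2⟩)
    rw [hc k hk]
    exact hp n hn le_rfl
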